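/- **Conventions.** A *cone* is a nonempty open set $C\subseteq\mathbb R^2$ with $tC\subseteq C$ for all real $t\ne0$. For a map $\phi$ of the plane put $\phi^z(\mathbf x)=z^{-1}\phi(z\mathbf x)$ for $z\neq0$ and $\phi^0(\mathbf x)=\mathbf x$. All identities between maps on a cone $C$ are identities of germs at its vertex: they hold at $z\mathbf x$ for all small $z\ne0$, locally uniformly in $\mathbf x\in C$. In this sense we say that maps *commute*, that a function is *rational* on $C$ (it agrees with a rational function), or *algebraic* on $C$ (it is a root of a nonzero polynomial with coefficients in $\mathbb R[x,y]$). A *(smooth) projective flow* on $C$ is a map $\phi=u\bullet v:=(u,v)$ such that $(z,\mathbf x)\mapsto\phi^z(\mathbf x)$ is $C^\infty$ near $\{0\}\times C$, $\phi^{z+w}=\phi^z\circ\phi^w$ for small $z,w$ (locally uniformly on $C$), and $\phi^z(\mathbf x)\to\mathbf x$ as $z\to0$. Its vector field is $\varpi\bullet\varrho=\frac{d}{dz}\phi^z(\mathbf x)|_{z=0}$; it is *rational* if $\varpi,\varrho$ are rational functions defined on $C$. An *orbit function* of a flow with rational vector field is a nonzero $1$-homogeneous rational function $\mathscr W$ with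 $\mathscr W\varrho+\mathscr W_x(y\varpi-x\varrho)=0$. The flow is *algebraic of level $1$* if its vector field is rational, $y\varpi-x\varrho\ne0$, it has a (rational) orbit function, and $u,v$ are algebraic. A *$1$-BIR* is a birational map of $\mathbb R^2$ with $1$-homogeneous coordinates. **Theorem.** 1. Let $\phi,\psi$ be projective flows on a cone $C$, different from the identity, with rational vector fields, which commute. Let $\varpi\bullet\varrho$ be the vector field of $\phi$ and suppose $y\varpi-x\varrho\neq0$, and that $\psi\ne\phi^c$ for all $c\in\mathbb R$. Then $\phi$ and $\psi$ are algebraic flows of level $1$. 2. Let $\phi$ be an algebraic flow of level $1$ on a cone $C$. Then there are a cone $C'\subseteq C$, dense in $C$, and an algebraic flow $\psi$ of level $1$ on $C'$, with $\psi\neq\phi^c$ for all $c\in\mathbb R$, such that for all $z,w\in\mathbb R$ the map $\phi^z\circ\psi^w$ is a projective flow on $C'$ which commutes with $\phi$; and conversely, every projective flow $\eta$ on a cone $D\subseteq C$ which commutes with $\phi$, where $D=S\cup(-S)$ with $S$ connected or $\eta$ has a rational vector field, equals $\phi^z\circ\psi^w$ on $D\cap C'$ for some $z,w\in\mathbb R$.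 3. Let $\mathscr V$ be a $1$-homogeneous rational function which is not of the form $cy$, $c\in\mathbb R$, and let $C_{\mathscr V}$ be the set of points where $\mathscr V$ is defined and $\mathscr V_x\neq0$; it is a cone and is dense in $\mathbb R^2$. On $C_{\mathscr V}$ there are functions $a,u$ with $$\mathscr V\Big(a,\frac{y}{y+1}\Big)=\mathscr V(x,y),\qquad \mathscr V(u,y)=\frac{\mathscr V(x,y)}{1-\mathscr V(x,y)},$$ on the branches given by $z^{-1}a(z\mathbf x)\to x$ and $z^{-1}u(z\mathbf x)\to x$ as $z\to0$, locally uniformly. For any such $a,u$ on any cone $C\subseteq C_{\mathscr V}$: the maps $\psi=a\bullet\frac{y}{y+1}$ and $\phi=u\bullet y$ are algebraic projective flows of level $1$ on $C$ and commute; $a$ is rational if and only if $u$ is. 4. With $a,u,\phi,\psi,C$ as in 3, let $z,w\in\mathbb R$ and let $u^z(x,y)=z^{-1}u(zx,zy)$, $u^0(x,y)=x$, and similarly for $a^w$. Then $$\phi^z\circ\psi^w=u^z\Big(a^w(x,y),\frac{y}{1+wy}\Big)\bullet\frac{y}{1+wy}$$ is a projective flow on $C$. If $(z,w)\ne(0,0)$,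 then its vector field is rational, $z\mathscr V+wy\ne 0$, and its orbits are given by $$\frac{\mathscr V(x,y)\,y}{z\mathscr V(x,y)+wy}=\mathrm{const},$$ that is, the left side is an orbit function of $\phi^z\circ\psi^w$ and is constant along its orbits. 5. Let $\phi,\psi$ be commuting algebraic projective flows of level $1$ on a cone $C$ with $\psi\ne\phi^c$ for all $c\in\mathbb R$. Then there are $\mathscr V$, $a$, $u$ as in 3 (on $C_{\mathscr V}$), a $1$-BIR $\ell$, and a cone $D\subseteq C$, dense in $C$, with $\ell(D)\subseteq C_{\mathscr V}$, such that on $D$ $$\phi=\ell^{-1}\circ(u\bullet y)\circ\ell,\qquad \psi=\ell^{-1}\circ\Big(a\bullet\frac{y}{y+1}\Big)\circ\ell.$$ -/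

import Mathlib

open scoped Topology ContDiff

namespace ProjFlow

noncomputable section

/-! ### Rational functions of two real variables -/

/-- The real plane; `p 0` is the coordinate `x` and `p 1` is the coordinate `y`. -/
abbrev Plane := Fin 2 → ℝ

/-- The field `ℝ(x, y)` of rational functions. -/
abbrev RatFun := FractionRing (MvPolynomial (Fin 2) ℝ)

/-- The coordinate functions `x` (for `i = 0`) and `y` (for `i = 1`) as rational functions. -/
def coord (i : Fin 2) : RatFun := algebraMap (MvPolynomial (Fin 2) ℝ) RatFun (MvPolynomial.X i)

/-- A real constant as a rational function. -/
def const (c : ℝ) : RatFun := algebraMap (MvPolynomial (Fin 2) ℝ) RatFun (MvPolynomial.C c)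

/-- The reduced numerator. -/
def numer (f : RatFun) : MvPolynomial (Fin 2) ℝ := IsFractionRing.num (MvPolynomial (Fin 2) ℝ) f

/-- The reduced denominator. -/
def denom (f : RatFun) : MvPolynomial (Fin 2) ℝ :=
  (IsFractionRing.den (MvPolynomial (Fin 2) ℝ) f : MvPolynomial (Fin 2) ℝ)

/-- The rational function `f`, in lowest terms, has a nonvanishing denominator at `p`. -/
def DefinedAt (f : RatFun) (p : Plane) : Prop := MvPolynomial.eval p (denom f) ≠ 0

/-- The value of `f` at a point where it is defined. -/
def val (f : RatFun) (p : Plane) : ℝ :=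
  MvPolynomial.eval p (numer f) / MvPolynomial.eval p (denom f)

/-- The partial derivative of a rational function in the variable number `i` (quotient rule). -/
def pd (i : Fin 2) (f : RatFun) : RatFun :=
  algebraMap (MvPolynomial (Fin 2) ℝ) RatFun
      (MvPolynomial.pderiv i (numer f) * denom f - numer f * MvPolynomial.pderiv i (denom f)) /
    algebraMap (MvPolynomial (Fin 2) ℝ) RatFun (denom f) ^ 2

/-- `f` is an `n`-homogeneous rational function: a quotient of homogeneous polynomials whose
degrees differ by `n`. -/
def IsHomog (n : ℕ) (f : RatFun) : Prop :=
  ∃ (d : ℕ) (P Q : MvPolynomial (Fin 2) ℝ), P.IsHomogeneous (d + n) ∧ Q.IsHomogeneous d ∧ Q ≠ 0 ∧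
    f = algebraMap (MvPolynomial (Fin 2) ℝ) RatFun P / algebraMap (MvPolynomial (Fin 2) ℝ) RatFun Q

/-! ### Germs at the vertex of a cone -/

/-- The cones over which (possibly ramified) flows live: nonempty open subsets of the plane which
are stable under multiplication with nonzero reals. -/
structure IsFlowDomain (C : Set Plane) : Prop where
  isOpen : IsOpen C
  nonempty : C.Nonempty
  smul_mem : ∀ p ∈ C, ∀ t : ℝ, t ≠ 0 → t • p ∈ C

/-- The cone `C` consists of a connected set together with its opposite. -/
def IsDoubleSector (C : Set Plane) : Prop :=
  ∃ S : Set Plane, IsConnected S ∧ ∀ p, p ∈ C ↔ p ∈ S ∨ -p ∈ S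

/-- `R` holds at all points `z • q` of the cone `C` with `z ≠ 0` small, locally uniformly
in `q ∈ C`. -/
def NearVertex (C : Set Plane) (R : Plane → Prop) : Prop :=
  ∀ p ∈ C, ∀ᶠ x : ℝ × Plane in 𝓝 ((0 : ℝ), p), x.1 ≠ 0 → R (x.1 • x.2)

/-- The two maps coincide near the vertex of `C`. -/
def GermEq (C : Set Plane) (f g : Plane → Plane) : Prop :=
  NearVertex C fun q => f q = g q

/-- The two maps commute near the vertex of `C`. -/
def Commutes (C : Set Plane) (f g : Plane → Plane) : Prop :=
  NearVertex C fun q => f (g q) = g (f q)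

/-- `f` is an algebraic function near the vertex of `C`: it is a root of a nonzero polynomial with
coefficients in `ℝ[x, y]`. -/
def IsAlgebraicFun (C : Set Plane) (f : Plane → ℝ) : Prop :=
  ∃ P : Polynomial (MvPolynomial (Fin 2) ℝ), P ≠ 0 ∧
    NearVertex C fun q => (P.map (MvPolynomial.eval q)).eval (f q) = 0

/-- `f` is a rational function near the vertex of `C`. -/
def IsRationalFun (C : Set Plane) (f : Plane → ℝ) : Prop :=
  ∃ r : RatFun, NearVertex C fun q => DefinedAt r q ∧ f q = val r q

/-! ### Projective flows -/

/-- `φ^z(𝐱) = z⁻¹ φ(z𝐱)`, with `φ^0 = id`. -/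
def flowPow (φ : Plane → Plane) (z : ℝ) (p : Plane) : Plane :=
  if z = 0 then p else z⁻¹ • φ (z • p)

/-- A smooth projective flow on the cone `C`: the translation equation
`φ^(z+w) = φ^z ∘ φ^w` holds for small `z`, `w`, and `φ^z(𝐱) → 𝐱` as `z → 0`. -/
structure IsProjectiveFlow (C : Set Plane) (φ : Plane → Plane) : Prop where
  domain : IsFlowDomain C
  smooth : ∀ p ∈ C, ∀ᶠ x : ℝ × Plane in 𝓝 ((0 : ℝ), p),
    ContDiffAt ℝ ∞ (fun y : ℝ × Plane => flowPow φ y.1 y.2) x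
  translation : ∀ p ∈ C, ∀ᶠ x : (ℝ × ℝ) × Plane in 𝓝 (((0 : ℝ), (0 : ℝ)), p),
    flowPow φ (x.1.1 + x.1.2) x.2 = flowPow φ x.1.1 (flowPow φ x.1.2 x.2)
  boundary : ∀ p ∈ C, Filter.Tendsto (fun z : ℝ => z⁻¹ • φ (z • p)) (𝓝[≠] 0) (𝓝 p)

/-- The vector field `d/dz φ^z(𝐱)` at `z = 0` is given on `C` by the pair of rational functions
`ϖ`, `ϱ`, both defined everywhere on `C`. -/
def HasRationalField (C : Set Plane) (φ : Plane → Plane) (ϖ ϱ : RatFun) : Prop :=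
  ∀ p ∈ C, DefinedAt ϖ p ∧ DefinedAt ϱ p ∧
    HasDerivAt (fun z : ℝ => flowPow φ z p) ![val ϖ p, val ϱ p] 0

/-- `W` is a rational equation for the orbits of the flow with vector field `ϖ`, `ϱ`: a nonzero
`1`-homogeneous solution of `W ϱ + W_x (y ϖ - x ϱ) = 0`. -/
def IsOrbitFunction (ϖ ϱ W : RatFun) : Prop :=
  W ≠ 0 ∧ IsHomog 1 W ∧ W * ϱ + pd 0 W * (coord 1 * ϖ - coord 0 * ϱ) = 0

/-- `W` is constant along the orbits `z ↦ φ^z(𝐱)`, for small `z`. -/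
def IsConserved (C : Set Plane) (φ : Plane → Plane) (W : RatFun) : Prop :=
  ∀ p ∈ C, ∀ᶠ x : ℝ × Plane in 𝓝 ((0 : ℝ), p), DefinedAt W x.2 →
    DefinedAt W (flowPow φ x.1 x.2) ∧ val W (flowPow φ x.1 x.2) = val W x.2

/-- An algebraic projective flow of level `1`: its vector field is rational, it is not of level `0`
(that is, `y ϖ - x ϱ ≠ 0`), the `1`-homogeneous equation of its orbits is a rational function (so
that `N = 1` is the least positive integer whose power makes it rational), and both coordinates of
the flow are algebraic functions. -/
def IsAlgebraicFlowOfLevelOne (C : Set Plane) (φ : Plane → Plane) : Prop :=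
  IsProjectiveFlow C φ ∧
    (∃ ϖ ϱ : RatFun, HasRationalField C φ ϖ ϱ ∧ coord 1 * ϖ - coord 0 * ϱ ≠ 0 ∧
      ∃ W : RatFun, IsOrbitFunction ϖ ϱ W) ∧
    IsAlgebraicFun C (fun q => φ q 0) ∧ IsAlgebraicFun C (fun q => φ q 1)

/-! ### The explicit construction -/

/-- The points where `V` is defined and `V_x ≠ 0`. -/
def regularCone (V : RatFun) : Set Plane :=
  {p | DefinedAt V p ∧ DefinedAt (pd 0 V) p ∧ val (pd 0 V) p ≠ 0}

/-- The branch condition: `z⁻¹ f(z𝐱) → x` as `z → 0`, locally uniformly on `C`. -/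
def IsMainBranch (C : Set Plane) (f : Plane → ℝ) : Prop :=
  ∀ p ∈ C, Filter.Tendsto (fun x : ℝ × Plane => x.1⁻¹ * f (x.1 • x.2))
    (𝓝[{x : ℝ × Plane | x.1 ≠ 0}] ((0 : ℝ), p)) (𝓝 (p 0))

/-- `a` is the branch of the function determined by `V(a, y / (y + 1)) = V(x, y)`. -/
def IsSolutionA (V : RatFun) (C : Set Plane) (a : Plane → ℝ) : Prop :=
  IsMainBranch C a ∧ NearVertex C fun q => val V ![a q, q 1 / (q 1 + 1)] = val V q

/-- `u` is the branch of the function determined by `V(u, y) = V(x, y) / (1 - V(x, y))`. -/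
def IsSolutionU (V : RatFun) (C : Set Plane) (u : Plane → ℝ) : Prop :=
  IsMainBranch C u ∧ NearVertex C fun q => val V ![u q, q 1] = val V q / (1 - val V q)

/-- The map `a • y / (y + 1)`. -/
def flowOfA (a : Plane → ℝ) (q : Plane) : Plane := ![a q, q 1 / (q 1 + 1)]

/-- The map `u • y`. -/
def flowOfU (u : Plane → ℝ) (q : Plane) : Plane := ![u q, q 1]

/-- `f^z(𝐱) = z⁻¹ f(z𝐱)` for the first coordinate `f` of a flow, with `f^0(x, y) = x`. -/
def firstPow (f : Plane → ℝ) (z : ℝ) (p : Plane) : ℝ :=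
  if z = 0 then p 0 else z⁻¹ * f (z • p)

/-! ### Birational transformations -/

/-- A birational transformation `ℓ` of the plane is an `ℝ`-automorphism `f ↦ f ∘ ℓ` of `ℝ(x, y)`;
its coordinates are the images of `x` and `y`. It is a `1`-BIR if these are `1`-homogeneous. -/
def IsOneBir (σ : RatFun ≃ₐ[ℝ] RatFun) : Prop :=
  ∀ i : Fin 2, IsHomog 1 (σ (coord i))

/-- The birational map as a map on points (where its coordinates are defined). -/
def birMap (σ : RatFun ≃ₐ[ℝ] RatFun) (p : Plane) : Plane := fun i => val (σ (coord i)) p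

/-- The birational map is defined at `p`. -/
def BirDefinedAt (σ : RatFun ≃ₐ[ℝ] RatFun) (p : Plane) : Prop :=
  ∀ i : Fin 2, DefinedAt (σ (coord i)) p

/-- The conjugate `ℓ⁻¹ ∘ φ ∘ ℓ`. -/
def conj (σ : RatFun ≃ₐ[ℝ] RatFun) (φ : Plane → Plane) : Plane → Plane :=
  birMap σ.symm ∘ φ ∘ birMap σ

end

end ProjFlow

/-!
The vector field of a projective flow is `2`-homogeneous, and the field `F` of a flow `φ` together
with the radial field `E` forms a frame of the plane wherever `y ϖ - x ϱ ≠ 0`. The whole theory is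
linear algebra in this frame, where `[E, F] = F`.

*Commuting flows.* If the flow of `H = a F + b E` commutes with `φ`, then `[F, H] = 0`, that is,
`F(a) = b` and `F(b) = 0` (`fderiv_fld_comm`, `fderiv_coef`). If both fields are rational, so are
`a` and `b`, and `b ≠ 0` unless the second flow is a power of the first
(`exists_coef_of_commutes`). Such a pair is called level one data for `φ` (`IsLevelOneData`). Along
trajectories `b` is constant and `a` grows with velocity `b`; as `a` and `b` are algebraically
independent, the two equations `a ∘ φ = a + b`, `b ∘ φ = b` determine `φ` up to finitely many
possibilities, so that its coordinates are algebraic functions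
(`IsLevelOneData.isAlgebraicFun`). The first flow has level one data with respect to the second, too
(`IsLevelOneData.dual`), and this proves that commuting flows are algebraic of level one.

*Charts.* The functions `V = -b / a` and `Y = -b` are `1`-homogeneous coordinates, and
`V² ∂_V` is the field `F` while `-Y² ∂_Y` is the field `a F + b E`. So in these coordinates the flows
become `(V, Y) ↦ (V / (1 - z V), Y / (1 + w Y))`. Conversely let `V`, `Y` be any `1`-homogeneous
rational functions with independent differentials on a cone (`IsChart`). A map which has this form
in the coordinates and is close to the identity near the vertex (`IsStraight`) is unique as a germ
(`IsChart.germEq`) and is a projective flow (`IsChart.isProjectiveFlow`); it exists by lifting of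
paths, since the scaling `z⁻¹ φ(z 𝐱)` turns a germ at the vertex into a local statement
(`liftFlow`); a flow is straight if its field is (`IsChart.isStraight_of_dval_fld`). All straight
flows of a chart commute with each other and the function `V Y / (z V + w Y)` is constant along
their orbits. The two functional equations for `a` and `u` say that `a • y / (y + 1)` and `u • y` are
straight in the chart `V`, `y` (`IsSolutionA.isStraight`, `IsSolutionU.isStraight`). If one of them
is rational, then the direction of a point can be recovered rationally from the value of `V / y`
(`IsChart.exists_direction`), so that `V / y` is a Möbius function of `x / y` (`exists_moebius`), and
then both are given by explicit rational expressions.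

*The centralizer.* For a flow of level one with orbit function `b` a rational `a` with `F(a) = b` has
to be found. The direction `x / y` of a point on a trajectory is an algebraic function of the time.
Differentiation of an algebraic relation of minimal degree between the time and the direction shows
that the time, up to a constant, is a rational function of the direction
(`exists_wronskian_of_relation`, `exists_isLevelOneData`). With level one data `a`, `b` at hand the
coefficients of an arbitrary field which commutes with `F` differ from `k + l a` and `l b` only in
that `k` and `l` are locally constant functions of the direction
(`IsLevelOneData.hasFDerivAt_coef`). They are constant if the field is rational, and also on a double
sector: on the two sides of a singular line of `a` or `b` the constants agree, as can be seen from
the derivatives of the smooth field there (`exists_eq_of_isDoubleSector`). Hence the commuting flows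
are precisely the straight flows of the chart (`exists_centralizer`).

*Conjugation.* The map `𝐱 ↦ c(𝐱) 𝐱` with `c` homogeneous of degree zero multiplies
`1`-homogeneous functions by `c`. Therefore the map with `c = -b / y` transforms the chart `y / a`,
`y` into the chart `-b / a`, `-b` (`IsStraight.conj_radial`, `exists_conj_of_commutes`).
-/


namespace ProjFlow

/-! ### Values of rational functions -/

/-- The ring of polynomials in the two coordinates. -/
abbrev Poly := MvPolynomial (Fin 2) ℝ

/-- A polynomial regarded as a rational function. -/
noncomputable abbrev ofPoly : Poly →+* RatFun := algebraMap Poly RatFun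

theorem ofPoly_injective : Function.Injective ofPoly := IsFractionRing.injective Poly RatFun

theorem denom_ne_zero (f : RatFun) : denom f ≠ 0 :=
  nonZeroDivisors.ne_zero (IsFractionRing.den Poly f).2

theorem ofPoly_ne_zero {P : Poly} (h : P ≠ 0) : ofPoly P ≠ 0 := by
  rwa [Ne, ← map_zero ofPoly, ofPoly_injective.eq_iff]

theorem mul_denom (f : RatFun) : f * ofPoly (denom f) = ofPoly (numer f) := by
  have h : ofPoly (numer f) / ofPoly (denom f) = f := IsFractionRing.mk'_num_den' Poly f
  exact ((div_eq_iff (ofPoly_ne_zero (denom_ne_zero f))).1 h).symm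

theorem eq_numer_div_denom (f : RatFun) : f = ofPoly (numer f) / ofPoly (denom f) :=
  (IsFractionRing.mk'_num_den' Poly f).symm

/-- A fraction representing `f` is obtained from the reduced one by multiplying the numerator and
the denominator with the same polynomial. -/
theorem exists_eq_mul_of_mul_eq {f : RatFun} {P Q : Poly} (h : f * ofPoly Q = ofPoly P) :
    ∃ k, Q = denom f * k ∧ P = numer f * k := by
  have h1 : numer f * Q = P * denom f := by
    apply ofPoly_injective
    rw [map_mul, map_mul, ← mul_denom, ← h]; ring
  have h2 : denom f ∣ Q := by
    have hr : IsRelPrime (numer f) (denom f) := IsFractionRing.num_den_reduced Poly f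
    exact hr.symm.dvd_of_dvd_mul_left ⟨P, by rw [h1]; ring⟩
  obtain ⟨k, rfl⟩ := h2
  refine ⟨k, rfl, ?_⟩
  have := denom_ne_zero f
  apply mul_right_cancel₀ this
  rw [← h1]; ring

theorem definedAt_of_mul_eq {f : RatFun} {P Q : Poly} (h : f * ofPoly Q = ofPoly P) {p : Plane}
    (hQ : MvPolynomial.eval p Q ≠ 0) : DefinedAt f p := by
  obtain ⟨k, rfl, rfl⟩ := exists_eq_mul_of_mul_eq h
  rw [map_mul] at hQ
  exact left_ne_zero_of_mul hQ

theorem val_mul_eval_of_mul_eq {f : RatFun} {P Q : Poly} (h : f * ofPoly Q = ofPoly P) {p : Plane}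
    (hf : DefinedAt f p) : val f p * MvPolynomial.eval p Q = MvPolynomial.eval p P := by
  obtain ⟨k, rfl, rfl⟩ := exists_eq_mul_of_mul_eq h
  unfold DefinedAt at hf
  rw [val, map_mul, map_mul]
  field_simp

theorem val_mul_denom {f : RatFun} {p : Plane} (hf : DefinedAt f p) :
    val f p * MvPolynomial.eval p (denom f) = MvPolynomial.eval p (numer f) :=
  val_mul_eval_of_mul_eq (mul_denom f) hf

theorem val_eq_of_mul_eq {f : RatFun} {P Q : Poly} (h : f * ofPoly Q = ofPoly P) {p : Plane}
    (hQ : MvPolynomial.eval p Q ≠ 0) :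
    val f p = MvPolynomial.eval p P / MvPolynomial.eval p Q := by
  rw [eq_div_iff hQ, val_mul_eval_of_mul_eq h (definedAt_of_mul_eq h hQ)]

section
variable {f g : RatFun} {p : Plane}

theorem definedAt_ofPoly (P : Poly) (p : Plane) : DefinedAt (ofPoly P) p :=
  definedAt_of_mul_eq (P := P) (Q := 1) (by rw [map_one, mul_one]) (by simp)

@[simp] theorem val_ofPoly (P : Poly) (p : Plane) : val (ofPoly P) p = MvPolynomial.eval p P := by
  rw [val_eq_of_mul_eq (Q := 1) (P := P) (by rw [map_one, mul_one]) (by simp)]; simp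

theorem definedAt_coord (i : Fin 2) (p : Plane) : DefinedAt (coord i) p := definedAt_ofPoly _ p

@[simp] theorem val_coord (i : Fin 2) (p : Plane) : val (coord i) p = p i := by
  rw [coord, val_ofPoly, MvPolynomial.eval_X]

theorem definedAt_const (c : ℝ) (p : Plane) : DefinedAt (const c) p := definedAt_ofPoly _ p

@[simp] theorem val_const (c : ℝ) (p : Plane) : val (const c) p = c := by
  rw [const, val_ofPoly, MvPolynomial.eval_C]

theorem const_zero : const 0 = 0 := by simp [const]
theorem const_one : const 1 = 1 := by simp [const]

theorem const_injective : Function.Injective const :=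
  ofPoly_injective.comp (MvPolynomial.C_injective _ _)

theorem const_ne_zero {c : ℝ} (h : c ≠ 0) : const c ≠ 0 := by
  rwa [← const_zero, Ne, const_injective.eq_iff]

@[simp] theorem val_zero : val 0 p = 0 := by rw [← const_zero, val_const]
@[simp] theorem val_one : val 1 p = 1 := by rw [← const_one, val_const]
theorem definedAt_one : DefinedAt 1 p := by rw [← const_one]; exact definedAt_const 1 p

theorem add_mul_denoms (f g : RatFun) : (f + g) * ofPoly (denom f * denom g) =
    ofPoly (numer f * denom g + numer g * denom f) := by
  simp only [map_mul, map_add, ← mul_denom]; ring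

theorem mul_mul_denoms (f g : RatFun) : (f * g) * ofPoly (denom f * denom g) =
    ofPoly (numer f * numer g) := by
  simp only [map_mul, ← mul_denom]; ring

theorem DefinedAt.add (hf : DefinedAt f p) (hg : DefinedAt g p) : DefinedAt (f + g) p :=
  definedAt_of_mul_eq (add_mul_denoms f g) (by rw [map_mul]; exact mul_ne_zero hf hg)

theorem val_add (hf : DefinedAt f p) (hg : DefinedAt g p) : val (f + g) p = val f p + val g p := by
  rw [val_eq_of_mul_eq (add_mul_denoms f g) (by rw [map_mul]; exact mul_ne_zero hf hg), val, val]
  unfold DefinedAt at hf hg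
  simp only [map_mul, map_add]; field_simp

theorem DefinedAt.mul (hf : DefinedAt f p) (hg : DefinedAt g p) : DefinedAt (f * g) p :=
  definedAt_of_mul_eq (mul_mul_denoms f g) (by rw [map_mul]; exact mul_ne_zero hf hg)

theorem val_mul (hf : DefinedAt f p) (hg : DefinedAt g p) : val (f * g) p = val f p * val g p := by
  rw [val_eq_of_mul_eq (mul_mul_denoms f g) (by rw [map_mul]; exact mul_ne_zero hf hg), val, val]
  unfold DefinedAt at hf hg
  simp only [map_mul]; field_simp

theorem neg_eq_const_mul (f : RatFun) : -f = const (-1) * f := by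
  rw [const, MvPolynomial.C_neg, map_neg, MvPolynomial.C_1, map_one, neg_one_mul]

theorem DefinedAt.neg (hf : DefinedAt f p) : DefinedAt (-f) p := by
  rw [neg_eq_const_mul]; exact (definedAt_const _ p).mul hf

theorem val_neg (hf : DefinedAt f p) : val (-f) p = -val f p := by
  rw [neg_eq_const_mul, val_mul (definedAt_const _ p) hf, val_const, neg_one_mul]

theorem DefinedAt.sub (hf : DefinedAt f p) (hg : DefinedAt g p) : DefinedAt (f - g) p := by
  rw [sub_eq_add_neg]; exact hf.add hg.neg

theorem val_sub (hf : DefinedAt f p) (hg : DefinedAt g p) : val (f - g) p = val f p - val g p := by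
  rw [sub_eq_add_neg, val_add hf hg.neg, val_neg hg, sub_eq_add_neg]

theorem DefinedAt.pow (hf : DefinedAt f p) (n : ℕ) : DefinedAt (f ^ n) p := by
  induction n with
  | zero => rw [pow_zero]; exact definedAt_one
  | succ n ih => rw [pow_succ]; exact ih.mul hf

theorem val_pow (hf : DefinedAt f p) (n : ℕ) : val (f ^ n) p = val f p ^ n := by
  induction n with
  | zero => simp
  | succ n ih => rw [pow_succ, val_mul (hf.pow n) hf, ih, pow_succ]

theorem ne_zero_of_val_ne_zero (h : val f p ≠ 0) : f ≠ 0 := by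
  rintro rfl; exact h val_zero

theorem inv_mul_numer (hf : f ≠ 0) : f⁻¹ * ofPoly (numer f) = ofPoly (denom f) := by
  rw [← mul_denom]; field_simp

theorem numer_eval_ne_zero (hf : DefinedAt f p) (h : val f p ≠ 0) :
    MvPolynomial.eval p (numer f) ≠ 0 := by
  rw [← val_mul_denom hf]; exact mul_ne_zero h hf

theorem DefinedAt.inv (hf : DefinedAt f p) (h : val f p ≠ 0) : DefinedAt f⁻¹ p :=
  definedAt_of_mul_eq (inv_mul_numer (ne_zero_of_val_ne_zero h)) (numer_eval_ne_zero hf h)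

theorem val_inv (hf : DefinedAt f p) (h : val f p ≠ 0) : val f⁻¹ p = (val f p)⁻¹ := by
  have h1 := val_mul (hf.inv h) hf
  rw [inv_mul_cancel₀ (ne_zero_of_val_ne_zero h), val_one] at h1
  exact eq_inv_of_mul_eq_one_left h1.symm

theorem DefinedAt.div (hf : DefinedAt f p) (hg : DefinedAt g p) (h : val g p ≠ 0) :
    DefinedAt (f / g) p := by
  rw [div_eq_mul_inv]; exact hf.mul (hg.inv h)

theorem val_div (hf : DefinedAt f p) (hg : DefinedAt g p) (h : val g p ≠ 0) :
    val (f / g) p = val f p / val g p := by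
  rw [div_eq_mul_inv, val_mul hf (hg.inv h), val_inv hg h, div_eq_mul_inv]

end

/-! ### Generic points -/

theorem mvPolynomial_eq_zero_of_open {P : Poly} {U : Set Plane} (hU : IsOpen U) (hne : U.Nonempty)
    (h : ∀ p ∈ U, MvPolynomial.eval p P = 0) : P = 0 := by
  obtain ⟨p, hp⟩ := hne
  obtain ⟨ε, hε, hb⟩ := Metric.isOpen_iff.1 hU p hp
  refine MvPolynomial.funext_set (fun i => Metric.ball (p i) ε) (fun i => ?_) (q := 0) ?_
  · rw [Real.ball_eq_Ioo]; exact Set.Ioo_infinite (by linarith)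
  · intro x hx
    rw [map_zero]
    apply h _ (hb _)
    rw [ball_pi _ hε]; exact hx

/-- A property of points of the plane is generic if it holds off the zero set of some nonzero
polynomial. -/
def Generic (R : Plane → Prop) : Prop :=
  ∃ S : Poly, S ≠ 0 ∧ ∀ p, MvPolynomial.eval p S ≠ 0 → R p

theorem Generic.and {R R' : Plane → Prop} (h : Generic R) (h' : Generic R') :
    Generic fun p => R p ∧ R' p := by
  obtain ⟨S, hS, h⟩ := h
  obtain ⟨S', hS', h'⟩ := h'
  refine ⟨S * S', mul_ne_zero hS hS', fun p hp => ?_⟩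
  rw [map_mul] at hp
  exact ⟨h p (left_ne_zero_of_mul hp), h' p (right_ne_zero_of_mul hp)⟩

theorem Generic.mono {R R' : Plane → Prop} (h : Generic R) (hi : ∀ p, R p → R' p) :
    Generic R' := by
  obtain ⟨S, hS, h⟩ := h
  exact ⟨S, hS, fun p hp => hi p (h p hp)⟩

theorem Generic.exists_mem {R : Plane → Prop} (h : Generic R) {U : Set Plane} (hU : IsOpen U)
    (hne : U.Nonempty) : ∃ p ∈ U, R p := by
  obtain ⟨S, hS, h⟩ := h
  by_contra! hc
  exact hS (mvPolynomial_eq_zero_of_open hU hne fun p hp => by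
    by_contra h0; exact hc p hp (h p h0))

theorem Generic.dense {R : Plane → Prop} (h : Generic R) : Dense {p | R p} := by
  rw [dense_iff_inter_open]
  intro U hU hne
  obtain ⟨p, hp, hR⟩ := h.exists_mem hU hne
  exact ⟨p, hp, hR⟩

theorem generic_definedAt (f : RatFun) : Generic (DefinedAt f) :=
  ⟨denom f, denom_ne_zero f, fun _ h => h⟩

theorem numer_ne_zero {f : RatFun} (hf : f ≠ 0) : numer f ≠ 0 := by
  intro h
  apply hf
  rw [eq_numer_div_denom f, h, map_zero, zero_div]

theorem generic_val_ne_zero {f : RatFun} (hf : f ≠ 0) :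
    Generic fun p => DefinedAt f p ∧ val f p ≠ 0 :=
  ((generic_definedAt f).and ⟨numer f, numer_ne_zero hf, fun _ h => h⟩).mono fun _ h =>
    ⟨h.1, div_ne_zero h.2 h.1⟩

theorem Generic.inter {C : Set Plane} {R : Plane → Prop} (h : Generic R) (hC : IsOpen C) :
    C ⊆ closure {p | p ∈ C ∧ R p} := by
  have := h.dense.open_subset_closure_inter hC
  exact this

theorem ratFun_eq_zero_of_val {f : RatFun} {U : Set Plane} (hU : IsOpen U) (hne : U.Nonempty)
    (h : ∀ p ∈ U, DefinedAt f p → val f p = 0) : f = 0 := by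
  by_contra hf
  obtain ⟨p, hp, h1, h2⟩ := (generic_val_ne_zero hf).exists_mem hU hne
  exact h2 (h p hp h1)

theorem ratFun_eq_of_val {f g : RatFun} {U : Set Plane} (hU : IsOpen U) (hne : U.Nonempty)
    (h : ∀ p ∈ U, DefinedAt f p → DefinedAt g p → val f p = val g p) : f = g := by
  rw [← sub_eq_zero]
  by_contra hf
  obtain ⟨p, hp, ⟨h1, h2⟩, h3, h4⟩ := ((generic_val_ne_zero hf).and
    ((generic_definedAt f).and (generic_definedAt g))).exists_mem hU hne
  exact h2 (by rw [val_sub h3 h4, h p hp h3 h4, sub_self])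

theorem isOpen_definedAt (f : RatFun) : IsOpen {p | DefinedAt f p} :=
  isOpen_ne_fun (MvPolynomial.continuous_eval _) continuous_const

/-! ### Partial derivatives -/

theorem contDiff_eval (P : Poly) {n : WithTop ℕ∞} :
    ContDiff ℝ n fun p : Plane => MvPolynomial.eval p P := by
  have h := AnalyticOnNhd.eval_mvPolynomial (𝕜 := ℝ) P
  exact h.contDiff

/-- The linear form with coefficients `a` and `b`. -/
noncomputable def linForm (a b : ℝ) : Plane →L[ℝ] ℝ :=
  a • ContinuousLinearMap.proj 0 + b • ContinuousLinearMap.proj 1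

@[simp] theorem linForm_apply (a b : ℝ) (v : Plane) : linForm a b v = a * v 0 + b * v 1 := by
  simp [linForm]

theorem hasFDerivAt_eval (P : Poly) (p : Plane) :
    HasFDerivAt (fun q : Plane => MvPolynomial.eval q P)
      (linForm (MvPolynomial.eval p (MvPolynomial.pderiv 0 P))
        (MvPolynomial.eval p (MvPolynomial.pderiv 1 P))) p := by
  induction P using MvPolynomial.induction_on with
  | C a =>
    simp only [MvPolynomial.eval_C, MvPolynomial.pderiv_C, map_zero]
    convert hasFDerivAt_const a p using 1
    ext v; simp
  | add P Q hP hQ =>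
    simp only [map_add]
    refine (hP.add hQ).congr_fderiv ?_
    ext v; simp; ring
  | mul_X P i hP =>
    simp only [map_mul, MvPolynomial.eval_X, MvPolynomial.pderiv_mul]
    refine (hP.mul (hasFDerivAt_apply (𝕜 := ℝ) i p)).congr_fderiv ?_
    ext v
    fin_cases i <;> simp [MvPolynomial.pderiv_X] <;> ring

theorem definedAt_pd {f : RatFun} {p : Plane} (hf : DefinedAt f p) (i : Fin 2) :
    DefinedAt (pd i f) p := by
  refine definedAt_of_mul_eq (Q := denom f ^ 2) ?_ (by rw [map_pow]; exact pow_ne_zero 2 hf)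
    (P := MvPolynomial.pderiv i (numer f) * denom f - numer f * MvPolynomial.pderiv i (denom f))
  rw [pd, map_pow, div_mul_cancel₀]
  exact pow_ne_zero 2 (ofPoly_ne_zero (denom_ne_zero f))

theorem val_pd {f : RatFun} {p : Plane} (hf : DefinedAt f p) (i : Fin 2) :
    val (pd i f) p = (MvPolynomial.eval p (MvPolynomial.pderiv i (numer f)) *
      MvPolynomial.eval p (denom f) - MvPolynomial.eval p (numer f) *
      MvPolynomial.eval p (MvPolynomial.pderiv i (denom f))) / MvPolynomial.eval p (denom f) ^ 2 := by
  rw [val_eq_of_mul_eq (Q := denom f ^ 2) (f := pd i f)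
    (P := MvPolynomial.pderiv i (numer f) * denom f - numer f * MvPolynomial.pderiv i (denom f)) ?_
    (by rw [map_pow]; exact pow_ne_zero 2 hf)]
  · simp only [map_mul, map_sub, map_pow]
  · rw [pd, map_pow, div_mul_cancel₀]
    exact pow_ne_zero 2 (ofPoly_ne_zero (denom_ne_zero f))

theorem contDiffAt_val {f : RatFun} {p : Plane} (hf : DefinedAt f p) {n : WithTop ℕ∞} :
    ContDiffAt ℝ n (val f) p :=
  (contDiff_eval _).contDiffAt.div (contDiff_eval _).contDiffAt hf

theorem hasFDerivAt_val {f : RatFun} {p : Plane} (hf : DefinedAt f p) :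
    HasFDerivAt (val f) (linForm (val (pd 0 f) p) (val (pd 1 f) p)) p := by
  have h := (hasFDerivAt_eval (numer f) p).mul
    (HasFDerivAt.comp (f := fun q : Plane => MvPolynomial.eval q (denom f)) p
      (hasFDerivAt_inv hf) (hasFDerivAt_eval (denom f) p))
  unfold DefinedAt at hf
  refine (h.congr_fderiv ?_).congr_of_eventuallyEq (Filter.Eventually.of_forall fun q => ?_)
  · ext v
    rw [linForm_apply, val_pd hf, val_pd hf]
    simp
    field_simp
    ring
  · simp [val, div_eq_mul_inv]

theorem eventually_definedAt {f : RatFun} {p : Plane} (hf : DefinedAt f p) :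
    ∀ᶠ q in 𝓝 p, DefinedAt f q := (isOpen_definedAt f).mem_nhds hf

theorem val_pd_eq {f : RatFun} {p : Plane} (hf : DefinedAt f p) {a b : ℝ}
    (h : HasFDerivAt (val f) (linForm a b) p) : val (pd 0 f) p = a ∧ val (pd 1 f) p = b := by
  have h1 := (hasFDerivAt_val hf).unique h
  have h0 := congrArg (fun l : Plane →L[ℝ] ℝ => l ![1, 0]) h1
  have h2 := congrArg (fun l : Plane →L[ℝ] ℝ => l ![0, 1]) h1
  simp at h0 h2
  exact ⟨h0, h2⟩

theorem pd_add (i : Fin 2) (f g : RatFun) : pd i (f + g) = pd i f + pd i g := by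
  refine ratFun_eq_of_val (U := {p | DefinedAt f p ∧ DefinedAt g p})
    ((isOpen_definedAt f).inter (isOpen_definedAt g))
    ((generic_definedAt f).and (generic_definedAt g)).dense.nonempty ?_
  rintro p ⟨hf, hg⟩ - -
  have h1 : HasFDerivAt (val (f + g)) (linForm (val (pd 0 f) p + val (pd 0 g) p)
      (val (pd 1 f) p + val (pd 1 g) p)) p := by
    refine (((hasFDerivAt_val hf).add (hasFDerivAt_val hg)).congr_fderiv ?_).congr_of_eventuallyEq ?_
    · ext v; simp; ring
    · filter_upwards [eventually_definedAt hf, eventually_definedAt hg] with q h1 h2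
      rw [val_add h1 h2]; rfl
  have h2 := val_pd_eq (hf.add hg) h1
  rw [val_add (definedAt_pd hf i) (definedAt_pd hg i)]
  fin_cases i
  exacts [h2.1, h2.2]

theorem pd_mul (i : Fin 2) (f g : RatFun) : pd i (f * g) = f * pd i g + g * pd i f := by
  refine ratFun_eq_of_val (U := {p | DefinedAt f p ∧ DefinedAt g p})
    ((isOpen_definedAt f).inter (isOpen_definedAt g))
    ((generic_definedAt f).and (generic_definedAt g)).dense.nonempty ?_
  rintro p ⟨hf, hg⟩ - -
  have h1 : HasFDerivAt (val (f * g)) (linForm (val f p * val (pd 0 g) p + val g p * val (pd 0 f) p)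
      (val f p * val (pd 1 g) p + val g p * val (pd 1 f) p)) p := by
    refine (((hasFDerivAt_val hf).mul (hasFDerivAt_val hg)).congr_fderiv ?_).congr_of_eventuallyEq ?_
    · ext v; simp; ring
    · filter_upwards [eventually_definedAt hf, eventually_definedAt hg] with q h1 h2
      rw [val_mul h1 h2]; rfl
  have h2 := val_pd_eq (hf.mul hg) h1
  rw [val_add (hf.mul (definedAt_pd hg i)) (hg.mul (definedAt_pd hf i)),
    val_mul hf (definedAt_pd hg i), val_mul hg (definedAt_pd hf i)]
  fin_cases i
  exacts [h2.1, h2.2]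

theorem pd_ofPoly (i : Fin 2) (P : Poly) : pd i (ofPoly P) = ofPoly (MvPolynomial.pderiv i P) := by
  refine ratFun_eq_of_val isOpen_univ Set.univ_nonempty fun p _ _ _ => ?_
  have h1 : HasFDerivAt (val (ofPoly P)) _ p :=
    (hasFDerivAt_eval P p).congr_of_eventuallyEq (Filter.Eventually.of_forall fun q => val_ofPoly P q)
  have h2 := val_pd_eq (definedAt_ofPoly P p) h1
  rw [val_ofPoly]
  fin_cases i
  exacts [h2.1, h2.2]

theorem pd_const (i : Fin 2) (c : ℝ) : pd i (const c) = 0 := by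
  rw [const, pd_ofPoly, MvPolynomial.pderiv_C, map_zero]

theorem pd_coord (i j : Fin 2) : pd i (coord j) = if i = j then 1 else 0 := by
  rw [coord, pd_ofPoly, MvPolynomial.pderiv_X]
  by_cases h : i = j
  · subst h; simp
  · rw [if_neg h, Pi.single_eq_of_ne (Ne.symm h), map_zero]

/-- The partial derivative in the variable number `i` as a derivation of the field `ℝ(x, y)`. -/
noncomputable def pdDer (i : Fin 2) : Derivation ℝ RatFun RatFun :=
  Derivation.mk'
    { toFun := pd i
      map_add' := pd_add i
      map_smul' := fun c f => by
        have h : ∀ g : RatFun, c • g = const c * g := fun g => by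
          rw [Algebra.smul_def, const, IsScalarTower.algebraMap_apply ℝ Poly RatFun]; rfl
        rw [h, pd_mul, pd_const, RingHom.id_apply, h]; ring }
    fun f g => by simp [pd_mul]

@[simp] theorem pdDer_apply (i : Fin 2) (f : RatFun) : pdDer i f = pd i f := rfl

/-- The derivation of `ℝ(x, y)` along the rational vector field with components `ϖ`, `ϱ`. -/
noncomputable def along (ϖ ϱ : RatFun) : Derivation ℝ RatFun RatFun :=
  ϖ • pdDer 0 + ϱ • pdDer 1

theorem along_apply (ϖ ϱ f : RatFun) : along ϖ ϱ f = ϖ * pd 0 f + ϱ * pd 1 f := by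
  simp [along]

@[simp] theorem along_coord_zero (ϖ ϱ : RatFun) : along ϖ ϱ (coord 0) = ϖ := by
  simp [along_apply, pd_coord]

@[simp] theorem along_coord_one (ϖ ϱ : RatFun) : along ϖ ϱ (coord 1) = ϱ := by
  simp [along_apply, pd_coord]

theorem definedAt_along {ϖ ϱ f : RatFun} {p : Plane} (h0 : DefinedAt ϖ p) (h1 : DefinedAt ϱ p)
    (hf : DefinedAt f p) : DefinedAt (along ϖ ϱ f) p := by
  rw [along_apply]
  exact (h0.mul (definedAt_pd hf 0)).add (h1.mul (definedAt_pd hf 1))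

theorem val_along {ϖ ϱ f : RatFun} {p : Plane} (h0 : DefinedAt ϖ p) (h1 : DefinedAt ϱ p)
    (hf : DefinedAt f p) :
    val (along ϖ ϱ f) p = val ϖ p * val (pd 0 f) p + val ϱ p * val (pd 1 f) p := by
  rw [along_apply, val_add (h0.mul (definedAt_pd hf 0)) (h1.mul (definedAt_pd hf 1)),
    val_mul h0 (definedAt_pd hf 0), val_mul h1 (definedAt_pd hf 1)]

/-- A rational function both of whose partial derivatives vanish is constant. -/
theorem exists_eq_const {f : RatFun} (h0 : pd 0 f = 0) (h1 : pd 1 f = 0) :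
    ∃ c : ℝ, f = const c := by
  obtain ⟨p, hp⟩ := (generic_definedAt f).dense.nonempty
  obtain ⟨ε, hε, hb⟩ := Metric.isOpen_iff.1 (isOpen_definedAt f) p hp
  refine ⟨val f p, ratFun_eq_of_val Metric.isOpen_ball ⟨p, Metric.mem_ball_self hε⟩
    fun q hq _ _ => ?_⟩
  rw [val_const]
  refine (convex_ball p ε).is_const_of_fderivWithin_eq_zero (𝕜 := ℝ) (f := val f) ?_ ?_ hq
    (Metric.mem_ball_self hε)
  · exact fun x hx => (hasFDerivAt_val (hb hx)).differentiableAt.differentiableWithinAt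
  · intro x hx
    rw [fderivWithin_of_isOpen Metric.isOpen_ball hx, (hasFDerivAt_val (hb hx)).fderiv, h0, h1]
    ext v; simp

end ProjFlow

namespace ProjFlow

/-! ### Homogeneous rational functions -/

theorem eval_smul_of_isHomogeneous {P : Poly} {d : ℕ} (hP : P.IsHomogeneous d) (t : ℝ)
    (p : Plane) : MvPolynomial.eval (t • p) P = t ^ d * MvPolynomial.eval p P := by
  rw [MvPolynomial.eval_eq', MvPolynomial.eval_eq', Finset.mul_sum]
  refine Finset.sum_congr rfl fun m hm => ?_
  have h : m 0 + m 1 = d := by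
    have := hP (MvPolynomial.mem_support_iff.1 hm)
    simpa [Finsupp.weight_apply, Finsupp.sum_fintype] using this
  simp only [Fin.prod_univ_two, Pi.smul_apply, smul_eq_mul, mul_pow, ← h, pow_add]
  ring

/-- The restriction of a polynomial to the line through the origin and `p`. -/
noncomputable def rayPoly (p : Plane) : Poly →ₐ[ℝ] Polynomial ℝ :=
  MvPolynomial.aeval fun i => p i • Polynomial.X

@[simp] theorem eval_rayPoly (p : Plane) (P : Poly) (t : ℝ) :
    (rayPoly p P).eval t = MvPolynomial.eval (t • p) P := by
  induction P using MvPolynomial.induction_on with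
  | C a => simp [rayPoly]
  | add P Q hP hQ => simp [hP, hQ]
  | mul_X P i hP => rw [map_mul, Polynomial.eval_mul, hP, map_mul]; simp [rayPoly]; left; ring

theorem coeff_rayPoly (p : Plane) (P : Poly) (j : ℕ) :
    (rayPoly p P).coeff j = MvPolynomial.eval p (MvPolynomial.homogeneousComponent j P) := by
  have h1 : ∀ i, rayPoly p (MvPolynomial.homogeneousComponent i P) =
      Polynomial.C (MvPolynomial.eval p (MvPolynomial.homogeneousComponent i P)) *
        Polynomial.X ^ i := fun i => by
    refine Polynomial.funext fun t => ?_
    rw [eval_rayPoly, eval_smul_of_isHomogeneous (MvPolynomial.homogeneousComponent_isHomogeneous i P),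
      Polynomial.eval_mul, Polynomial.eval_C, Polynomial.eval_pow, Polynomial.eval_X, mul_comm]
  conv_lhs => rw [← MvPolynomial.sum_homogeneousComponent P]
  rw [map_sum, Polynomial.finsetSum_coeff]
  simp only [h1, Polynomial.coeff_C_mul_X_pow]
  rw [Finset.sum_ite_eq]
  split_ifs with h
  · rfl
  · rw [MvPolynomial.homogeneousComponent_eq_zero, map_zero]
    simpa using h

/-- Homogeneity is defined by some homogeneous fraction, while domain of definition and values refer
to the reduced fraction; hence the detour through the uniqueness of the latter. -/
theorem IsHomog.definedAt_smul_and_val {n : ℕ} {f : RatFun} (h : IsHomog n f) {p : Plane}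
    (hf : DefinedAt f p) {t : ℝ} (ht : t ≠ 0) :
    DefinedAt f (t • p) ∧ val f (t • p) = t ^ n * val f p := by
  obtain ⟨d, P, Q, hP, hQ, hQ0, rfl⟩ := h
  set f : RatFun := ofPoly P / ofPoly Q with hfdef
  have hfQ : f * ofPoly Q = ofPoly P := div_mul_cancel₀ _ (ofPoly_ne_zero hQ0)
  let s : Poly →ₐ[ℝ] Poly := MvPolynomial.aeval fun i => MvPolynomial.C t⁻¹ * MvPolynomial.X i
  have hs : ∀ (R : Poly) (q : Plane),
      MvPolynomial.eval q (s R) = MvPolynomial.eval (t⁻¹ • q) R := fun R q => by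
    induction R using MvPolynomial.induction_on with
    | C a => simp [s]
    | add P Q hP hQ => simp [hP, hQ]
    | mul_X P i hP => rw [map_mul, map_mul, hP, map_mul]; simp [s]
  -- the reduced fraction, evaluated at `t⁻¹ • q` and rescaled, is another fraction for `f`
  have key : f * ofPoly (s (denom f)) = ofPoly (MvPolynomial.C (t ^ n) * s (numer f)) := by
    have hpoly : P * s (denom f) = MvPolynomial.C (t ^ n) * s (numer f) * Q := by
      refine MvPolynomial.funext fun q => ?_
      have e1 := congrArg (MvPolynomial.eval (t⁻¹ • q)) (ofPoly_injective (a₁ := P * denom f)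
        (a₂ := numer f * Q) (by rw [map_mul, map_mul, ← mul_denom, ← hfQ]; ring))
      simp only [map_mul, eval_smul_of_isHomogeneous hP, eval_smul_of_isHomogeneous hQ] at e1
      simp only [map_mul, hs, MvPolynomial.eval_C]
      have ht' : t ^ d * t⁻¹ ^ d = 1 := by rw [← mul_pow, mul_inv_cancel₀ ht, one_pow]
      have ht'' : t ^ n * t⁻¹ ^ n = 1 := by rw [← mul_pow, mul_inv_cancel₀ ht, one_pow]
      rw [pow_add] at e1
      linear_combination (t ^ d * t ^ n) * e1 -
        MvPolynomial.eval q P * MvPolynomial.eval (t⁻¹ • q) (denom f) * ht' * t ^ n * t⁻¹ ^ n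
        - MvPolynomial.eval q P * MvPolynomial.eval (t⁻¹ • q) (denom f) * ht''
        + t ^ n * MvPolynomial.eval q Q * MvPolynomial.eval (t⁻¹ • q) (numer f) * ht'
    have := congrArg ofPoly hpoly
    rw [map_mul, map_mul _ _ Q, ← hfQ] at this
    apply mul_right_cancel₀ (ofPoly_ne_zero hQ0)
    rw [← this]; ring
  have he : MvPolynomial.eval (t • p) (s (denom f)) = MvPolynomial.eval p (denom f) := by
    rw [hs, smul_smul, inv_mul_cancel₀ ht, one_smul]
  have hne : MvPolynomial.eval (t • p) (s (denom f)) ≠ 0 := by rw [he]; exact hf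
  refine ⟨definedAt_of_mul_eq key hne, ?_⟩
  rw [val_eq_of_mul_eq key hne, he, map_mul, hs, smul_smul, inv_mul_cancel₀ ht, one_smul,
    MvPolynomial.eval_C, val, mul_div_assoc]

theorem IsHomog.definedAt_smul {n : ℕ} {f : RatFun} (h : IsHomog n f) {p : Plane}
    (hf : DefinedAt f p) {t : ℝ} (ht : t ≠ 0) : DefinedAt f (t • p) :=
  (h.definedAt_smul_and_val hf ht).1

theorem IsHomog.val_smul {n : ℕ} {f : RatFun} (h : IsHomog n f) {p : Plane}
    (hf : DefinedAt f p) {t : ℝ} (ht : t ≠ 0) : val f (t • p) = t ^ n * val f p :=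
  (h.definedAt_smul_and_val hf ht).2

/-- Homogeneity of a rational function can be read off from its values on a cone: comparison of
coefficients along rays shows that a pair of homogeneous components of the numerator and of the
denominator represents the function. -/
theorem isHomog_of_val_smul {C : Set Plane} (hC : IsFlowDomain C) {n : ℕ} {f : RatFun}
    (h : ∀ p ∈ C, ∀ t : ℝ, t ≠ 0 → DefinedAt f p → DefinedAt f (t • p) →
      val f (t • p) = t ^ n * val f p) : IsHomog n f := by
  set N := numer f
  set M := denom f
  obtain ⟨j, hj⟩ : ∃ j, MvPolynomial.homogeneousComponent j M ≠ 0 := by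
    by_contra! hc
    apply denom_ne_zero f
    rw [← MvPolynomial.sum_homogeneousComponent (denom f)]
    exact Finset.sum_eq_zero fun i _ => hc i
  have key : ∀ p ∈ C, DefinedAt f p →
      MvPolynomial.eval p (MvPolynomial.homogeneousComponent (j + n) N * M) =
      MvPolynomial.eval p (N * MvPolynomial.homogeneousComponent j M) := by
    intro p hp hf
    have hM : rayPoly p M ≠ 0 := by
      intro h0
      have := congrArg (Polynomial.eval 1) h0
      rw [eval_rayPoly, one_smul, Polynomial.eval_zero] at this
      exact hf this
    -- homogeneity of the values along the ray of `p`, with the denominators cleared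
    have hpoly : rayPoly p N * Polynomial.C (MvPolynomial.eval p M) =
        Polynomial.X ^ n * rayPoly p M * Polynomial.C (MvPolynomial.eval p N) := by
      refine Polynomial.eq_of_infinite_eval_eq _ _ (Set.Infinite.mono (s :=
        ({t | (Polynomial.X * rayPoly p M).eval t = 0}ᶜ)) ?_ (Set.Finite.infinite_compl ?_))
      · intro t ht
        simp only [Set.mem_compl_iff, Set.mem_ofPred_eq, Polynomial.eval_mul, Polynomial.eval_X,
          eval_rayPoly, mul_eq_zero, not_or] at ht
        have hv := h p hp t ht.1 hf ht.2
        have h1 := val_mul_denom (f := f) (p := t • p) ht.2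
        have h2 := val_mul_denom hf
        simp only [Set.mem_ofPred_eq, Polynomial.eval_mul, Polynomial.eval_C, Polynomial.eval_pow,
          Polynomial.eval_X, eval_rayPoly]
        rw [← h1, ← h2, hv]; ring
      · exact (Polynomial.rootSet_finite (Polynomial.X * rayPoly p M) ℝ).subset fun t ht => by
          rw [Polynomial.mem_rootSet]
          exact ⟨mul_ne_zero Polynomial.X_ne_zero hM, by simpa using ht⟩
    -- the coefficient of degree `j + n` compares the homogeneous components
    have hc := congrArg (fun P => Polynomial.coeff P (j + n)) hpoly
    simp only [Polynomial.coeff_mul_C, mul_assoc, Polynomial.coeff_X_pow_mul, coeff_rayPoly] at hc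
    rw [map_mul, map_mul, hc]; ring
  have hpoly : MvPolynomial.homogeneousComponent (j + n) N * M =
      N * MvPolynomial.homogeneousComponent j M := by
    rw [← sub_eq_zero]
    refine mvPolynomial_eq_zero_of_open (hC.isOpen.inter (isOpen_definedAt f)) ?_ ?_
    · exact (generic_definedAt f).exists_mem hC.isOpen hC.nonempty
    · rintro p ⟨hp, hf⟩
      rw [map_sub, key p hp hf, sub_self]
  refine ⟨j, _, _, MvPolynomial.homogeneousComponent_isHomogeneous (j + n) N,
    MvPolynomial.homogeneousComponent_isHomogeneous j M, hj, ?_⟩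
  rw [eq_div_iff (ofPoly_ne_zero hj)]
  apply mul_right_cancel₀ (ofPoly_ne_zero (denom_ne_zero f))
  have e := congrArg ofPoly hpoly
  rw [map_mul, map_mul, ← mul_denom f] at e
  exact (e.trans (by ring)).symm

theorem isHomog_coord (i : Fin 2) : IsHomog 1 (coord i) :=
  ⟨0, MvPolynomial.X i, 1, by simpa using MvPolynomial.isHomogeneous_X ℝ i,
    MvPolynomial.isHomogeneous_one _ _, one_ne_zero, by rw [map_one, div_one]; rfl⟩

theorem isHomog_const (c : ℝ) : IsHomog 0 (const c) :=
  ⟨0, MvPolynomial.C c, 1, MvPolynomial.isHomogeneous_C _ _,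
    MvPolynomial.isHomogeneous_one _ _, one_ne_zero, by rw [map_one, div_one]; rfl⟩

theorem IsHomog.mul {m n : ℕ} {f g : RatFun} (hf : IsHomog m f) (hg : IsHomog n g) :
    IsHomog (m + n) (f * g) := by
  obtain ⟨d, P, Q, hP, hQ, hQ0, rfl⟩ := hf
  obtain ⟨d', P', Q', hP', hQ', hQ0', rfl⟩ := hg
  refine ⟨d + d', P * P', Q * Q', ?_, hQ.mul hQ', mul_ne_zero hQ0 hQ0', ?_⟩
  · have := hP.mul hP'
    rwa [show d + d' + (m + n) = d + m + (d' + n) by ring]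
  · rw [map_mul, map_mul, div_mul_div_comm]

theorem IsHomog.add {n : ℕ} {f g : RatFun} (hf : IsHomog n f) (hg : IsHomog n g) :
    IsHomog n (f + g) := by
  obtain ⟨d, P, Q, hP, hQ, hQ0, rfl⟩ := hf
  obtain ⟨d', P', Q', hP', hQ', hQ0', rfl⟩ := hg
  refine ⟨d + d', P * Q' + Q * P', Q * Q', ?_, hQ.mul hQ', mul_ne_zero hQ0 hQ0', ?_⟩
  · have h1 := hP.mul hQ'
    have h2 := hQ.mul hP'
    rw [show d + n + d' = d + d' + n by ring] at h1
    rw [← add_assoc] at h2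
    exact h1.add h2
  · rw [map_mul, map_add, map_mul, map_mul, div_add_div _ _ (ofPoly_ne_zero hQ0) (ofPoly_ne_zero hQ0')]

theorem IsHomog.neg {n : ℕ} {f : RatFun} (hf : IsHomog n f) : IsHomog n (-f) := by
  have := (isHomog_const (-1)).mul hf
  rwa [zero_add, ← neg_eq_const_mul] at this

theorem IsHomog.div {m n : ℕ} {f g : RatFun} (hf : IsHomog (m + n) f) (hg : IsHomog m g)
    (hg0 : g ≠ 0) : IsHomog n (f / g) := by
  obtain ⟨d, P, Q, hP, hQ, hQ0, rfl⟩ := hf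
  obtain ⟨d', P', Q', hP', hQ', hQ0', rfl⟩ := hg
  have hP0' : P' ≠ 0 := by rintro rfl; simp at hg0
  refine ⟨d + (d' + m), P * Q', Q * P', ?_, hQ.mul hP', mul_ne_zero hQ0 hP0', ?_⟩
  · have h1 := hP.mul hQ'
    rwa [show d + (m + n) + d' = d + (d' + m) + n by ring] at h1
  · rw [map_mul, map_mul, div_div_div_eq]

theorem IsHomog.euler {n : ℕ} {f : RatFun} (hf : IsHomog n f) :
    coord 0 * pd 0 f + coord 1 * pd 1 f = const n * f := by
  refine ratFun_eq_of_val (isOpen_definedAt f) (generic_definedAt f).dense.nonempty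
    fun p hp _ _ => ?_
  have h1 : HasDerivAt (fun t : ℝ => val f (t • p))
      (linForm (val (pd 0 f) p) (val (pd 1 f) p) p) 1 := by
    have h2 : HasDerivAt (fun t : ℝ => t • p) p 1 := by
      simpa using (hasDerivAt_id (1 : ℝ)).smul_const p
    have h3 : HasFDerivAt (val f) (linForm (val (pd 0 f) p) (val (pd 1 f) p)) ((1 : ℝ) • p) := by
      rw [one_smul]; exact hasFDerivAt_val hp
    exact h3.comp_hasDerivAt (1 : ℝ) h2
  have h4 : HasDerivAt (fun t : ℝ => t ^ n * val f p) (n * val f p) 1 := by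
    simpa using (hasDerivAt_pow n (1 : ℝ)).mul_const (val f p)
  have h5 := h1.unique (h4.congr_of_eventuallyEq (by
    filter_upwards [isOpen_ne.mem_nhds (one_ne_zero (α := ℝ))] with t ht
    exact hf.val_smul hp ht))
  have d0 := definedAt_pd hp 0
  have d1 := definedAt_pd hp 1
  rw [val_add ((definedAt_coord 0 p).mul d0) ((definedAt_coord 1 p).mul d1),
    val_mul (definedAt_coord 0 p) d0, val_mul (definedAt_coord 1 p) d1,
    val_mul (definedAt_const _ p) hp, val_const, val_coord, val_coord, ← h5]
  simp; ring

theorem algebraMap_real_eq_const (c : ℝ) : algebraMap ℝ RatFun c = const c := by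
  rw [IsScalarTower.algebraMap_apply ℝ Poly RatFun]; rfl

theorem definedAt_aeval {f : RatFun} {p : Plane} (hf : DefinedAt f p) (q : Polynomial ℝ) :
    DefinedAt (Polynomial.aeval f q) p ∧ val (Polynomial.aeval f q) p = q.eval (val f p) := by
  induction q using Polynomial.induction_on' with
  | add q r hq hr =>
    rw [map_add, Polynomial.eval_add]
    exact ⟨hq.1.add hr.1, by rw [val_add hq.1 hr.1, hq.2, hr.2]⟩
  | monomial n a =>
    rw [Polynomial.aeval_monomial, algebraMap_real_eq_const, Polynomial.eval_monomial]
    exact ⟨(definedAt_const a p).mul (hf.pow n),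
      by rw [val_mul (definedAt_const a p) (hf.pow n), val_const, val_pow hf]⟩

theorem definedAt_mvAeval {f : Fin 2 → RatFun} {p : Plane} (hf : ∀ i, DefinedAt (f i) p)
    (P : Poly) : DefinedAt (MvPolynomial.aeval f P) p ∧
      val (MvPolynomial.aeval f P) p = MvPolynomial.eval (fun i => val (f i) p) P := by
  induction P using MvPolynomial.induction_on with
  | C a => simpa [algebraMap_real_eq_const] using definedAt_const a p
  | add q r hq hr =>
    rw [map_add, map_add]
    exact ⟨hq.1.add hr.1, by rw [val_add hq.1 hr.1, hq.2, hr.2]⟩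
  | mul_X q i hq =>
    rw [map_mul, map_mul, MvPolynomial.aeval_X, MvPolynomial.eval_X]
    exact ⟨hq.1.mul (hf i), by rw [val_mul hq.1 (hf i), hq.2]⟩

/-- The linear form vanishing on the line through `p`. -/
noncomputable def lineForm (p : Plane) : RatFun := const (p 0) * coord 1 - const (p 1) * coord 0

theorem definedAt_lineForm (p q : Plane) : DefinedAt (lineForm p) q :=
  ((definedAt_const _ q).mul (definedAt_coord _ q)).sub
    ((definedAt_const _ q).mul (definedAt_coord _ q))

theorem val_lineForm (p q : Plane) : val (lineForm p) q = p 0 * q 1 - p 1 * q 0 := by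
  rw [lineForm, val_sub ((definedAt_const _ q).mul (definedAt_coord _ q))
    ((definedAt_const _ q).mul (definedAt_coord _ q)), val_mul (definedAt_const _ q)
    (definedAt_coord _ q), val_mul (definedAt_const _ q) (definedAt_coord _ q)]
  simp

theorem lineForm_ne_zero {p : Plane} (hp : p ≠ 0) : lineForm p ≠ 0 := by
  intro h
  apply hp
  have h0 := val_lineForm p ![1, 0]
  have h1 := val_lineForm p ![0, 1]
  rw [h, val_zero] at h0 h1
  simp at h0 h1
  ext i; fin_cases i
  · simpa using h1.symm
  · simpa using h0

theorem sq_add_sq_ne_zero {p : Plane} (hp : p ≠ 0) : p 0 ^ 2 + p 1 ^ 2 ≠ 0 := by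
  intro h
  apply hp
  ext i; fin_cases i
  · simp; nlinarith [sq_nonneg (p 0), sq_nonneg (p 1)]
  · simp; nlinarith [sq_nonneg (p 0), sq_nonneg (p 1)]

/-- The order of vanishing of a homogeneous polynomial along the line through `p`. With the linear
form `l = ⟨p, ·⟩ / |p|²` and `m` vanishing on that line, such a polynomial of degree `d` is
`l ^ d * q (m / l)` for a polynomial `q` in one variable. -/
theorem exists_order_of_isHomogeneous {P : Poly} {d : ℕ} (hP : P.IsHomogeneous d) (hP0 : P ≠ 0)
    {p : Plane} (hp : p ≠ 0) :
    ∃ (k : ℕ) (g : RatFun), ofPoly P = lineForm p ^ k * g ∧ DefinedAt g p ∧ val g p ≠ 0 := by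
  set r := p 0 ^ 2 + p 1 ^ 2 with hr
  have hr0 : r ≠ 0 := sq_add_sq_ne_zero hp
  let l : RatFun := const (p 0 / r) * coord 0 + const (p 1 / r) * coord 1
  let m : RatFun := lineForm p
  have dl : ∀ q, DefinedAt l q := fun q => ((definedAt_const _ q).mul (definedAt_coord _ q)).add
    ((definedAt_const _ q).mul (definedAt_coord _ q))
  have vl : ∀ q, val l q = (p 0 * q 0 + p 1 * q 1) / r := fun q => by
    rw [val_add ((definedAt_const _ q).mul (definedAt_coord _ q))
      ((definedAt_const _ q).mul (definedAt_coord _ q)), val_mul (definedAt_const _ q)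
      (definedAt_coord _ q), val_mul (definedAt_const _ q) (definedAt_coord _ q)]
    simp; field_simp
  have vlp : val l p = 1 := by rw [vl]; field_simp; rw [hr]
  have l0 : l ≠ 0 := ne_zero_of_val_ne_zero (p := p) (by rw [vlp]; exact one_ne_zero)
  -- the restriction of `P` to the line through `p` perpendicular to `p`, where `m` is the parameter
  let s : Polynomial ℝ := MvPolynomial.aeval
    ![Polynomial.C (p 0) - Polynomial.C (p 1 / r) * Polynomial.X,
      Polynomial.C (p 1) + Polynomial.C (p 0 / r) * Polynomial.X] P
  have hs : ∀ t, s.eval t = MvPolynomial.eval ![p 0 - p 1 / r * t, p 1 + p 0 / r * t] P := fun t => by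
    have : ∀ R : Poly, (MvPolynomial.aeval
      ![Polynomial.C (p 0) - Polynomial.C (p 1 / r) * Polynomial.X,
      Polynomial.C (p 1) + Polynomial.C (p 0 / r) * Polynomial.X] R : Polynomial ℝ).eval t =
      MvPolynomial.eval ![p 0 - p 1 / r * t, p 1 + p 0 / r * t] R := fun R => by
      induction R using MvPolynomial.induction_on with
      | C a => simp
      | add P Q hP hQ => simp [hP, hQ]
      | mul_X P i hP => rw [map_mul, Polynomial.eval_mul, hP, map_mul]; fin_cases i <;> simp
    exact this P
  have hPs : ofPoly P = l ^ d * Polynomial.aeval (m / l) s := by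
    refine ratFun_eq_of_val (U := {q | val l q ≠ 0}) (isOpen_ne_fun ?_ continuous_const)
      ⟨p, by simp [vlp]⟩ fun q hq _ _ => ?_
    · have e := funext vl
      change Continuous (val l)
      rw [e]; fun_prop
    · have h1 := (definedAt_lineForm p q).div (dl q) hq
      rw [val_mul ((dl q).pow d) (definedAt_aeval h1 s).1, (definedAt_aeval h1 s).2,
        val_div (definedAt_lineForm p q) (dl q) hq, val_pow (dl q), hs, val_ofPoly,
        ← eval_smul_of_isHomogeneous hP]
      have hT := mul_div_cancel₀ (val (lineForm p) q) hq
      set T := val (lineForm p) q / val l q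
      rw [vl, val_lineForm] at hT
      rw [vl]
      -- the point `q` is `l(q)` times a point of the perpendicular line
      have hq2 : ((p 0 * q 0 + p 1 * q 1) / r) •
          (![p 0 - p 1 / r * T, p 1 + p 0 / r * T] : Plane) = q := by
        ext i
        fin_cases i
        · have e : (p 0 * q 0 + p 1 * q 1) / r * (p 0 - p 1 / r * T) =
              ((p 0 * q 0 + p 1 * q 1) * p 0 - p 1 * (p 0 * q 1 - p 1 * q 0)) / r := by
            linear_combination (-(p 1 / r)) * hT
          simp only [Fin.zero_eta, Pi.smul_apply, Matrix.cons_val_zero, smul_eq_mul]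
          rw [e, div_eq_iff hr0, hr]; ring
        · have e : (p 0 * q 0 + p 1 * q 1) / r * (p 1 + p 0 / r * T) =
              ((p 0 * q 0 + p 1 * q 1) * p 1 + p 0 * (p 0 * q 1 - p 1 * q 0)) / r := by
            linear_combination (p 0 / r) * hT
          simp only [Fin.mk_one, Pi.smul_apply, Matrix.cons_val_one, Matrix.cons_val_fin_one,
            smul_eq_mul]
          rw [e, div_eq_iff hr0, hr]; ring
      rw [hq2]
  have hs0 : s ≠ 0 := by
    intro h
    rw [h, map_zero, mul_zero] at hPs
    exact ofPoly_ne_zero hP0 hPs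
  -- the order is the multiplicity of the zero of `s` at the parameter of `p`
  obtain ⟨u, hu, hdvd⟩ := Polynomial.exists_eq_pow_rootMultiplicity_mul_and_not_dvd s hs0 0
  set k := Polynomial.rootMultiplicity 0 s
  have h1 := (definedAt_lineForm p p).div (dl p) (by rw [vlp]; exact one_ne_zero)
  refine ⟨k, l ^ d * (l⁻¹ ^ k * Polynomial.aeval (m / l) u), ?_, ?_, ?_⟩
  · rw [hPs, hu]
    simp only [map_mul, map_pow, Polynomial.aeval_X, Polynomial.C_0, sub_zero]
    rw [div_pow, inv_pow]
    change _ = m ^ k * _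
    field_simp
  · exact ((dl p).pow d).mul ((((dl p).inv (by simp [vlp])).pow k).mul (definedAt_aeval h1 u).1)
  · have d1 := (dl p).inv (by simp [vlp])
    rw [val_mul ((dl p).pow d) ((d1.pow k).mul (definedAt_aeval h1 u).1),
      val_mul (d1.pow k) (definedAt_aeval h1 u).1, val_pow d1, val_pow (dl p),
      val_inv (dl p) (by simp [vlp]), vlp, (definedAt_aeval h1 u).2,
      val_div (definedAt_lineForm p p) (dl p) (by simp [vlp]), val_lineForm]
    simp only [one_pow, inv_one, one_mul]
    intro h
    apply hdvd
    rw [mul_comm (p 1), sub_self, zero_div] at h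
    rw [Polynomial.dvd_iff_isRoot, Polynomial.IsRoot, h]

/-- The order of a homogeneous rational function along the line through `p`. -/
theorem exists_order_of_isHomog {n : ℕ} {f : RatFun} (hf : IsHomog n f) (hf0 : f ≠ 0)
    {p : Plane} (hp : p ≠ 0) :
    ∃ (k : ℤ) (g : RatFun), f = lineForm p ^ k * g ∧ DefinedAt g p ∧ val g p ≠ 0 := by
  obtain ⟨d, P, Q, hP, hQ, hQ0, rfl⟩ := hf
  have hP0 : P ≠ 0 := by rintro rfl; simp at hf0
  obtain ⟨k, g, hk, hg, hg0⟩ := exists_order_of_isHomogeneous hP hP0 hp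
  obtain ⟨k', g', hk', hg', hg0'⟩ := exists_order_of_isHomogeneous hQ hQ0 hp
  have hm := lineForm_ne_zero hp
  refine ⟨k - k', g / g', ?_, hg.div hg' hg0', ?_⟩
  · change ofPoly P / ofPoly Q = _
    rw [hk, hk', zpow_sub₀ hm, zpow_natCast, zpow_natCast, mul_div_mul_comm]
  · rw [val_div hg hg' hg0']; exact div_ne_zero hg0 hg0'

end ProjFlow

namespace ProjFlow

/-! ### Projective flows and their vector fields -/

section Germs
variable {C C' : Set Plane} {φ ψ : Plane → Plane}

@[simp] theorem flowPow_zero (φ : Plane → Plane) (p : Plane) : flowPow φ 0 p = p := by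
  simp [flowPow]

theorem flowPow_of_ne (φ : Plane → Plane) {z : ℝ} (hz : z ≠ 0) (p : Plane) :
    flowPow φ z p = z⁻¹ • φ (z • p) := by simp [flowPow, hz]

theorem smul_flowPow (φ : Plane → Plane) {z : ℝ} (hz : z ≠ 0) (p : Plane) :
    z • flowPow φ z p = φ (z • p) := by
  rw [flowPow_of_ne φ hz, smul_inv_smul₀ hz]

theorem flowPow_smul (φ : Plane → Plane) (z : ℝ) {t : ℝ} (ht : t ≠ 0) (p : Plane) :
    flowPow φ z (t • p) = t • flowPow φ (z * t) p := by
  rcases eq_or_ne z 0 with rfl | hz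
  · simp
  · rw [flowPow_of_ne φ hz, flowPow_of_ne φ (mul_ne_zero hz ht), smul_smul, smul_smul]
    congr 1
    field_simp

theorem flowPow_flowPow (φ : Plane → Plane) (c t : ℝ) (p : Plane) :
    flowPow (flowPow φ c) t p = flowPow φ (c * t) p := by
  rcases eq_or_ne t 0 with rfl | ht
  · simp
  · rw [flowPow_of_ne _ ht, flowPow_smul φ c ht, inv_smul_smul₀ ht]

theorem flowPow_comp (φ ψ : Plane → Plane) (t : ℝ) (p : Plane) :
    flowPow (φ ∘ ψ) t p = flowPow φ t (flowPow ψ t p) := by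
  rcases eq_or_ne t 0 with rfl | ht
  · simp
  · rw [flowPow_of_ne _ ht, flowPow_of_ne φ ht, smul_flowPow ψ ht, Function.comp]

theorem IsFlowDomain.mem_of_smul_mem (hC : IsFlowDomain C) {p : Plane} {t : ℝ} (ht : t ≠ 0)
    (h : t • p ∈ C) : p ∈ C := by
  have := hC.smul_mem _ h t⁻¹ (inv_ne_zero ht)
  rwa [inv_smul_smul₀ ht] at this

theorem IsFlowDomain.mem_nhds (hC : IsFlowDomain C) {p : Plane} (hp : p ∈ C) : C ∈ 𝓝 p :=
  hC.isOpen.mem_nhds hp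

/-- A cone which contains the origin is the whole plane. -/
theorem IsFlowDomain.mem_of_zero_mem (hC : IsFlowDomain C) (h0 : (0 : Plane) ∈ C) (q : Plane) :
    q ∈ C := by
  have ht : Filter.Tendsto (fun t : ℝ => t • q) (𝓝[≠] 0) (𝓝 0) := by
    have h1 : ContinuousAt (fun t : ℝ => t • q) 0 := by fun_prop
    have h2 := h1.tendsto
    rw [zero_smul] at h2
    exact h2.mono_left nhdsWithin_le_nhds
  obtain ⟨t, h1, h2⟩ := ((ht.eventually (hC.mem_nhds h0)).and self_mem_nhdsWithin).exists
  exact hC.mem_of_smul_mem h2 h1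

theorem NearVertex.mono {R R' : Plane → Prop} (h : NearVertex C R) (hi : ∀ q, R q → R' q) :
    NearVertex C R' := fun p hp => (h p hp).mono fun _ hx h0 => hi _ (hx h0)

theorem NearVertex.and {R R' : Plane → Prop} (h : NearVertex C R) (h' : NearVertex C R') :
    NearVertex C fun q => R q ∧ R' q := fun p hp => by
  filter_upwards [h p hp, h' p hp] with x h1 h2 h0 using ⟨h1 h0, h2 h0⟩

theorem germEq_iff : GermEq C φ ψ ↔
    ∀ p ∈ C, ∀ᶠ x : ℝ × Plane in 𝓝 ((0 : ℝ), p), flowPow φ x.1 x.2 = flowPow ψ x.1 x.2 := by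
  refine forall₂_congr fun p _ => Filter.eventually_congr (Filter.Eventually.of_forall fun x => ?_)
  rcases eq_or_ne x.1 0 with h | h
  · simp [h]
  · rw [flowPow_of_ne φ h, flowPow_of_ne ψ h, (smul_right_injective Plane (inv_ne_zero h)).eq_iff]
    simp [h]

theorem commutes_iff : Commutes C φ ψ ↔ ∀ p ∈ C, ∀ᶠ x : ℝ × Plane in 𝓝 ((0 : ℝ), p),
    flowPow φ x.1 (flowPow ψ x.1 x.2) = flowPow ψ x.1 (flowPow φ x.1 x.2) := by
  simp only [← flowPow_comp]
  exact germEq_iff (φ := φ ∘ ψ) (ψ := ψ ∘ φ)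

theorem eventually_box {p : Plane} {R : ℝ × Plane → Prop}
    (h : ∀ᶠ x : ℝ × Plane in 𝓝 ((0 : ℝ), p), R x) :
    ∃ ε > 0, ∃ N ∈ 𝓝 p, ∀ t ∈ Set.Ioo (-ε) ε, ∀ q ∈ N, R (t, q) := by
  rw [nhds_prod_eq, Filter.eventually_prod_iff] at h
  obtain ⟨P, hP, Q, hQ, hPQ⟩ := h
  obtain ⟨ε, hε, hb⟩ := Metric.eventually_nhds_iff_ball.1 hP
  refine ⟨ε, hε, {q | Q q}, hQ, fun t ht q hq => hPQ (hb t ?_) hq⟩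
  rw [Real.ball_eq_Ioo]; simpa using ht

theorem eventually_of_box {p : Plane} {R : ℝ × Plane → Prop} {ε : ℝ} (hε : 0 < ε) {N : Set Plane}
    (hN : N ∈ 𝓝 p) (h : ∀ t ∈ Set.Ioo (-ε) ε, ∀ q ∈ N, R (t, q)) :
    ∀ᶠ x : ℝ × Plane in 𝓝 ((0 : ℝ), p), R x := by
  filter_upwards [prod_mem_nhds (Ioo_mem_nhds (neg_lt_zero.2 hε) hε) hN] with x hx
  exact h x.1 hx.1 x.2 hx.2

end Germs

/-- The vector field of a projective flow. -/
noncomputable def fld (φ : Plane → Plane) (p : Plane) : Plane := deriv (fun z => flowPow φ z p) 0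

theorem HasRationalField.fld_eq {C : Set Plane} {φ : Plane → Plane} {ϖ ϱ : RatFun}
    (h : HasRationalField C φ ϖ ϱ) {p : Plane} (hp : p ∈ C) :
    fld φ p = ![val ϖ p, val ϱ p] := (h p hp).2.2.deriv

theorem fld_smul (φ : Plane → Plane) {t : ℝ} (ht : t ≠ 0) (p : Plane) :
    fld φ (t • p) = t ^ 2 • fld φ p := by
  unfold fld
  simp only [flowPow_smul φ _ ht, mul_comm _ t]
  have h := deriv_comp_mul_left t (fun z => flowPow φ z p) 0
  rw [mul_zero] at h
  have h2 : deriv (fun z => t • flowPow φ (t * z) p) 0 =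
      t • deriv (fun z => flowPow φ (t * z) p) 0 :=
    deriv_fun_const_smul_field t _
  rw [h2, h, smul_smul, pow_two]

theorem fld_flowPow (φ : Plane → Plane) (c : ℝ) (p : Plane) :
    fld (flowPow φ c) p = c • fld φ p := by
  unfold fld
  simp only [flowPow_flowPow]
  have h := deriv_comp_mul_left c (fun z => flowPow φ z p) 0
  rw [h, mul_zero]

theorem fld_eq_of_germEq {C : Set Plane} {φ ψ : Plane → Plane} (h : GermEq C φ ψ) {p : Plane}
    (hp : p ∈ C) : fld φ p = fld ψ p := by
  refine Filter.EventuallyEq.deriv_eq ?_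
  have h1 : Filter.Tendsto (fun z : ℝ => (z, p)) (𝓝 0) (𝓝 ((0 : ℝ), p)) :=
    (Continuous.prodMk_left p).tendsto 0
  exact h1.eventually (germEq_iff.1 h p hp)

namespace IsProjectiveFlow
variable {C D : Set Plane} {φ ψ : Plane → Plane} {p : Plane}

theorem mono (h : IsProjectiveFlow C φ) (hD : IsFlowDomain D) (hDC : D ⊆ C) :
    IsProjectiveFlow D φ :=
  ⟨hD, fun p hp => h.smooth p (hDC hp), fun p hp => h.translation p (hDC hp),
    fun p hp => h.boundary p (hDC hp)⟩

theorem contDiffAt (h : IsProjectiveFlow C φ) (hp : p ∈ C) :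
    ContDiffAt ℝ ∞ (fun y : ℝ × Plane => flowPow φ y.1 y.2) ((0 : ℝ), p) :=
  (h.smooth p hp).self_of_nhds

theorem tendsto (h : IsProjectiveFlow C φ) (hp : p ∈ C) :
    Filter.Tendsto (fun y : ℝ × Plane => flowPow φ y.1 y.2) (𝓝 ((0 : ℝ), p)) (𝓝 p) := by
  have := (h.contDiffAt hp).continuousAt.tendsto
  simpa using this

theorem hasDerivAt_zero (h : IsProjectiveFlow C φ) (hp : p ∈ C) :
    HasDerivAt (fun z => flowPow φ z p) (fld φ p) 0 := by
  have h1 := ((h.contDiffAt hp).differentiableAt (by simp)).hasFDerivAt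
  have h2 : HasDerivAt (fun z : ℝ => (z, p)) ((1 : ℝ), (0 : Plane)) 0 :=
    (hasDerivAt_id 0).prodMk (hasDerivAt_const 0 p)
  exact (h1.comp_hasDerivAt (0 : ℝ) h2).differentiableAt.hasDerivAt

theorem fld_eq_fderiv (h : IsProjectiveFlow C φ) (hp : p ∈ C) :
    fld φ p = fderiv ℝ (fun y : ℝ × Plane => flowPow φ y.1 y.2) ((0 : ℝ), p) (1, 0) := by
  have h1 := ((h.contDiffAt hp).differentiableAt (by simp)).hasFDerivAt
  have h2 : HasDerivAt (fun z : ℝ => (z, p)) ((1 : ℝ), (0 : Plane)) 0 :=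
    (hasDerivAt_id 0).prodMk (hasDerivAt_const 0 p)
  have h3 := HasFDerivAt.comp_hasDerivAt (f := fun z : ℝ => (z, p)) (0 : ℝ) h1 h2
  exact (h.hasDerivAt_zero hp).unique h3

theorem contDiffAt_fld (h : IsProjectiveFlow C φ) (hp : p ∈ C) : ContDiffAt ℝ ∞ (fld φ) p := by
  have h1 : ContDiffAt ℝ ∞ (fderiv ℝ (fun y : ℝ × Plane => flowPow φ y.1 y.2)) ((0 : ℝ), p) :=
    (h.contDiffAt hp).fderiv_right (by simp)
  have h2 : ContDiffAt ℝ ∞ (fun q : Plane => ((0 : ℝ), q)) p := contDiffAt_const.prodMk contDiffAt_id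
  have h3 : ContDiffAt ℝ ∞ (fun q : Plane =>
      fderiv ℝ (fun y : ℝ × Plane => flowPow φ y.1 y.2) ((0 : ℝ), q) (1, 0)) p :=
    (ContDiffAt.comp p h1 h2).clm_apply contDiffAt_const
  refine h3.congr_of_eventuallyEq ?_
  filter_upwards [h.domain.mem_nhds hp] with q hq
  exact h.fld_eq_fderiv hq

theorem hasFDerivAt_fld (h : IsProjectiveFlow C φ) (hp : p ∈ C) :
    HasFDerivAt (fld φ) (fderiv ℝ (fld φ) p) p :=
  ((h.contDiffAt_fld hp).differentiableAt (by simp)).hasFDerivAt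

theorem fderiv_fld_self (h : IsProjectiveFlow C φ) (hp : p ∈ C) :
    fderiv ℝ (fld φ) p p = (2 : ℝ) • fld φ p := by
  have h1 : HasDerivAt (fun t : ℝ => t • p) p 1 := by
    simpa using (hasDerivAt_id (1 : ℝ)).smul_const p
  have h2 : HasFDerivAt (fld φ) (fderiv ℝ (fld φ) p) ((1 : ℝ) • p) := by
    rw [one_smul]; exact h.hasFDerivAt_fld hp
  have h3 := h2.comp_hasDerivAt (1 : ℝ) h1
  have h4 : HasDerivAt (fun t : ℝ => t ^ 2 • fld φ p) ((2 : ℝ) • fld φ p) 1 := by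
    simpa using (hasDerivAt_pow 2 (1 : ℝ)).smul_const (fld φ p)
  refine h3.unique (h4.congr_of_eventuallyEq ?_)
  filter_upwards [isOpen_ne.mem_nhds (one_ne_zero (α := ℝ))] with t ht
  exact fld_smul φ ht p

theorem eventually_mem (h : IsProjectiveFlow C φ) (hp : p ∈ C) :
    ∀ᶠ x : ℝ × Plane in 𝓝 ((0 : ℝ), p), flowPow φ x.1 x.2 ∈ C :=
  (h.tendsto hp).eventually (h.domain.mem_nhds hp)

/-- The trajectories of a projective flow are integral curves of its vector field. -/
theorem eventually_hasDerivAt (h : IsProjectiveFlow C φ) (hp : p ∈ C) :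
    ∀ᶠ x : ℝ × Plane in 𝓝 ((0 : ℝ), p),
      HasDerivAt (fun z => flowPow φ z x.2) (fld φ (flowPow φ x.1 x.2)) x.1 := by
  have h1 : Filter.Tendsto (fun y : (ℝ × Plane) × ℝ => ((y.2, y.1.1), y.1.2))
      (𝓝 (((0 : ℝ), p), (0 : ℝ))) (𝓝 (((0 : ℝ), (0 : ℝ)), p)) := by
    have : Continuous (fun y : (ℝ × Plane) × ℝ => ((y.2, y.1.1), y.1.2)) := by fun_prop
    exact this.tendsto _
  have h2 := h1.eventually (h.translation p hp)
  rw [nhds_prod_eq] at h2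
  filter_upwards [h2.curry, h.eventually_mem hp] with x hx hC
  have h3 := h.hasDerivAt_zero hC
  have h4 : HasDerivAt (fun s => flowPow φ (s + x.1) x.2) (fld φ (flowPow φ x.1 x.2)) 0 :=
    h3.congr_of_eventuallyEq hx
  have h5 : HasDerivAt (fun z : ℝ => z - x.1) 1 x.1 := (hasDerivAt_id _).sub_const _
  rw [← sub_self x.1] at h4
  have h6 : HasDerivAt ((fun s => flowPow φ (s + x.1) x.2) ∘ fun z => z - x.1) _ x.1 :=
    HasDerivAt.scomp x.1 h4 h5
  simpa [Function.comp_def] using h6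

/-- A projective flow is determined by its vector field. -/
theorem germEq_of_fld_eq (hφ : IsProjectiveFlow C φ) (hψ : IsProjectiveFlow C ψ)
    (h : ∀ p ∈ C, fld φ p = fld ψ p) : GermEq C φ ψ := by
  rw [germEq_iff]
  intro p hp
  obtain ⟨K, s, hs, hK⟩ := ((hφ.contDiffAt_fld hp).of_le (m := 1) (by simp)).exists_lipschitzOnWith
  obtain ⟨ε, hε, N, hN, hb⟩ := eventually_box ((hφ.eventually_hasDerivAt hp).and
    ((hψ.eventually_hasDerivAt hp).and (((hφ.tendsto hp).eventually hs).and
      (((hψ.tendsto hp).eventually hs).and (hψ.eventually_mem hp)))))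
  refine eventually_of_box hε hN fun t ht q hq => ?_
  refine ODE_solution_unique_of_mem_Ioo (v := fun _ => fld φ) (s := fun _ => s) (t₀ := 0)
    (f := fun z => flowPow φ z q) (g := fun z => flowPow ψ z q) (fun _ _ => hK)
    ⟨neg_lt_zero.2 hε, hε⟩ ?_ ?_ (by simp) ht
  · intro t ht
    obtain ⟨h1, h2, h3, h4, h5⟩ := hb t ht q hq
    exact ⟨h1, h3⟩
  · intro t ht
    obtain ⟨h1, h2, h3, h4, h5⟩ := hb t ht q hq
    refine ⟨?_, h4⟩
    rw [h _ h5]; exact h2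

theorem flowPow (h : IsProjectiveFlow C φ) (c : ℝ) : IsProjectiveFlow C (flowPow φ c) := by
  have h0 : ∀ p : Plane, Filter.Tendsto (fun x : ℝ × Plane => (c * x.1, x.2)) (𝓝 ((0 : ℝ), p))
      (𝓝 ((0 : ℝ), p)) := fun p => by
    have : Continuous (fun x : ℝ × Plane => (c * x.1, x.2)) := by fun_prop
    simpa using this.tendsto ((0 : ℝ), p)
  refine ⟨h.domain, fun p hp => ?_, fun p hp => ?_, fun p hp => ?_⟩
  · filter_upwards [(h0 p).eventually (h.smooth p hp)] with x hx
    simp only [flowPow_flowPow]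
    have h1 : ContDiffAt ℝ ∞ (fun x : ℝ × Plane => (c * x.1, x.2)) x := by fun_prop
    exact ContDiffAt.comp x hx h1
  · have h1 : Filter.Tendsto (fun x : (ℝ × ℝ) × Plane => ((c * x.1.1, c * x.1.2), x.2))
        (𝓝 (((0 : ℝ), (0 : ℝ)), p)) (𝓝 (((0 : ℝ), (0 : ℝ)), p)) := by
      have : Continuous (fun x : (ℝ × ℝ) × Plane => ((c * x.1.1, c * x.1.2), x.2)) := by fun_prop
      simpa using this.tendsto (((0 : ℝ), (0 : ℝ)), p)
    filter_upwards [h1.eventually (h.translation p hp)] with x hx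
    simp only [flowPow_flowPow, mul_add]
    exact hx
  · have h1 : Filter.Tendsto (fun z : ℝ => (c * z, p)) (𝓝[≠] 0) (𝓝 ((0 : ℝ), p)) := by
      have : Continuous (fun z : ℝ => (c * z, p)) := by fun_prop
      have := this.tendsto 0
      rw [mul_zero] at this
      exact this.mono_left nhdsWithin_le_nhds
    refine ((h.tendsto hp).comp h1).congr' ?_
    filter_upwards [self_mem_nhdsWithin] with z hz
    rw [← flowPow_of_ne _ hz, flowPow_flowPow]; rfl

end IsProjectiveFlow

/-! ### Commuting flows have commuting vector fields -/

theorem hasDerivAt_apply_const {E G : Type*} [NormedAddCommGroup E] [NormedSpace ℝ E]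
    [NormedAddCommGroup G] [NormedSpace ℝ G] {c : ℝ → E →L[ℝ] G} {c' : E →L[ℝ] G} {t : ℝ}
    (h : HasDerivAt c c' t) (v : E) : HasDerivAt (fun s => c s v) (c' v) t := by
  have := h.clm_apply (hasDerivAt_const t v)
  simpa using this

section MixedDerivative
variable {E G : Type*} [NormedAddCommGroup E] [NormedSpace ℝ E] [NormedAddCommGroup G]
  [NormedSpace ℝ G]

theorem hasFDerivAt_fderiv {m : E → G} {x : E} (hm : ContDiffAt ℝ 2 m x) :
    HasFDerivAt (fderiv ℝ m) (fderiv ℝ (fderiv ℝ m) x) x :=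
  ((hm.fderiv_right (m := 1) (by norm_num)).differentiableAt (by simp)).hasFDerivAt

theorem hasDerivAt_fderiv_line {m : E → G} {x : E} (hm : ContDiffAt ℝ 2 m x) (v w : E) :
    HasDerivAt (fun t : ℝ => fderiv ℝ m (x + t • v) w) (fderiv ℝ (fderiv ℝ m) x v w) 0 := by
  have h1 : HasDerivAt (fun t : ℝ => x + t • v) v 0 := by
    simpa using ((hasDerivAt_id (0 : ℝ)).smul_const v).const_add x
  have h2 : HasFDerivAt (fderiv ℝ m) (fderiv ℝ (fderiv ℝ m) x) (x + (0 : ℝ) • v) := by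
    rw [zero_smul, add_zero]; exact hasFDerivAt_fderiv hm
  have h3 : HasDerivAt (fun t : ℝ => fderiv ℝ m (x + t • v)) (fderiv ℝ (fderiv ℝ m) x v) 0 :=
    h2.comp_hasDerivAt (0 : ℝ) h1
  exact hasDerivAt_apply_const h3 w

/-- If a map vanishes along a line in the direction `v`, so does its second derivative. -/
theorem fderiv_fderiv_apply_eq_zero {m : E → G} {v : E} (hm : ContDiffAt ℝ 2 m 0)
    (h : ∀ᶠ t : ℝ in 𝓝 0, m (t • v) = 0) : fderiv ℝ (fderiv ℝ m) 0 v v = 0 := by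
  have hl : Filter.Tendsto (fun t : ℝ => t • v) (𝓝 0) (𝓝 0) := by
    have : Continuous (fun t : ℝ => t • v) := by fun_prop
    simpa using this.tendsto 0
  have h1 : ∀ᶠ t : ℝ in 𝓝 0, fderiv ℝ m (0 + t • v) v = 0 := by
    filter_upwards [h.eventually_nhds, hl.eventually (hm.eventually (by simp))] with t h2 h3
    have h4 : HasDerivAt (fun t : ℝ => t • v) v t := by
      simpa using (hasDerivAt_id t).smul_const v
    have h5 : HasDerivAt (fun t : ℝ => m (t • v)) (fderiv ℝ m (t • v) v) t :=
      (h3.differentiableAt (by simp)).hasFDerivAt.comp_hasDerivAt t h4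
    rw [zero_add]
    exact h5.unique ((hasDerivAt_const t (0 : G)).congr_of_eventuallyEq h2)
  exact (hasDerivAt_fderiv_line hm v v).unique
    ((hasDerivAt_const (0 : ℝ) (0 : G)).congr_of_eventuallyEq h1)

/-- A map of two real variables which vanishes on both axes and on the diagonal has vanishing mixed
second derivative at the origin. -/
theorem fderiv_fderiv_mixed_eq_zero {m : ℝ × ℝ → G} (hm : ContDiffAt ℝ 2 m 0)
    (h1 : ∀ t, m (t, 0) = 0) (h2 : ∀ t, m (0, t) = 0) (h3 : ∀ᶠ t : ℝ in 𝓝 0, m (t, t) = 0) :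
    fderiv ℝ (fderiv ℝ m) 0 (0, 1) (1, 0) = 0 := by
  have b1 := fderiv_fderiv_apply_eq_zero (v := ((1 : ℝ), (0 : ℝ))) hm
    (Filter.Eventually.of_forall fun t => by simp [h1])
  have b2 := fderiv_fderiv_apply_eq_zero (v := ((0 : ℝ), (1 : ℝ))) hm
    (Filter.Eventually.of_forall fun t => by simp [h2])
  have b3 := fderiv_fderiv_apply_eq_zero (v := ((1 : ℝ), (1 : ℝ))) hm
    (h3.mono fun t ht => by simpa using ht)
  have bs := (hm.isSymmSndFDerivAt (by simp)).eq ((1 : ℝ), (0 : ℝ)) ((0 : ℝ), (1 : ℝ))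
  generalize fderiv ℝ (fderiv ℝ m) 0 = B at *
  have e : ((1 : ℝ), (1 : ℝ)) = (1, 0) + (0, 1) := by simp
  rw [e, map_add, map_add, add_apply, add_apply, b1, b2, bs] at b3
  simp only [zero_add, add_zero] at b3
  rw [← two_smul ℝ] at b3
  exact (smul_eq_zero.1 b3).resolve_left two_ne_zero

/-- Two local flows with commuting time-`t` maps have commuting velocity fields: the map
`m(s, t) = Φ_s Ψ_t - Ψ_t Φ_s` vanishes on the axes and on the diagonal, and its mixed derivative at
the origin is the commutator of the two fields. -/
theorem fderiv_comm_of_flows_comm {Φ Ψ : ℝ × E → E} {F H : E → E} {p : E}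
    (hΦ : ContDiffAt ℝ 2 Φ (0, p)) (hΨ : ContDiffAt ℝ 2 Ψ (0, p)) (hΦ0 : ∀ q, Φ (0, q) = q)
    (hΨ0 : ∀ q, Ψ (0, q) = q) (hF : ∀ᶠ q in 𝓝 p, HasDerivAt (fun z : ℝ => Φ (z, q)) (F q) 0)
    (hH : ∀ᶠ q in 𝓝 p, HasDerivAt (fun z : ℝ => Ψ (z, q)) (H q) 0)
    (hFd : DifferentiableAt ℝ F p) (hHd : DifferentiableAt ℝ H p)
    (hc : ∀ᶠ t : ℝ in 𝓝 0, Φ (t, Ψ (t, p)) = Ψ (t, Φ (t, p))) :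
    fderiv ℝ F p (H p) = fderiv ℝ H p (F p) := by
  have hm1 : ContDiffAt ℝ 2 (fun x : ℝ × ℝ => Φ (x.1, Ψ (x.2, p))) 0 := by
    have h1 : ContDiffAt ℝ 2 (fun x : ℝ × ℝ => Ψ (x.2, p)) 0 :=
      ContDiffAt.comp (0 : ℝ × ℝ) (f := fun x : ℝ × ℝ => (x.2, p)) hΨ (by fun_prop)
    have h2 : ContDiffAt ℝ 2 (fun x : ℝ × ℝ => (x.1, Ψ (x.2, p))) 0 := contDiffAt_fst.prodMk h1
    have h3 : ContDiffAt ℝ 2 Φ ((fun x : ℝ × ℝ => (x.1, Ψ (x.2, p))) 0) := by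
      change ContDiffAt ℝ 2 Φ (0, Ψ (0, p))
      rwa [hΨ0]
    exact ContDiffAt.comp (0 : ℝ × ℝ) h3 h2
  have hm2 : ContDiffAt ℝ 2 (fun x : ℝ × ℝ => Ψ (x.2, Φ (x.1, p))) 0 := by
    have h1 : ContDiffAt ℝ 2 (fun x : ℝ × ℝ => Φ (x.1, p)) 0 :=
      ContDiffAt.comp (0 : ℝ × ℝ) (f := fun x : ℝ × ℝ => (x.1, p)) hΦ (by fun_prop)
    have h2 : ContDiffAt ℝ 2 (fun x : ℝ × ℝ => (x.2, Φ (x.1, p))) 0 := contDiffAt_snd.prodMk h1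
    have h3 : ContDiffAt ℝ 2 Ψ ((fun x : ℝ × ℝ => (x.2, Φ (x.1, p))) 0) := by
      change ContDiffAt ℝ 2 Ψ (0, Φ (0, p))
      rwa [hΦ0]
    exact ContDiffAt.comp (0 : ℝ × ℝ) h3 h2
  set m : ℝ × ℝ → E := fun x => Φ (x.1, Ψ (x.2, p)) - Ψ (x.2, Φ (x.1, p)) with hmdef
  have hm : ContDiffAt ℝ 2 m 0 := hm1.sub hm2
  have b12 := fderiv_fderiv_mixed_eq_zero hm (fun t => by simp [hmdef, hΨ0])
    (fun t => by simp [hmdef, hΦ0]) (hc.mono fun t ht => by simp [hmdef, ht])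
  have hcurve : Filter.Tendsto (fun w : ℝ => (w, p)) (𝓝 0) (𝓝 ((0 : ℝ), p)) :=
    (Continuous.prodMk_left p).tendsto 0
  have hΨt : Filter.Tendsto (fun w : ℝ => Ψ (w, p)) (𝓝 0) (𝓝 p) := by
    have := hΨ.continuousAt.tendsto.comp hcurve
    rwa [hΨ0] at this
  have haxis : Filter.Tendsto (fun w : ℝ => (0 : ℝ × ℝ) + w • ((0 : ℝ), (1 : ℝ))) (𝓝 0) (𝓝 0) := by
    have : Continuous (fun w : ℝ => (0 : ℝ × ℝ) + w • ((0 : ℝ), (1 : ℝ))) := by fun_prop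
    simpa using this.tendsto 0
  -- the derivative of `m` in the first variable along the second axis
  have hA : ∀ᶠ w : ℝ in 𝓝 0, fderiv ℝ m (0 + w • ((0 : ℝ), (1 : ℝ))) (1, 0) =
      F (Ψ (w, p)) - fderiv ℝ Ψ ((0, p) + w • ((1 : ℝ), (0 : E))) (0, F p) := by
    filter_upwards [hΨt.eventually hF, hcurve.eventually (hΨ.eventually (by simp)),
      haxis.eventually (hm.eventually (by simp))] with w h1 h2 h3
    have e0 : (0 : ℝ × ℝ) + w • ((0 : ℝ), (1 : ℝ)) = (0, w) := by simp
    have e0' : ((0 : ℝ), p) + w • ((1 : ℝ), (0 : E)) = (w, p) := by simp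
    rw [e0] at h3
    rw [e0, e0']
    have e1 : HasDerivAt (fun z : ℝ => (z, w)) ((1 : ℝ), (0 : ℝ)) 0 :=
      (hasDerivAt_id 0).prodMk (hasDerivAt_const 0 w)
    have e3 := (h3.differentiableAt (by simp)).hasFDerivAt
    have e2 : HasDerivAt (fun z : ℝ => m (z, w)) (fderiv ℝ m (0, w) (1, 0)) 0 :=
      HasFDerivAt.comp_hasDerivAt (f := fun z : ℝ => (z, w)) (0 : ℝ) e3 e1
    have e4 : HasDerivAt (fun z : ℝ => (w, Φ (z, p))) ((0 : ℝ), F p) 0 :=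
      (hasDerivAt_const 0 w).prodMk hF.self_of_nhds
    have e5 : HasFDerivAt Ψ (fderiv ℝ Ψ (w, p)) (w, Φ (0, p)) := by
      rw [hΦ0]; exact (h2.differentiableAt (by simp)).hasFDerivAt
    have e6 : HasDerivAt (fun z : ℝ => Ψ (w, Φ (z, p))) (fderiv ℝ Ψ (w, p) (0, F p)) 0 :=
      e5.comp_hasDerivAt (0 : ℝ) e4
    exact e2.unique (h1.sub e6)
  -- the derivatives of the two terms in the second variable
  have hR1 : HasDerivAt (fun w : ℝ => F (Ψ (w, p))) (fderiv ℝ F p (H p)) 0 := by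
    have e1 : HasFDerivAt F (fderiv ℝ F p) (Ψ (0, p)) := by rw [hΨ0]; exact hFd.hasFDerivAt
    exact e1.comp_hasDerivAt (0 : ℝ) hH.self_of_nhds
  have hS : fderiv ℝ (fderiv ℝ Ψ) (0, p) (0, F p) (1, 0) = fderiv ℝ H p (F p) := by
    have e1 : HasDerivAt (fun t : ℝ => p + t • F p) (F p) 0 := by
      simpa using ((hasDerivAt_id (0 : ℝ)).smul_const (F p)).const_add p
    have e2 : HasFDerivAt H (fderiv ℝ H p) (p + (0 : ℝ) • F p) := by
      rw [zero_smul, add_zero]; exact hHd.hasFDerivAt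
    have e3 : HasDerivAt (fun t : ℝ => H (p + t • F p)) (fderiv ℝ H p (F p)) 0 :=
      e2.comp_hasDerivAt (0 : ℝ) e1
    refine (hasDerivAt_fderiv_line hΨ (0, F p) (1, 0)).unique (e3.congr_of_eventuallyEq ?_)
    have hl : Filter.Tendsto (fun t : ℝ => p + t • F p) (𝓝 0) (𝓝 p) := by
      have := e1.continuousAt.tendsto
      simpa using this
    have hl2 : Filter.Tendsto (fun t : ℝ => ((0 : ℝ), p + t • F p)) (𝓝 0) (𝓝 ((0 : ℝ), p)) :=
      tendsto_const_nhds.prodMk_nhds hl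
    filter_upwards [hl.eventually hH, hl2.eventually (hΨ.eventually (by simp))] with t h1 h2
    have f1 : HasDerivAt (fun z : ℝ => (z, p + t • F p)) ((1 : ℝ), (0 : E)) 0 :=
      (hasDerivAt_id 0).prodMk (hasDerivAt_const 0 _)
    have f2 : HasDerivAt (fun z : ℝ => Ψ (z, p + t • F p))
        (fderiv ℝ Ψ (0, p + t • F p) (1, 0)) 0 :=
      (h2.differentiableAt (by simp)).hasFDerivAt.comp_hasDerivAt (0 : ℝ) f1
    have e0 : ((0 : ℝ), p) + t • ((0 : ℝ), F p) = (0, p + t • F p) := by simp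
    rw [e0]
    exact f2.unique h1
  have hfin := (hasDerivAt_fderiv_line hm (0, 1) (1, 0)).unique
    ((hR1.sub (hasDerivAt_fderiv_line hΨ (1, 0) (0, F p))).congr_of_eventuallyEq hA)
  rw [b12, (hΨ.isSymmSndFDerivAt (by simp)).eq (1, 0) (0, F p), hS] at hfin
  exact sub_eq_zero.1 hfin.symm

end MixedDerivative

/-- The vector fields of commuting projective flows commute. -/
theorem fderiv_fld_comm {C : Set Plane} {φ η : Plane → Plane} (hφ : IsProjectiveFlow C φ)
    (hη : IsProjectiveFlow C η) (hc : Commutes C φ η) {p : Plane} (hp : p ∈ C) :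
    fderiv ℝ (fld φ) p (fld η p) = fderiv ℝ (fld η) p (fld φ p) := by
  have hl : Filter.Tendsto (fun t : ℝ => (t, p)) (𝓝 0) (𝓝 ((0 : ℝ), p)) :=
    (Continuous.prodMk_left p).tendsto 0
  exact fderiv_comm_of_flows_comm (Φ := fun y => ProjFlow.flowPow φ y.1 y.2)
    (Ψ := fun y => ProjFlow.flowPow η y.1 y.2)
    ((hφ.contDiffAt hp).of_le (WithTop.coe_le_coe.2 le_top))
    ((hη.contDiffAt hp).of_le (WithTop.coe_le_coe.2 le_top)) (flowPow_zero φ) (flowPow_zero η)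
    (by filter_upwards [hφ.domain.mem_nhds hp] with q hq using hφ.hasDerivAt_zero hq)
    (by filter_upwards [hη.domain.mem_nhds hp] with q hq using hη.hasDerivAt_zero hq)
    (hφ.hasFDerivAt_fld hp).differentiableAt (hη.hasFDerivAt_fld hp).differentiableAt
    (hl.eventually (commutes_iff.1 hc p hp))

/-! ### The frame formed by a vector field and the radial field -/

/-- The determinant of two vectors of the plane. -/
def det2 (v w : Plane) : ℝ := v 0 * w 1 - v 1 * w 0

theorem eq_smul_add_smul_of_det2 {v w : Plane} (h : det2 v w ≠ 0) (x : Plane) :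
    x = (det2 x w / det2 v w) • v + (det2 v x / det2 v w) • w := by
  ext i
  fin_cases i <;> simp <;> field_simp <;> simp only [det2] <;> ring

theorem eq_zero_of_smul_add_smul {v w : Plane} (h : det2 v w ≠ 0) {a b : ℝ}
    (hab : a • v + b • w = 0) : a = 0 ∧ b = 0 := by
  have h0 := congrFun hab 0
  have h1 := congrFun hab 1
  simp at h0 h1
  constructor
  · apply (mul_eq_zero.1 (?_ : a * det2 v w = 0)).resolve_right h
    simp only [det2]; linear_combination w 1 * h0 - w 0 * h1
  · apply (mul_eq_zero.1 (?_ : b * det2 v w = 0)).resolve_right h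
    simp only [det2]; linear_combination v 0 * h1 - v 1 * h0

/-- The first coefficient of `H` in the frame formed by `F` and the radial field. -/
noncomputable def coefF (F H : Plane → Plane) (q : Plane) : ℝ := det2 (H q) q / det2 (F q) q

/-- The second coefficient of `H` in the frame formed by `F` and the radial field. -/
noncomputable def coefE (F H : Plane → Plane) (q : Plane) : ℝ := det2 (F q) (H q) / det2 (F q) q

theorem eq_coefF_add_coefE {F H : Plane → Plane} {q : Plane} (h : det2 (F q) q ≠ 0) :
    H q = coefF F H q • F q + coefE F H q • q := eq_smul_add_smul_of_det2 h (H q)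

theorem contDiffAt_det2 {F H : Plane → Plane} {p : Plane} {n : WithTop ℕ∞}
    (hF : ContDiffAt ℝ n F p) (hH : ContDiffAt ℝ n H p) :
    ContDiffAt ℝ n (fun q => det2 (F q) (H q)) p := by
  unfold det2
  have f := contDiffAt_pi.1 hF
  have h := contDiffAt_pi.1 hH
  exact ((f 0).mul (h 1)).sub ((f 1).mul (h 0))

theorem contDiffAt_coefF {F H : Plane → Plane} {p : Plane} {n : WithTop ℕ∞}
    (hF : ContDiffAt ℝ n F p) (hH : ContDiffAt ℝ n H p) (h : det2 (F p) p ≠ 0) :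
    ContDiffAt ℝ n (coefF F H) p :=
  (contDiffAt_det2 hH contDiffAt_id).div (contDiffAt_det2 hF contDiffAt_id) h

theorem contDiffAt_coefE {F H : Plane → Plane} {p : Plane} {n : WithTop ℕ∞}
    (hF : ContDiffAt ℝ n F p) (hH : ContDiffAt ℝ n H p) (h : det2 (F p) p ≠ 0) :
    ContDiffAt ℝ n (coefE F H) p :=
  (contDiffAt_det2 hF hH).div (contDiffAt_det2 hF contDiffAt_id) h

/-- If the `2`-homogeneous fields `F` and `H = α F + β E` commute, with `E` the radial field, then
`F(α) = β` and `F(β) = 0`, since `[E, F] = F`; moreover `α` and `β` are homogeneous of degrees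
`0` and `1`. -/
theorem fderiv_coef {F H : Plane → Plane} {p : Plane} (hF : ContDiffAt ℝ ∞ F p)
    (hH : ContDiffAt ℝ ∞ H p) (h : det2 (F p) p ≠ 0) (eF : fderiv ℝ F p p = (2 : ℝ) • F p)
    (eH : fderiv ℝ H p p = (2 : ℝ) • H p) (hc : fderiv ℝ F p (H p) = fderiv ℝ H p (F p)) :
    fderiv ℝ (coefF F H) p (F p) = coefE F H p ∧ fderiv ℝ (coefE F H) p (F p) = 0 ∧
    fderiv ℝ (coefF F H) p p = 0 ∧ fderiv ℝ (coefE F H) p p = coefE F H p := by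
  have dA := ((contDiffAt_coefF hF hH h).differentiableAt (by simp)).hasFDerivAt
  have dB := ((contDiffAt_coefE hF hH h).differentiableAt (by simp)).hasFDerivAt
  have dF := (hF.differentiableAt (by simp)).hasFDerivAt
  have ev : H =ᶠ[𝓝 p] fun q => coefF F H q • F q + coefE F H q • q := by
    filter_upwards [(contDiffAt_det2 hF contDiffAt_id).continuousAt.eventually_ne h] with q hq
    exact eq_coefF_add_coefE hq
  have dH := ((dA.smul dF).add (dB.smul (hasFDerivAt_id p))).congr_of_eventuallyEq ev
  have e0 : H p = coefF F H p • F p + coefE F H p • p := eq_coefF_add_coefE h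
  have g1 := dH.fderiv ▸ hc
  have g2 := dH.fderiv ▸ eH
  rw [e0, map_add, map_smul, map_smul, eF] at g1
  rw [e0] at g2
  simp only [add_apply, smul_apply,
    ContinuousLinearMap.smulRight_apply, ContinuousLinearMap.id_apply, id_eq, eF] at g1 g2
  have r1 : (fderiv ℝ (coefF F H) p (F p) - coefE F H p) • F p +
      fderiv ℝ (coefE F H) p (F p) • p = 0 := by
    rw [← sub_eq_zero] at g1
    rw [← neg_eq_zero, ← g1]
    module
  have r2 : fderiv ℝ (coefF F H) p p • F p +
      (fderiv ℝ (coefE F H) p p - coefE F H p) • p = 0 := by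
    rw [← sub_eq_zero] at g2
    rw [← g2]
    module
  obtain ⟨a1, a2⟩ := eq_zero_of_smul_add_smul h r1
  obtain ⟨a3, a4⟩ := eq_zero_of_smul_add_smul h r2
  exact ⟨sub_eq_zero.1 a1, a2, a3, sub_eq_zero.1 a4⟩

end ProjFlow

namespace ProjFlow

/-! ### Charts that straighten flows -/

/-- The differential at `p` of the function defined by a rational function. -/
noncomputable abbrev dval (f : RatFun) (p : Plane) : Plane →L[ℝ] ℝ :=
  linForm (val (pd 0 f) p) (val (pd 1 f) p)

/-- A pair of `1`-homogeneous rational functions which are defined and have independent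
differentials everywhere on the cone `C`. -/
structure IsChart (C : Set Plane) (V Y : RatFun) : Prop where
  domain : IsFlowDomain C
  homogV : IsHomog 1 V
  homogY : IsHomog 1 Y
  definedV : ∀ p ∈ C, DefinedAt V p
  definedY : ∀ p ∈ C, DefinedAt Y p
  jac : ∀ p ∈ C, val (pd 0 V) p * val (pd 1 Y) p - val (pd 1 V) p * val (pd 0 Y) p ≠ 0

/-- In the coordinates `V`, `Y` the germ of `φ` at the vertex of `C` is the map
`(V, Y) ↦ (V / (1 - z V), Y / (1 + w Y))`. -/
structure IsStraight (C : Set Plane) (V Y : RatFun) (z w : ℝ) (φ : Plane → Plane) : Prop where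
  tendsto : ∀ p ∈ C,
    Filter.Tendsto (fun x : ℝ × Plane => flowPow φ x.1 x.2) (𝓝 ((0 : ℝ), p)) (𝓝 p)
  eqV : ∀ p ∈ C, ∀ᶠ x : ℝ × Plane in 𝓝 ((0 : ℝ), p),
    val V (flowPow φ x.1 x.2) * (1 - z * x.1 * val V x.2) = val V x.2
  eqY : ∀ p ∈ C, ∀ᶠ x : ℝ × Plane in 𝓝 ((0 : ℝ), p),
    val Y (flowPow φ x.1 x.2) * (1 + w * x.1 * val Y x.2) = val Y x.2

theorem one_sub_ne_zero_of_mul_eq {a c v : ℝ} (ha : a * (1 - c * v) = v) : 1 - c * v ≠ 0 := by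
  intro h
  rw [h, mul_zero] at ha
  rw [← ha, mul_zero, sub_zero] at h
  exact one_ne_zero h

theorem eq_of_mul_one_sub_eq {a b c v : ℝ} (ha : a * (1 - c * v) = v) (hb : b * (1 - c * v) = v) :
    a = b := mul_right_cancel₀ (one_sub_ne_zero_of_mul_eq ha) (ha.trans hb.symm)

theorem eq_of_mul_one_add_eq {a b c v : ℝ} (ha : a * (1 + c * v) = v) (hb : b * (1 + c * v) = v) :
    a = b := by
  have h : 1 + c * v = 1 - -c * v := by ring
  rw [h] at ha hb
  exact eq_of_mul_one_sub_eq ha hb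

/-- The invertible linear map whose components are two independent linear forms. -/
noncomputable def pairEquiv {a b c d : ℝ} (h : a * d - b * c ≠ 0) : Plane ≃L[ℝ] Plane :=
  ContinuousLinearEquiv.equivOfInverse
    (ContinuousLinearMap.pi ![linForm a b, linForm c d])
    (ContinuousLinearMap.pi ![linForm ((a * d - b * c)⁻¹ * d) ((a * d - b * c)⁻¹ * -b),
      linForm ((a * d - b * c)⁻¹ * -c) ((a * d - b * c)⁻¹ * a)])
    (fun v => by
      ext i
      fin_cases i
      · simp [linForm_apply]
        linear_combination v 0 * inv_mul_cancel₀ h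
      · simp [linForm_apply]
        linear_combination v 1 * inv_mul_cancel₀ h)
    (fun v => by
      ext i
      fin_cases i
      · simp [linForm_apply]
        linear_combination v 0 * inv_mul_cancel₀ h
      · simp [linForm_apply]
        linear_combination v 1 * inv_mul_cancel₀ h)

namespace IsChart
variable {C D : Set Plane} {V Y : RatFun} {p : Plane} {z w z' w' : ℝ} {φ ψ : Plane → Plane}

/-- The differentials of the two coordinates determine a vector. -/
theorem eq_of_dval_eq (h : IsChart C V Y) (hp : p ∈ C) {v v' : Plane}
    (hV : dval V p v = dval V p v') (hY : dval Y p v = dval Y p v') : v = v' := by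
  apply (pairEquiv (h.jac p hp)).injective
  ext i
  fin_cases i
  · exact hV
  · exact hY

/-- The inverse function theorem in a chart: the coordinates are locally injective, and the model
map lifts to an analytic family of maps near the identity. -/
theorem exists_localInverse (h : IsChart C V Y) (hp : p ∈ C) :
    (∃ U ∈ 𝓝 p, ∀ q ∈ U, ∀ q' ∈ U, val V q = val V q' → val Y q = val Y q' → q = q') ∧
    ∃ g : Plane → Plane, ContDiffAt ℝ ω g ![val V p, val Y p] ∧
      g ![val V p, val Y p] = p ∧ (∀ᶠ q in 𝓝 p, g ![val V q, val Y q] = q) ∧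
      ∀ᶠ y in 𝓝 ![val V p, val Y p], val V (g y) = y 0 ∧ val Y (g y) = y 1 := by
  let m : Plane → Plane := fun q => ![val V q, val Y q]
  have hm : ContDiffAt ℝ ω m p := by
    rw [contDiffAt_pi]
    intro i
    fin_cases i
    · exact contDiffAt_val (h.definedV p hp)
    · exact contDiffAt_val (h.definedY p hp)
  have hm' : HasFDerivAt m (pairEquiv (h.jac p hp) : Plane →L[ℝ] Plane) p := by
    rw [hasFDerivAt_pi']
    intro i
    fin_cases i
    · exact hasFDerivAt_val (h.definedV p hp)
    · exact hasFDerivAt_val (h.definedY p hp)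
  have hs := hm.hasStrictFDerivAt' hm' (by simp)
  refine ⟨⟨(hs.toOpenPartialHomeomorph m).source, (hs.toOpenPartialHomeomorph m).open_source.mem_nhds
    hs.mem_toOpenPartialHomeomorph_source, fun q hq q' hq' h1 h2 => ?_⟩, hm.localInverse hm' (by simp),
    hm.to_localInverse hm' (by simp), hm.localInverse_apply_image hm' (by simp), hs.eventually_left_inverse, ?_⟩
  · refine (hs.toOpenPartialHomeomorph m).injOn hq hq' ?_
    change m q = m q'
    simp only [m, h1, h2]
  · filter_upwards [hs.eventually_right_inverse] with y hy
    exact ⟨congrFun hy 0, congrFun hy 1⟩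

/-- The model map in the coordinates, followed by the local inverse of the chart, is an analytic local
flow. -/
theorem exists_localFlow (h : IsChart C V Y) (hp : p ∈ C) (z w : ℝ) :
    ∃ G : ℝ × Plane → Plane, ContDiffAt ℝ ω G (0, p) ∧ G (0, p) = p ∧
      (∀ᶠ q in 𝓝 p, G (0, q) = q) ∧ ∀ᶠ x : ℝ × Plane in 𝓝 ((0 : ℝ), p), G x ∈ C ∧
        val V (G x) * (1 - z * x.1 * val V x.2) = val V x.2 ∧
        val Y (G x) * (1 + w * x.1 * val Y x.2) = val Y x.2 := by
  obtain ⟨-, g, hg, hgp, hg1, hg2⟩ := h.exists_localInverse hp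
  let τ : ℝ × Plane → Plane := fun x =>
    ![val V x.2 / (1 - z * x.1 * val V x.2), val Y x.2 / (1 + w * x.1 * val Y x.2)]
  have hV : ContDiffAt ℝ ω (fun x : ℝ × Plane => val V x.2) (0, p) :=
    ContDiffAt.comp ((0 : ℝ), p) (contDiffAt_val (h.definedV p hp)) contDiffAt_snd
  have hY : ContDiffAt ℝ ω (fun x : ℝ × Plane => val Y x.2) (0, p) :=
    ContDiffAt.comp ((0 : ℝ), p) (contDiffAt_val (h.definedY p hp)) contDiffAt_snd
  have hdV : ContDiffAt ℝ ω (fun x : ℝ × Plane => 1 - z * x.1 * val V x.2) (0, p) :=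
    contDiffAt_const.sub ((contDiffAt_const.mul contDiffAt_fst).mul hV)
  have hdY : ContDiffAt ℝ ω (fun x : ℝ × Plane => 1 + w * x.1 * val Y x.2) (0, p) :=
    contDiffAt_const.add ((contDiffAt_const.mul contDiffAt_fst).mul hY)
  have hτ : ContDiffAt ℝ ω τ (0, p) := by
    rw [contDiffAt_pi]
    intro i
    fin_cases i
    · exact hV.div hdV (by simp)
    · exact hY.div hdY (by simp)
  have hτ0 : ∀ q, τ (0, q) = ![val V q, val Y q] := fun q => by simp [τ]
  have hG : ContDiffAt ℝ ω (g ∘ τ) (0, p) :=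
    ContDiffAt.comp ((0 : ℝ), p) (by rw [hτ0]; exact hg) hτ
  have hGp : (g ∘ τ) (0, p) = p := by rw [Function.comp, hτ0, hgp]
  refine ⟨g ∘ τ, hG, hGp, ?_, ?_⟩
  · filter_upwards [hg1] with q hq
    rw [Function.comp, hτ0, hq]
  · have t1 : Filter.Tendsto τ (𝓝 ((0 : ℝ), p)) (𝓝 ![val V p, val Y p]) := by
      have := hτ.continuousAt.tendsto
      rwa [hτ0] at this
    have t2 : Filter.Tendsto (g ∘ τ) (𝓝 ((0 : ℝ), p)) (𝓝 p) := by
      have := hG.continuousAt.tendsto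
      rwa [hGp] at this
    filter_upwards [t1.eventually hg2, t2.eventually (h.domain.mem_nhds hp),
      hdV.continuousAt.eventually_ne (y := 0) (by simp), hdY.continuousAt.eventually_ne (y := 0) (by simp)]
      with x h1 h2 h3 h4
    refine ⟨h2, ?_, ?_⟩
    · rw [Function.comp, h1.1]
      exact div_mul_cancel₀ _ h3
    · rw [Function.comp, h1.2]
      exact div_mul_cancel₀ _ h4

/-- A map which is straight in a chart coincides near the vertex with the analytic local flow of
`exists_localFlow`. -/
theorem eventually_eq_of_isStraight (h : IsChart C V Y) (hp : p ∈ C) (z w : ℝ) :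
    ∃ G : ℝ × Plane → Plane, ContDiffAt ℝ ω G (0, p) ∧ ∀ φ, IsStraight C V Y z w φ →
      ∀ᶠ x : ℝ × Plane in 𝓝 ((0 : ℝ), p), flowPow φ x.1 x.2 = G x := by
  obtain ⟨⟨U, hU, hinj⟩, -⟩ := h.exists_localInverse hp
  obtain ⟨G, hG, hGp, -, hG2⟩ := h.exists_localFlow hp z w
  refine ⟨G, hG, fun φ hφ => ?_⟩
  have t2 : Filter.Tendsto G (𝓝 ((0 : ℝ), p)) (𝓝 p) := by
    have := hG.continuousAt.tendsto
    rwa [hGp] at this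
  filter_upwards [hG2, hφ.eqV p hp, hφ.eqY p hp, (hφ.tendsto p hp).eventually hU,
    t2.eventually hU] with x h1 h2 h3 h4 h5
  exact hinj _ h4 _ h5 (eq_of_mul_one_sub_eq h2 h1.2.1) (eq_of_mul_one_add_eq h3 h1.2.2)

theorem germEq (h : IsChart C V Y) (hφ : IsStraight C V Y z w φ) (hψ : IsStraight C V Y z w ψ) :
    GermEq C φ ψ := by
  rw [germEq_iff]
  intro p hp
  obtain ⟨G, -, hG⟩ := h.eventually_eq_of_isStraight hp z w
  filter_upwards [hG φ hφ, hG ψ hψ] with x h1 h2 using h1.trans h2.symm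

theorem isProjectiveFlow (h : IsChart C V Y) (hφ : IsStraight C V Y z w φ) :
    IsProjectiveFlow C φ := by
  refine ⟨h.domain, fun p hp => ?_, fun p hp => ?_, fun p hp => ?_⟩
  · obtain ⟨G, hG, hG2⟩ := h.eventually_eq_of_isStraight hp z w
    filter_upwards [(hG2 φ hφ).eventually_nhds, hG.eventually (by simp)] with x h1 h2
    exact (h2.of_le le_top).congr_of_eventuallyEq h1
  -- both sides of the flow equation have the same coordinates and are close to `p`
  · obtain ⟨⟨U, hU, hinj⟩, -⟩ := h.exists_localInverse hp
    have t1 : Filter.Tendsto (fun x : (ℝ × ℝ) × Plane => (x.1.2, x.2))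
        (𝓝 (((0 : ℝ), (0 : ℝ)), p)) (𝓝 ((0 : ℝ), p)) := by
      have : Continuous (fun x : (ℝ × ℝ) × Plane => (x.1.2, x.2)) := by fun_prop
      exact this.tendsto _
    have t2 : Filter.Tendsto (fun x : (ℝ × ℝ) × Plane => (x.1.1 + x.1.2, x.2))
        (𝓝 (((0 : ℝ), (0 : ℝ)), p)) (𝓝 ((0 : ℝ), p)) := by
      have : Continuous (fun x : (ℝ × ℝ) × Plane => (x.1.1 + x.1.2, x.2)) := by fun_prop
      simpa using this.tendsto (((0 : ℝ), (0 : ℝ)), p)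
    have t3 : Filter.Tendsto (fun x : (ℝ × ℝ) × Plane => (x.1.1, flowPow φ x.1.2 x.2))
        (𝓝 (((0 : ℝ), (0 : ℝ)), p)) (𝓝 ((0 : ℝ), p)) := by
      refine Filter.Tendsto.prodMk_nhds ?_ ((hφ.tendsto p hp).comp t1)
      have : Continuous (fun x : (ℝ × ℝ) × Plane => x.1.1) := by fun_prop
      exact this.tendsto (((0 : ℝ), (0 : ℝ)), p)
    filter_upwards [t1.eventually (hφ.eqV p hp), t1.eventually (hφ.eqY p hp),
      t2.eventually (hφ.eqV p hp), t2.eventually (hφ.eqY p hp), t3.eventually (hφ.eqV p hp),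
      t3.eventually (hφ.eqY p hp), ((hφ.tendsto p hp).comp t2).eventually hU,
      ((hφ.tendsto p hp).comp t3).eventually hU] with x a1 a2 b1 b2 c1 c2 d1 d2
    refine hinj _ d1 _ d2 (eq_of_mul_one_sub_eq b1 ?_) (eq_of_mul_one_add_eq b2 ?_)
    · linear_combination c1 * (1 - z * x.1.2 * val V x.2) + a1 +
        z * x.1.1 * val V (flowPow φ x.1.1 (flowPow φ x.1.2 x.2)) * a1
    · linear_combination c2 * (1 + w * x.1.2 * val Y x.2) + a2 -
        w * x.1.1 * val Y (flowPow φ x.1.1 (flowPow φ x.1.2 x.2)) * a2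
  · have h1 : Filter.Tendsto (fun z : ℝ => (z, p)) (𝓝[≠] 0) (𝓝 ((0 : ℝ), p)) :=
      ((Continuous.prodMk_left p).tendsto 0).mono_left nhdsWithin_le_nhds
    refine ((hφ.tendsto p hp).comp h1).congr' ?_
    filter_upwards [self_mem_nhdsWithin] with z hz
    exact flowPow_of_ne _ hz p

/-- The vector field of a straight flow is the vector field `z V² ∂_V - w Y² ∂_Y`. -/
theorem dval_fld (h : IsChart C V Y) (hφ : IsStraight C V Y z w φ) (hp : p ∈ C) :
    dval V p (fld φ p) = z * val V p ^ 2 ∧ dval Y p (fld φ p) = -(w * val Y p ^ 2) := by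
  have hd := (h.isProjectiveFlow hφ).hasDerivAt_zero hp
  have hl : Filter.Tendsto (fun t : ℝ => (t, p)) (𝓝 0) (𝓝 ((0 : ℝ), p)) :=
    (Continuous.prodMk_left p).tendsto 0
  have key : ∀ {f : RatFun} {c : ℝ}, DefinedAt f p → (∀ᶠ x : ℝ × Plane in 𝓝 ((0 : ℝ), p),
      val f (flowPow φ x.1 x.2) * (1 - c * x.1 * val f x.2) = val f x.2) →
      dval f p (fld φ p) = c * val f p ^ 2 := by
    intro f c hf he
    have e1 : HasFDerivAt (val f) (dval f p) (flowPow φ 0 p) := by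
      rw [flowPow_zero]; exact hasFDerivAt_val hf
    have e2 : HasDerivAt (fun t => val f (flowPow φ t p)) (dval f p (fld φ p)) 0 :=
      HasFDerivAt.comp_hasDerivAt (f := fun t => flowPow φ t p) (0 : ℝ) e1 hd
    have e3 : HasDerivAt (fun t : ℝ => 1 - c * t * val f p) (-(c * val f p)) 0 := by
      simpa using (((hasDerivAt_id (0 : ℝ)).const_mul c).mul_const (val f p)).const_sub 1
    have e4 := (e2.mul e3).unique ((hasDerivAt_const (0 : ℝ) (val f p)).congr_of_eventuallyEq
      (hl.eventually he))
    simp only [mul_zero, zero_mul, sub_zero, mul_one, flowPow_zero] at e4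
    linear_combination e4
  refine ⟨key (h.definedV p hp) (hφ.eqV p hp), ?_⟩
  rw [← neg_mul]
  refine key (h.definedY p hp) ((hφ.eqY p hp).mono fun x hx => ?_)
  linear_combination hx

end IsChart

theorem IsStraight.mono {C D : Set Plane} {V Y : RatFun} {z w : ℝ} {φ : Plane → Plane}
    (h : IsStraight C V Y z w φ) (hDC : D ⊆ C) : IsStraight D V Y z w φ :=
  ⟨fun p hp => h.tendsto p (hDC hp), fun p hp => h.eqV p (hDC hp), fun p hp => h.eqY p (hDC hp)⟩

theorem IsStraight.comp {C : Set Plane} {V Y : RatFun} {z w z' w' : ℝ} {φ ψ : Plane → Plane}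
    (hφ : IsStraight C V Y z w φ) (hψ : IsStraight C V Y z' w' ψ) :
    IsStraight C V Y (z + z') (w + w') (φ ∘ ψ) := by
  have t : ∀ p ∈ C, Filter.Tendsto (fun x : ℝ × Plane => (x.1, flowPow ψ x.1 x.2))
      (𝓝 ((0 : ℝ), p)) (𝓝 ((0 : ℝ), p)) := fun p hp =>
    Filter.Tendsto.prodMk_nhds (continuous_fst.tendsto ((0 : ℝ), p)) (hψ.tendsto p hp)
  refine ⟨fun p hp => ?_, fun p hp => ?_, fun p hp => ?_⟩
  · simp only [flowPow_comp]
    exact (hφ.tendsto p hp).comp (t p hp)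
  · filter_upwards [(t p hp).eventually (hφ.eqV p hp), hψ.eqV p hp] with x h1 h2
    rw [flowPow_comp]
    linear_combination h1 * (1 - z' * x.1 * val V x.2) + h2 +
        z * x.1 * val V (flowPow φ x.1 (flowPow ψ x.1 x.2)) * h2
  · filter_upwards [(t p hp).eventually (hφ.eqY p hp), hψ.eqY p hp] with x h1 h2
    rw [flowPow_comp]
    linear_combination h1 * (1 + w' * x.1 * val Y x.2) + h2 -
        w * x.1 * val Y (flowPow φ x.1 (flowPow ψ x.1 x.2)) * h2

theorem IsStraight.flowPow {C : Set Plane} {V Y : RatFun} {z w : ℝ} {φ : Plane → Plane}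
    (hφ : IsStraight C V Y z w φ) (c : ℝ) :
    IsStraight C V Y (c * z) (c * w) (flowPow φ c) := by
  have t : ∀ p : Plane, Filter.Tendsto (fun x : ℝ × Plane => (c * x.1, x.2)) (𝓝 ((0 : ℝ), p))
      (𝓝 ((0 : ℝ), p)) := fun p => by
    have : Continuous (fun x : ℝ × Plane => (c * x.1, x.2)) := by fun_prop
    simpa using this.tendsto ((0 : ℝ), p)
  refine ⟨fun p hp => ?_, fun p hp => ?_, fun p hp => ?_⟩
  · simp only [flowPow_flowPow]
    exact (hφ.tendsto p hp).comp (t p)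
  · filter_upwards [(t p).eventually (hφ.eqV p hp)] with x h1
    rw [flowPow_flowPow]
    linear_combination h1
  · filter_upwards [(t p).eventually (hφ.eqY p hp)] with x h1
    rw [flowPow_flowPow]
    linear_combination h1

theorem IsChart.commutes {C : Set Plane} {V Y : RatFun} {z w z' w' : ℝ} {φ ψ : Plane → Plane}
    (h : IsChart C V Y) (hφ : IsStraight C V Y z w φ) (hψ : IsStraight C V Y z' w' ψ) :
    Commutes C φ ψ := by
  have h2 := hψ.comp hφ
  rw [add_comm, add_comm w'] at h2
  exact h.germEq (hφ.comp hψ) h2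

/-! ### Existence of straight flows by lifting of paths -/

/-- The path `γ` on `[0, 1]` starts at `q` and covers the trajectory of `q` under the model flow. -/
structure IsLift (C : Set Plane) (V Y : RatFun) (z w : ℝ) (q : Plane) (γ : ℝ → Plane) : Prop where
  cont : ContinuousOn γ (Set.Icc 0 1)
  zero : γ 0 = q
  mem : ∀ s ∈ Set.Icc (0 : ℝ) 1, γ s ∈ C
  eqV : ∀ s ∈ Set.Icc (0 : ℝ) 1, val V (γ s) * (1 - z * s * val V q) = val V q
  eqY : ∀ s ∈ Set.Icc (0 : ℝ) 1, val Y (γ s) * (1 + w * s * val Y q) = val Y q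

/-- The set of times at which two lifts coincide is closed, and open to the right since the coordinates
are locally injective. -/
theorem IsChart.lift_unique {C : Set Plane} {V Y : RatFun} {z w : ℝ} {q : Plane} {γ γ' : ℝ → Plane}
    (h : IsChart C V Y) (hγ : IsLift C V Y z w q γ) (hγ' : IsLift C V Y z w q γ') :
    γ 1 = γ' 1 := by
  have hsub : Set.Icc (0 : ℝ) 1 ⊆ {s | γ s - γ' s = 0} := by
    refine IsClosed.Icc_subset_of_forall_mem_nhdsWithin ?_ ?_ ?_
    · rw [Set.inter_comm]
      exact (hγ.cont.sub hγ'.cont).preimage_isClosed_of_isClosed isClosed_Icc isClosed_singleton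
    · simp [hγ.zero, hγ'.zero]
    · rintro s ⟨hs, hs1⟩
      have hs2 : s ∈ Set.Icc (0 : ℝ) 1 := Set.Ico_subset_Icc_self hs1
      obtain ⟨⟨U, hU, hinj⟩, -⟩ := h.exists_localInverse (hγ.mem s hs2)
      have hI : Set.Icc (0 : ℝ) 1 ∈ 𝓝[>] s :=
        Filter.mem_of_superset (Ioc_mem_nhdsGT hs1.2) fun x hx => ⟨hs1.1.trans hx.1.le, hx.2⟩
      have hle : 𝓝[>] s ≤ 𝓝[Set.Icc 0 1] s := nhdsWithin_le_of_mem hI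
      have t1 := ((hγ.cont s hs2).mono_left hle).eventually hU
      rw [sub_eq_zero.1 hs] at hU
      have t2 := ((hγ'.cont s hs2).mono_left hle).eventually hU
      filter_upwards [t1, t2, hI] with x h1 h2 h3
      exact sub_eq_zero.2 (hinj _ h1 _ h2 (eq_of_mul_one_sub_eq (hγ.eqV x h3) (hγ'.eqV x h3))
        (eq_of_mul_one_add_eq (hγ.eqY x h3) (hγ'.eqY x h3)))
  exact sub_eq_zero.1 (hsub ⟨zero_le_one, le_rfl⟩)

open Classical in
/-- The end point of the lift of the model trajectory of `q`, if there is one; otherwise the point `q`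
itself, an arbitrary value which plays no role for the germ at the vertex. -/
noncomputable def liftFlow (C : Set Plane) (V Y : RatFun) (z w : ℝ) (q : Plane) : Plane :=
  if h : ∃ γ, IsLift C V Y z w q γ then h.choose 1 else q

theorem IsChart.liftFlow_eq {C : Set Plane} {V Y : RatFun} {z w : ℝ} {q : Plane} {γ : ℝ → Plane}
    (h : IsChart C V Y) (hγ : IsLift C V Y z w q γ) : liftFlow C V Y z w q = γ 1 := by
  have he : ∃ γ, IsLift C V Y z w q γ := ⟨γ, hγ⟩
  rw [liftFlow, dif_pos he]
  exact h.lift_unique he.choose_spec hγ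

/-- Near the vertex of the cone lifts exist: for small `t` and `q` near `p` the path
`s ↦ t G(ts, q)` is a lift of the trajectory of `t q`, where `G` is the local flow at `p`. -/
theorem IsChart.isStraight_liftFlow {C : Set Plane} {V Y : RatFun} (h : IsChart C V Y) (z w : ℝ) :
    IsStraight C V Y z w (liftFlow C V Y z w) := by
  have key : ∀ p ∈ C, ∃ G : ℝ × Plane → Plane, ContDiffAt ℝ ω G (0, p) ∧ G (0, p) = p ∧
      ∀ᶠ x : ℝ × Plane in 𝓝 ((0 : ℝ), p), flowPow (liftFlow C V Y z w) x.1 x.2 = G x ∧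
        val V (G x) * (1 - z * x.1 * val V x.2) = val V x.2 ∧
        val Y (G x) * (1 + w * x.1 * val Y x.2) = val Y x.2 := by
    intro p hp
    obtain ⟨G, hG, hGp, hG1, hG2⟩ := h.exists_localFlow hp z w
    refine ⟨G, hG, hGp, ?_⟩
    obtain ⟨ε, hε, N, hN, hb⟩ := eventually_box ((hG.eventually (by simp)).and hG2)
    refine eventually_of_box hε (Filter.inter_mem hN (Filter.inter_mem hG1 (h.domain.mem_nhds hp)))
      fun t ht q hq => ?_
    obtain ⟨hq1, hq2, hq3⟩ := hq
    refine ⟨?_, (hb t ht q hq1).2.2⟩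
    rcases eq_or_ne t 0 with rfl | ht0
    · simp only [flowPow_zero]; exact hq2.symm
    have hts : ∀ s ∈ Set.Icc (0 : ℝ) 1, t * s ∈ Set.Ioo (-ε) ε := by
      intro s hs
      rw [Set.mem_Ioo, ← abs_lt] at ht ⊢
      rw [abs_mul, abs_of_nonneg hs.1]
      exact (mul_le_of_le_one_right (abs_nonneg t) hs.2).trans_lt ht
    have hlift : IsLift C V Y z w (t • q) fun s => t • G (t * s, q) := by
      have dV := h.definedV q hq3
      have dY := h.definedY q hq3
      refine ⟨?_, ?_, fun s hs => ?_, fun s hs => ?_, fun s hs => ?_⟩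
      · intro s hs
        have c1 := (hb _ (hts s hs) q hq1).1.continuousAt
        have c2 : ContinuousAt (fun s : ℝ => (t * s, q)) s := by fun_prop
        exact (ContinuousAt.const_smul (c1.comp (f := fun s : ℝ => (t * s, q)) c2)
          t).continuousWithinAt
      · rw [mul_zero]; exact congrArg _ hq2
      · exact h.domain.smul_mem _ (hb _ (hts s hs) q hq1).2.1 t ht0
      · have hx := (hb _ (hts s hs) q hq1).2
        have dG := h.definedV _ hx.1
        rw [h.homogV.val_smul dG ht0, h.homogV.val_smul dV ht0]
        linear_combination t * hx.2.1
      · have hx := (hb _ (hts s hs) q hq1).2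
        have dG := h.definedY _ hx.1
        rw [h.homogY.val_smul dG ht0, h.homogY.val_smul dY ht0]
        linear_combination t * hx.2.2
    rw [flowPow_of_ne _ ht0, h.liftFlow_eq hlift, mul_one, inv_smul_smul₀ ht0]
  refine ⟨fun p hp => ?_, fun p hp => ?_, fun p hp => ?_⟩
  · obtain ⟨G, hG, hGp, hx⟩ := key p hp
    have := hG.continuousAt.tendsto
    rw [hGp] at this
    exact this.congr' (hx.mono fun x hx => hx.1.symm)
  · obtain ⟨G, hG, hGp, hx⟩ := key p hp
    exact hx.mono fun x hx => by rw [hx.1]; exact hx.2.1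
  · obtain ⟨G, hG, hGp, hx⟩ := key p hp
    exact hx.mono fun x hx => by rw [hx.1]; exact hx.2.2

/-! ### Flows are straight if their vector fields are -/

/-- A solution of a linear differential equation which vanishes at one point vanishes. -/
theorem eq_zero_of_hasDerivAt_mul_self {a b t₀ t : ℝ} {e k : ℝ → ℝ}
    (he : ∀ s ∈ Set.Ioo a b, HasDerivAt e (k s * e s) s) (hk : ContinuousOn k (Set.Ioo a b))
    (ht₀ : t₀ ∈ Set.Ioo a b) (h0 : e t₀ = 0) (ht : t ∈ Set.Ioo a b) : e t = 0 := by
  obtain ⟨a', ha1, ha2⟩ := exists_between (lt_min ht₀.1 ht.1)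
  obtain ⟨b', hb1, hb2⟩ := exists_between (max_lt ht₀.2 ht.2)
  have hsub : Set.Icc a' b' ⊆ Set.Ioo a b := fun x hx => ⟨ha1.trans_le hx.1, hx.2.trans_lt hb2⟩
  obtain ⟨K, hK⟩ := isCompact_Icc.exists_bound_of_continuousOn (hk.mono hsub)
  refine ODE_solution_unique_of_mem_Ioo (v := fun s x => k s * x) (s := fun _ => Set.univ)
    (K := K.toNNReal) (f := e) (g := fun _ => 0) (a := a') (b := b') (t₀ := t₀) ?_
    ⟨ha2.trans_le (min_le_left _ _), (le_max_left _ _).trans_lt hb1⟩ ?_ ?_ h0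
    ⟨ha2.trans_le (min_le_right _ _), (le_max_right _ _).trans_lt hb1⟩
  · intro s hs
    refine LipschitzOnWith.of_dist_le_mul fun x _ y _ => ?_
    rw [Real.dist_eq, Real.dist_eq, ← mul_sub, abs_mul]
    have := hK s (Set.Ioo_subset_Icc_self hs)
    exact mul_le_mul_of_nonneg_right (this.trans (Real.le_coe_toNNReal K)) (abs_nonneg _)
  · exact fun s hs => ⟨he s (hsub (Set.Ioo_subset_Icc_self hs)), trivial⟩
  · intro s _
    refine ⟨?_, trivial⟩
    rw [mul_zero]
    exact hasDerivAt_const s (0 : ℝ)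

theorem mul_one_sub_eq_of_hasDerivAt {ε c : ℝ} {A : ℝ → ℝ} (hε : 0 < ε)
    (hA : ∀ t ∈ Set.Ioo (-ε) ε, HasDerivAt A (c * A t ^ 2) t) {t : ℝ} (ht : t ∈ Set.Ioo (-ε) ε) :
    A t * (1 - c * t * A 0) = A 0 := by
  have key : A t * (1 - c * t * A 0) - A 0 = 0 := by
    refine eq_zero_of_hasDerivAt_mul_self (e := fun t => A t * (1 - c * t * A 0) - A 0)
      (k := fun t => c * A t) (t₀ := 0) ?_ ?_ ⟨neg_lt_zero.2 hε, hε⟩ (by simp) ht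
    · intro s hs
      have e3 : HasDerivAt (fun t : ℝ => 1 - c * t * A 0) (-(c * A 0)) s := by
        simpa using (((hasDerivAt_id s).const_mul c).mul_const (A 0)).const_sub 1
      refine (((hA s hs).mul e3).sub_const (A 0)).congr_deriv ?_
      ring
    · exact continuousOn_const.mul fun s hs => (hA s hs).continuousAt.continuousWithinAt
  linear_combination key

/-- A flow whose field is `z V² ∂_V - w Y² ∂_Y` is straight: along its trajectories the coordinates
solve Riccati equations. -/
theorem IsChart.isStraight_of_dval_fld {C : Set Plane} {V Y : RatFun} {z w : ℝ} {φ : Plane → Plane}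
    (h : IsChart C V Y) (hφ : IsProjectiveFlow C φ)
    (hV : ∀ p ∈ C, dval V p (fld φ p) = z * val V p ^ 2)
    (hY : ∀ p ∈ C, dval Y p (fld φ p) = -(w * val Y p ^ 2)) : IsStraight C V Y z w φ := by
  have key : ∀ {f : RatFun} {c : ℝ}, (∀ p ∈ C, DefinedAt f p) →
      (∀ p ∈ C, dval f p (fld φ p) = c * val f p ^ 2) → ∀ p ∈ C,
      ∀ᶠ x : ℝ × Plane in 𝓝 ((0 : ℝ), p),
        val f (flowPow φ x.1 x.2) * (1 - c * x.1 * val f x.2) = val f x.2 := by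
    intro f c hf hc p hp
    obtain ⟨ε, hε, N, hN, hb⟩ := eventually_box
      ((hφ.eventually_hasDerivAt hp).and (hφ.eventually_mem hp))
    refine eventually_of_box hε hN fun t ht q hq => ?_
    have := mul_one_sub_eq_of_hasDerivAt (A := fun t => val f (ProjFlow.flowPow φ t q)) (c := c) hε
      (fun s hs => ?_) ht
    · simpa using this
    · obtain ⟨h1, h2⟩ := hb s hs q hq
      dsimp only at h1 h2
      rw [← hc _ h2]
      exact (hasFDerivAt_val (hf _ h2)).comp_hasDerivAt s h1
  refine ⟨fun p hp => hφ.tendsto hp, key h.definedV hV, fun p hp => ?_⟩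
  have hY' : ∀ p ∈ C, dval Y p (fld φ p) = -w * val Y p ^ 2 := fun p hp => by
    rw [hY p hp, neg_mul]
  filter_upwards [key h.definedY hY' p hp] with x hx
  linear_combination hx

end ProjFlow

namespace ProjFlow

/-! ### Algebraic independence -/

theorem derivation_mvAeval (d : Derivation ℝ RatFun RatFun) (f : Fin 2 → RatFun) (P : Poly) :
    d (MvPolynomial.aeval f P) = MvPolynomial.aeval f (MvPolynomial.pderiv 0 P) * d (f 0) +
      MvPolynomial.aeval f (MvPolynomial.pderiv 1 P) * d (f 1) := by
  induction P using MvPolynomial.induction_on with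
  | C a => simp
  | add P Q hP hQ => simp only [map_add, hP, hQ]; ring
  | mul_X P i hP =>
    fin_cases i <;>
    · simp [hP, Derivation.leibniz, MvPolynomial.pderiv_X]
      ring

theorem totalDegree_pderiv_lt {P : Poly} {i : Fin 2} (h : MvPolynomial.pderiv i P ≠ 0) :
    (MvPolynomial.pderiv i P).totalDegree < P.totalDegree := by
  obtain ⟨m, hm, hs⟩ := Finset.exists_mem_eq_sup _ (MvPolynomial.support_nonempty.2 h)
    fun m => m.sum fun _ e => e
  rw [MvPolynomial.totalDegree, hs]
  rw [MvPolynomial.mem_support_iff, MvPolynomial.coeff_pderiv] at hm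
  have h1 := MvPolynomial.le_totalDegree (MvPolynomial.mem_support_iff.2 (left_ne_zero_of_mul hm))
  rw [Finsupp.sum_add_index' (by simp) (by simp), Finsupp.sum_single_index rfl] at h1
  exact Nat.lt_of_succ_le h1

theorem mvPolynomial_eq_C_of_pderiv_eq_zero {P : Poly} (h : ∀ i, MvPolynomial.pderiv i P = 0) :
    ∃ c, P = MvPolynomial.C c := by
  obtain ⟨c, hc⟩ := exists_eq_const (f := ofPoly P) (by rw [pd_ofPoly, h, map_zero])
    (by rw [pd_ofPoly, h, map_zero])
  exact ⟨c, ofPoly_injective hc⟩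

/-- A relation between `a` and `b` could be differentiated along the field and along the radial
field, which yields relations of smaller degree. -/
theorem algebraicIndependent_of_along {ϖ ϱ a b : RatFun} (hb : IsHomog 1 b) (hb0 : b ≠ 0)
    (hab : along ϖ ϱ a = b) (hbb : along ϖ ϱ b = 0) : AlgebraicIndependent ℝ ![a, b] := by
  rw [algebraicIndependent_iff]
  intro P
  induction hn : P.totalDegree using Nat.strong_induction_on generalizing P with
  | _ n ih =>
  intro hP
  have h1 : ∀ i, MvPolynomial.aeval ![a, b] (MvPolynomial.pderiv i P) = 0 →
      MvPolynomial.pderiv i P = 0 := by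
    intro i hi
    by_contra hne
    exact hne (ih _ (hn ▸ totalDegree_pderiv_lt hne) _ rfl hi)
  have e0 := derivation_mvAeval (along ϖ ϱ) ![a, b] P
  have e1 := derivation_mvAeval (along (coord 0) (coord 1)) ![a, b] P
  have hE : along (coord 0) (coord 1) b = b := by
    rw [along_apply, hb.euler, Nat.cast_one, const_one, one_mul]
  simp only [hP, map_zero, Matrix.cons_val_zero, Matrix.cons_val_one, hab, hbb, mul_zero, add_zero,
    hE] at e0 e1
  have d0 := h1 0 ((mul_eq_zero.1 e0.symm).resolve_right hb0)
  rw [d0, map_zero, zero_mul, zero_add] at e1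
  have d1 := h1 1 ((mul_eq_zero.1 e1.symm).resolve_right hb0)
  obtain ⟨c, rfl⟩ := mvPolynomial_eq_C_of_pderiv_eq_zero (P := P) fun i => by
    fin_cases i
    · exact d0
    · exact d1
  rw [MvPolynomial.aeval_C, algebraMap_real_eq_const] at hP
  rw [const_injective (hP.trans const_zero.symm), map_zero]

theorem trdeg_ratFun : Algebra.trdeg ℝ RatFun = 2 := by
  have : Algebra.IsAlgebraic Poly RatFun := IsLocalization.isAlgebraic RatFun (nonZeroDivisors Poly)
  have h := (IsTranscendenceBasis.mvPolynomial (Fin 2) ℝ).algebraMap_comp (A := RatFun)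
  simpa using h.cardinalMk_eq_trdeg.symm

/-- Two algebraically independent elements of `ℝ(x, y)` form a transcendence basis. -/
theorem exists_relation_of_algebraicIndependent {f : Fin 2 → RatFun} (hf : AlgebraicIndependent ℝ f)
    (g : RatFun) : ∃ R : Polynomial Poly, R ≠ 0 ∧
      R.eval₂ (MvPolynomial.aeval f : Poly →ₐ[ℝ] RatFun).toRingHom g = 0 := by
  have hb : IsTranscendenceBasis ℝ f := by
    refine hf.isTranscendenceBasis_of_trdeg_le_of_finite ?_
    simp [trdeg_ratFun]
  obtain ⟨P, hP, h0⟩ := hb.isAlgebraic.isAlgebraic g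
  let e : Poly ≃ₐ[ℝ] Algebra.adjoin ℝ (Set.range f) := hf.aevalEquiv
  refine ⟨P.map (e.symm : _ →+* Poly), ?_, ?_⟩
  · rwa [Ne, Polynomial.map_eq_zero_iff e.symm.injective]
  · rw [Polynomial.eval₂_map, ← h0, Polynomial.aeval_def]
    congr 1
    ext x
    obtain ⟨y, rfl⟩ := e.surjective x
    simp [e]

theorem definedAt_eval₂ {f : Fin 2 → RatFun} {g : RatFun} {p : Plane} (hf : ∀ i, DefinedAt (f i) p)
    (hg : DefinedAt g p) (R : Polynomial Poly) :
    DefinedAt (R.eval₂ (MvPolynomial.aeval f : Poly →ₐ[ℝ] RatFun).toRingHom g) p ∧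
      val (R.eval₂ (MvPolynomial.aeval f : Poly →ₐ[ℝ] RatFun).toRingHom g) p =
        (R.map (MvPolynomial.eval fun i => val (f i) p)).eval (val g p) := by
  induction R using Polynomial.induction_on' with
  | add q r hq hr =>
    rw [Polynomial.eval₂_add, Polynomial.map_add, Polynomial.eval_add]
    exact ⟨hq.1.add hr.1, by rw [val_add hq.1 hr.1, hq.2, hr.2]⟩
  | monomial n a =>
    rw [Polynomial.eval₂_monomial, Polynomial.map_monomial, Polynomial.eval_monomial]
    have h := definedAt_mvAeval hf a
    refine ⟨h.1.mul (hg.pow n), ?_⟩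
    rw [← h.2, ← val_pow hg]
    exact val_mul h.1 (hg.pow n)

/-- Substitution of algebraically independent rational functions for the two variables of the
coefficients of a polynomial, followed by multiplication with a common denominator. -/
theorem exists_polynomial_of_algebraicIndependent {f : Fin 2 → RatFun}
    (hf : AlgebraicIndependent ℝ f) {R : Polynomial Poly} (hR : R ≠ 0) :
    ∃ Q : Polynomial Poly, Q ≠ 0 ∧ ∀ p, (∀ i, DefinedAt (f i) p) → ∀ t,
      (R.map (MvPolynomial.eval fun i => val (f i) p)).eval t = 0 →
      (Q.map (MvPolynomial.eval p)).eval t = 0 := by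
  set R' := R.map (MvPolynomial.aeval f : Poly →ₐ[ℝ] RatFun).toRingHom
  have hR' : R' ≠ 0 := by
    rwa [Ne, Polynomial.map_eq_zero_iff]
    exact hf
  obtain ⟨M, hM, hb⟩ := IsLocalization.integerNormalization_spec (nonZeroDivisors Poly) R'
  set Q := IsLocalization.integerNormalization (nonZeroDivisors Poly) R'
  have hM0 : M ≠ 0 := nonZeroDivisors.ne_zero hM
  refine ⟨Q, ?_, fun p hp t ht => ?_⟩
  · intro h0
    rw [h0, Polynomial.map_zero] at hb
    rcases smul_eq_zero.1 hb.symm with h | h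
    · exact hM0 h
    · exact hR' h
  · have hc : Q.map (MvPolynomial.eval p) = Polynomial.C (MvPolynomial.eval p M) *
        R.map (MvPolynomial.eval fun i => val (f i) p) := by
      ext n
      have h1 := congrArg (fun P => Polynomial.coeff P n) hb
      simp only [Polynomial.coeff_map, Polynomial.coeff_smul, R'] at h1
      have h2 := definedAt_mvAeval hp (R.coeff n)
      rw [Polynomial.coeff_map, Polynomial.coeff_C_mul, Polynomial.coeff_map, ← h2.2,
        ← val_ofPoly M, ← val_ofPoly (Q.coeff n), ← val_mul (definedAt_ofPoly _ _) h2.1]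
      congr 1
      rw [h1, Algebra.smul_def]
      rfl
    rw [hc, Polynomial.eval_mul, ht, mul_zero]

end ProjFlow

namespace ProjFlow

/-! ### Flows with an orbit function and a linear first coordinate are algebraic -/

/-- The numerator `y ϖ - x ϱ` of the angular velocity. -/
noncomputable def angular (ϖ ϱ : RatFun) : RatFun := coord 1 * ϖ - coord 0 * ϱ

theorem definedAt_angular {ϖ ϱ : RatFun} {p : Plane} (h0 : DefinedAt ϖ p) (h1 : DefinedAt ϱ p) :
    DefinedAt (angular ϖ ϱ) p :=
  ((definedAt_coord 1 p).mul h0).sub ((definedAt_coord 0 p).mul h1)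

theorem val_angular {ϖ ϱ : RatFun} {p : Plane} (h0 : DefinedAt ϖ p) (h1 : DefinedAt ϱ p) :
    val (angular ϖ ϱ) p = p 1 * val ϖ p - p 0 * val ϱ p := by
  rw [angular, val_sub ((definedAt_coord 1 p).mul h0) ((definedAt_coord 0 p).mul h1),
    val_mul (definedAt_coord 1 p) h0, val_mul (definedAt_coord 0 p) h1, val_coord, val_coord]

/-- The data in terms of which a flow of level one can be integrated: `b` is constant along the
field, and `a` grows with the constant velocity `b`. -/
structure IsLevelOneData (ϖ ϱ a b : RatFun) : Prop where
  angular_ne : angular ϖ ϱ ≠ 0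
  homogA : IsHomog 0 a
  homogB : IsHomog 1 b
  ne_zero : b ≠ 0
  along_a : along ϖ ϱ a = b
  along_b : along ϖ ϱ b = 0

theorem IsHomog.isOrbitFunction {ϖ ϱ b : RatFun} (hb : IsHomog 1 b) (hb0 : b ≠ 0)
    (h : along ϖ ϱ b = 0) : IsOrbitFunction ϖ ϱ b := by
  refine ⟨hb0, hb, ?_⟩
  have h1 := hb.euler
  rw [Nat.cast_one, const_one, one_mul] at h1
  rw [along_apply] at h
  linear_combination coord 1 * h - ϱ * h1

theorem IsOrbitFunction.along_eq_zero {ϖ ϱ b : RatFun} (h : IsOrbitFunction ϖ ϱ b) :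
    along ϖ ϱ b = 0 := by
  obtain ⟨-, hb, h⟩ := h
  have h1 := hb.euler
  rw [Nat.cast_one, const_one, one_mul] at h1
  have hy : coord 1 ≠ 0 := ne_zero_of_val_ne_zero (p := ![0, 1]) (by simp)
  apply (mul_eq_zero.1 (?_ : coord 1 * along ϖ ϱ b = 0)).resolve_left hy
  rw [along_apply]
  linear_combination h + ϱ * h1

theorem HasRationalField.isHomog {C : Set Plane} {φ : Plane → Plane} {ϖ ϱ : RatFun}
    (hC : IsFlowDomain C) (h : HasRationalField C φ ϖ ϱ) : IsHomog 2 ϖ ∧ IsHomog 2 ϱ := by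
  have key : ∀ p ∈ C, ∀ t : ℝ, t ≠ 0 →
      val ϖ (t • p) = t ^ 2 * val ϖ p ∧ val ϱ (t • p) = t ^ 2 * val ϱ p := by
    intro p hp t ht
    have h1 := fld_smul φ ht p
    rw [h.fld_eq hp, h.fld_eq (hC.smul_mem p hp t ht)] at h1
    exact ⟨congrFun h1 0, congrFun h1 1⟩
  exact ⟨isHomog_of_val_smul hC fun p hp t ht _ _ => (key p hp t ht).1,
    isHomog_of_val_smul hC fun p hp t ht _ _ => (key p hp t ht).2⟩

/-- The function `y ϖ - x ϱ` is semi-invariant under a homogeneous field. -/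
theorem along_angular {ϖ ϱ : RatFun} (h0 : IsHomog 2 ϖ) (h1 : IsHomog 2 ϱ) :
    along ϖ ϱ (angular ϖ ϱ) = (pd 0 ϖ + pd 1 ϱ) * angular ϖ ϱ := by
  have e0 := h0.euler
  have e1 := h1.euler
  have h : along ϖ ϱ (angular ϖ ϱ) =
      ϱ * ϖ + coord 1 * along ϖ ϱ ϖ - (ϖ * ϱ + coord 0 * along ϖ ϱ ϱ) := by
    rw [angular, map_sub, Derivation.leibniz, Derivation.leibniz, along_coord_zero, along_coord_one]
    simp only [smul_eq_mul]
    ring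
  rw [h, along_apply, along_apply, angular]
  linear_combination ϱ * e0 - ϖ * e1

theorem ne_zero_of_angular {ϖ ϱ : RatFun} {p : Plane} (h0 : DefinedAt ϖ p) (h1 : DefinedAt ϱ p)
    (h : val (angular ϖ ϱ) p ≠ 0) : p ≠ 0 := by
  rintro rfl
  rw [val_angular h0 h1] at h
  simp at h

/-- The order of vanishing of a homogeneous function along the line through `p` is lowered by one
through differentiation along a field which is transversal to that line. -/
theorem order_of_along {ϖ ϱ g : RatFun} {k : ℤ} {p : Plane} (h0 : DefinedAt ϖ p)
    (h1 : DefinedAt ϱ p) (h : val (angular ϖ ϱ) p ≠ 0) (hg : DefinedAt g p) :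
    ∃ r : RatFun, along ϖ ϱ (lineForm p ^ k * g) = lineForm p ^ (k - 1) * r ∧ DefinedAt r p ∧
      val r p = -(k * val (angular ϖ ϱ) p * val g p) := by
  have hm := lineForm_ne_zero (ne_zero_of_angular h0 h1 h)
  have hd := definedAt_lineForm p p
  have hdm := definedAt_along h0 h1 hd
  have hdg := definedAt_along h0 h1 hg
  have hl : along ϖ ϱ (lineForm p) = const (p 0) * ϱ - const (p 1) * ϖ := by
    rw [along_apply, lineForm]
    have : ∀ i, pd i (const (p 0) * coord 1 - const (p 1) * coord 0) =
        const (p 0) * pd i (coord 1) - const (p 1) * pd i (coord 0) := fun i => by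
      rw [← pdDer_apply, map_sub, Derivation.leibniz, Derivation.leibniz]
      simp [pd_const]
    simp only [this, pd_coord]
    simp; ring
  have hv : val (along ϖ ϱ (lineForm p)) p = -val (angular ϖ ϱ) p := by
    rw [hl, val_angular h0 h1, val_sub ((definedAt_const _ p).mul h1) ((definedAt_const _ p).mul h0),
      val_mul (definedAt_const _ p) h1, val_mul (definedAt_const _ p) h0, val_const, val_const]
    ring
  refine ⟨const k * along ϖ ϱ (lineForm p) * g + lineForm p * along ϖ ϱ g, ?_,
    (((definedAt_const _ p).mul hdm).mul hg).add (hd.mul hdg), ?_⟩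
  · have e1 : lineForm p ^ k = lineForm p ^ (k - 1) * lineForm p := by
      rw [← zpow_add_one₀ hm, sub_add_cancel]
    have e2 : (const k : RatFun) = (k : RatFun) := by
      rw [← algebraMap_real_eq_const, map_intCast]
    rw [Derivation.leibniz, Derivation.leibniz_zpow, e1, e2]
    simp only [smul_eq_mul, zsmul_eq_mul]
    ring
  · rw [val_add (((definedAt_const _ p).mul hdm).mul hg) (hd.mul hdg),
      val_mul ((definedAt_const _ p).mul hdm) hg, val_mul (definedAt_const _ p) hdm,
      val_mul hd hdg, hv, val_const, val_lineForm]
    ring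

namespace IsLevelOneData
variable {ϖ ϱ a b : RatFun} {p : Plane}

theorem ne_zero_a (h : IsLevelOneData ϖ ϱ a b) : a ≠ 0 := by
  rintro rfl
  exact h.ne_zero (by rw [← h.along_a, map_zero])

/-- The order `k` of `b` along the line through `p` is zero, since otherwise `along ϖ ϱ b = 0` would
have the order `k - 1`. -/
theorem definedAt_b (h : IsLevelOneData ϖ ϱ a b) (h0 : DefinedAt ϖ p) (h1 : DefinedAt ϱ p)
    (hD : val (angular ϖ ϱ) p ≠ 0) : DefinedAt b p ∧ val b p ≠ 0 := by
  have hp := ne_zero_of_angular h0 h1 hD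
  obtain ⟨k, g, hk, hg, hg0⟩ := exists_order_of_isHomog h.homogB h.ne_zero hp
  obtain ⟨r, hr, hr1, hr2⟩ := order_of_along (k := k) h0 h1 hD hg
  have hz := h.along_b
  rw [hk, hr] at hz
  have hr0 := (mul_eq_zero.1 hz).resolve_left (zpow_ne_zero _ (lineForm_ne_zero hp))
  rw [hr0, val_zero] at hr2
  have : (k : ℝ) = 0 := by
    by_contra hne
    exact mul_ne_zero (mul_ne_zero hne hD) hg0 (neg_eq_zero.1 hr2.symm)
  rw [Int.cast_eq_zero.1 this, zpow_zero, one_mul] at hk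
  exact hk ▸ ⟨hg, hg0⟩

/-- The order `k` of `a` along the line through `p` is nonnegative, since otherwise `along ϖ ϱ a = b`
would have the negative order `k - 1`. -/
theorem definedAt_a (h : IsLevelOneData ϖ ϱ a b) (h0 : DefinedAt ϖ p) (h1 : DefinedAt ϱ p)
    (hD : val (angular ϖ ϱ) p ≠ 0) : DefinedAt a p := by
  have hp := ne_zero_of_angular h0 h1 hD
  obtain ⟨k, g, hk, hg, hg0⟩ := exists_order_of_isHomog h.homogA h.ne_zero_a hp
  rcases le_or_gt 0 k with hk0 | hk0
  · obtain ⟨n, rfl⟩ := Int.eq_ofNat_of_zero_le hk0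
    rw [hk, zpow_natCast]
    exact ((definedAt_lineForm p p).pow n).mul hg
  · exfalso
    obtain ⟨r, hr, hr1, hr2⟩ := order_of_along (k := k) h0 h1 hD hg
    have hm := lineForm_ne_zero hp
    have hz := h.along_a
    obtain ⟨n, hn⟩ := Int.eq_ofNat_of_zero_le (show 0 ≤ -k by omega)
    have e : r = lineForm p ^ (n + 1) * b := by
      rw [← hz, hk, hr, ← mul_assoc, ← zpow_natCast, ← zpow_add₀ hm]
      have : ((n + 1 : ℕ) : ℤ) + (k - 1) = 0 := by push_cast; omega
      rw [this, zpow_zero, one_mul]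
    have hb := h.definedAt_b h0 h1 hD
    have hl := definedAt_lineForm p p
    rw [e, val_mul (hl.pow _) hb.1, val_pow hl, val_lineForm, mul_comm (p 0), sub_self,
      zero_pow (Nat.succ_ne_zero n), zero_mul] at hr2
    have hk1 : (k : ℝ) ≠ 0 := Int.cast_ne_zero.2 hk0.ne
    exact mul_ne_zero (mul_ne_zero hk1 hD) hg0 (neg_eq_zero.1 hr2.symm)

end IsLevelOneData

/-- The derivative of a rational function along an integral curve. -/
theorem hasDerivAt_val_comp {ϖ ϱ f : RatFun} {X : ℝ → Plane} {t : ℝ} (h0 : DefinedAt ϖ (X t))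
    (h1 : DefinedAt ϱ (X t)) (hf : DefinedAt f (X t))
    (hX : HasDerivAt X ![val ϖ (X t), val ϱ (X t)] t) :
    HasDerivAt (fun s => val f (X s)) (val (along ϖ ϱ f) (X t)) t := by
  have h := (hasFDerivAt_val hf).comp_hasDerivAt t hX
  refine h.congr_deriv ?_
  rw [val_along h0 h1 hf]
  simp; ring

/-- Along an integral curve of a homogeneous field `y ϖ - x ϱ` vanishes everywhere or nowhere. -/
theorem angular_ne_zero_of_hasDerivAt {ϖ ϱ : RatFun} (hϖ : IsHomog 2 ϖ) (hϱ : IsHomog 2 ϱ)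
    {X : ℝ → Plane} {ε : ℝ} (hε : 0 < ε)
    (h0 : ∀ t ∈ Set.Ioo (-ε) ε, DefinedAt ϖ (X t)) (h1 : ∀ t ∈ Set.Ioo (-ε) ε, DefinedAt ϱ (X t))
    (hX : ∀ t ∈ Set.Ioo (-ε) ε, HasDerivAt X ![val ϖ (X t), val ϱ (X t)] t)
    (hD : val (angular ϖ ϱ) (X 0) ≠ 0) : ∀ t ∈ Set.Ioo (-ε) ε, val (angular ϖ ϱ) (X t) ≠ 0 := by
  intro t ht hne
  refine hD (eq_zero_of_hasDerivAt_mul_self (e := fun t => val (angular ϖ ϱ) (X t))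
    (k := fun t => val (pd 0 ϖ + pd 1 ϱ) (X t)) ?_ ?_ ht hne ⟨neg_lt_zero.2 hε, hε⟩)
  · intro s hs
    have d := definedAt_angular (h0 s hs) (h1 s hs)
    refine (hasDerivAt_val_comp (h0 s hs) (h1 s hs) d (hX s hs)).congr_deriv ?_
    rw [along_angular hϖ hϱ, val_mul ((definedAt_pd (h0 s hs) 0).add (definedAt_pd (h1 s hs) 1)) d]
  · intro s hs
    have d := (definedAt_pd (h0 s hs) 0).add (definedAt_pd (h1 s hs) 1)
    have c : ContinuousAt (val (pd 0 ϖ + pd 1 ϱ)) (X s) :=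
      (contDiffAt_val d (n := 0)).continuousAt
    exact (ContinuousAt.comp c (hX s hs).continuousAt).continuousWithinAt

theorem eq_add_mul_of_hasDerivAt {ε c : ℝ} {A : ℝ → ℝ} (hε : 0 < ε)
    (hA : ∀ t ∈ Set.Ioo (-ε) ε, HasDerivAt A c t) {t : ℝ} (ht : t ∈ Set.Ioo (-ε) ε) :
    A t = A 0 + t * c := by
  have h : ∀ s ∈ Set.Ioo (-ε) ε, HasDerivAt (fun s => A s - s * c) 0 s := fun s hs =>
    ((hA s hs).sub ((hasDerivAt_id s).mul_const c)).congr_deriv (by simp)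
  have := (convex_Ioo (-ε) ε).is_const_of_fderivWithin_eq_zero (𝕜 := ℝ)
    (f := fun s => A s - s * c)
    (fun s hs => (h s hs).differentiableAt.differentiableWithinAt) (fun s hs => by
      rw [fderivWithin_of_isOpen isOpen_Ioo hs]
      ext
      simp [(h s hs).deriv]) ht ⟨neg_lt_zero.2 hε, hε⟩
  simp at this
  linear_combination this

/-- Along trajectories `b` is constant and `a` is linear in the time. -/
theorem IsLevelOneData.eventually_eq {C : Set Plane} {φ : Plane → Plane} {ϖ ϱ a b : RatFun}
    (h : IsLevelOneData ϖ ϱ a b) (hφ : IsProjectiveFlow C φ) (hF : HasRationalField C φ ϖ ϱ)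
    {p : Plane} (hp : p ∈ C) : ∀ᶠ x : ℝ × Plane in 𝓝 ((0 : ℝ), p), val (angular ϖ ϱ) x.2 ≠ 0 →
      flowPow φ x.1 x.2 ∈ C ∧ val (angular ϖ ϱ) (flowPow φ x.1 x.2) ≠ 0 ∧
      val a (flowPow φ x.1 x.2) = val a x.2 + x.1 * val b x.2 ∧
      val b (flowPow φ x.1 x.2) = val b x.2 := by
  obtain ⟨hϖ, hϱ⟩ := hF.isHomog hφ.domain
  obtain ⟨ε, hε, N, hN, hb⟩ := eventually_box
    ((hφ.eventually_hasDerivAt hp).and (hφ.eventually_mem hp))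
  refine eventually_of_box hε hN fun t ht q hq hD => ?_
  obtain ⟨X, hXdef⟩ : ∃ X : ℝ → Plane, ∀ t, flowPow φ t q = X t := ⟨_, fun _ => rfl⟩
  have hX0 : X 0 = q := by rw [← hXdef, flowPow_zero]
  simp only [hXdef]
  have hX : ∀ t ∈ Set.Ioo (-ε) ε, HasDerivAt X ![val ϖ (X t), val ϱ (X t)] t := fun t ht => by
    obtain ⟨h1, h2⟩ := hb t ht q hq
    simp only [hXdef] at h1 h2
    rw [← hF.fld_eq h2]
    exact h1
  have hC : ∀ t ∈ Set.Ioo (-ε) ε, X t ∈ C := fun t ht => by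
    rw [← hXdef]; exact (hb t ht q hq).2
  have h0 : ∀ t ∈ Set.Ioo (-ε) ε, DefinedAt ϖ (X t) := fun t ht => (hF _ (hC t ht)).1
  have h1 : ∀ t ∈ Set.Ioo (-ε) ε, DefinedAt ϱ (X t) := fun t ht => (hF _ (hC t ht)).2.1
  have hD' := angular_ne_zero_of_hasDerivAt hϖ hϱ hε h0 h1 hX (by rwa [hX0])
  have eb : ∀ t ∈ Set.Ioo (-ε) ε, val b (X t) = val b q := fun t ht => by
    have := eq_add_mul_of_hasDerivAt (A := fun t => val b (X t)) (c := 0) hε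
      (fun s hs => (hasDerivAt_val_comp (h0 s hs) (h1 s hs)
        (h.definedAt_b (h0 s hs) (h1 s hs) (hD' s hs)).1 (hX s hs)).congr_deriv
          (by rw [h.along_b, val_zero])) ht
    simpa [hX0] using this
  refine ⟨hC t ht, hD' t ht, ?_, eb t ht⟩
  have := eq_add_mul_of_hasDerivAt (A := fun t => val a (X t)) (c := val b q) hε
      (fun s hs => (hasDerivAt_val_comp (h0 s hs) (h1 s hs)
        (h.definedAt_a (h0 s hs) (h1 s hs) (hD' s hs)) (hX s hs)).congr_deriv
          (by rw [h.along_a, eb s hs])) ht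
  simpa [hX0] using this

/-- The coordinates of the flow are algebraic, since the rational functions `a + b` and `b` of the
initial point are the values of `a` and `b` at its image, and form a transcendence basis. -/
theorem IsLevelOneData.isAlgebraicFun {C : Set Plane} {φ : Plane → Plane} {ϖ ϱ a b : RatFun}
    (h : IsLevelOneData ϖ ϱ a b) (hφ : IsProjectiveFlow C φ) (hF : HasRationalField C φ ϖ ϱ)
    (i : Fin 2) : IsAlgebraicFun C fun q => φ q i := by
  obtain ⟨R, hR, hR0⟩ := exists_relation_of_algebraicIndependent
    (algebraicIndependent_of_along h.homogB h.ne_zero h.along_a h.along_b) (coord i)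
  -- `R` relates the coordinate to `a`, `b`; substitution of `a + b`, `b` gives an equation for `φ`
  obtain ⟨Q, hQ, hQ0⟩ := exists_polynomial_of_algebraicIndependent
    (algebraicIndependent_of_along (a := a + b) h.homogB h.ne_zero
      (by rw [map_add, h.along_a, h.along_b, add_zero]) h.along_b) hR
  refine ⟨Q, hQ, fun p hp => ?_⟩
  obtain ⟨ε, hε, N, hN, hb⟩ := eventually_box ((h.eventually_eq hφ hF hp).and (hφ.smooth p hp))
  obtain ⟨N', hN', hNo, hpN⟩ := mem_nhds_iff.1 (Filter.inter_mem hN (hφ.domain.mem_nhds hp))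
  refine eventually_of_box hε (hNo.mem_nhds hpN) fun t ht q hq ht0 => ?_
  dsimp only at ht0 ⊢
  have key : ∀ q ∈ N', val (angular ϖ ϱ) q ≠ 0 →
      (Q.map (MvPolynomial.eval (t • q))).eval (φ (t • q) i) = 0 := by
    intro q hq hD
    have hqC := (hN' hq).2
    obtain ⟨h1, h2, h3, h4⟩ := (hb t ht q (hN' hq).1).1 hD
    dsimp only at h1 h2 h3 h4
    have da := h.definedAt_a (hF q hqC).1 (hF q hqC).2.1 hD
    have db := (h.definedAt_b (hF q hqC).1 (hF q hqC).2.1 hD).1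
    have da' := h.definedAt_a (hF _ h1).1 (hF _ h1).2.1 h2
    have db' := (h.definedAt_b (hF _ h1).1 (hF _ h1).2.1 h2).1
    have ta := h.homogA.definedAt_smul da ht0
    have tb := h.homogB.definedAt_smul db ht0
    apply hQ0
    · intro j
      fin_cases j
      · exact ta.add tb
      · exact tb
    · have e := (definedAt_eval₂ (f := ![a, b]) (g := coord i) (p := φ (t • q)) (fun j => ?_)
        (definedAt_coord _ _) R).2
      · rw [hR0, val_zero, val_coord] at e
        rw [e]
        congr 3
        funext j
        fin_cases j
        · change val (a + b) (t • q) = val a (φ (t • q))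
          rw [val_add ta tb, ← smul_flowPow φ ht0, h.homogA.val_smul da ht0,
            h.homogB.val_smul db ht0, h.homogA.val_smul da' ht0, h3]
          ring
        · change val b (t • q) = val b (φ (t • q))
          rw [← smul_flowPow φ ht0, h.homogB.val_smul db ht0, h.homogB.val_smul db' ht0, h4]
      · rw [← smul_flowPow φ ht0]
        fin_cases j
        · exact h.homogA.definedAt_smul da' ht0
        · exact h.homogB.definedAt_smul db' ht0
  -- the points with `y ϖ - x ϱ ≠ 0` are dense, and both sides are continuous
  have hcl : q ∈ closure (N' ∩ {q | DefinedAt (angular ϖ ϱ) q ∧ val (angular ϖ ϱ) q ≠ 0}) :=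
    (generic_val_ne_zero h.angular_ne).dense.open_subset_closure_inter hNo hq
  obtain ⟨u, hu, hut⟩ := mem_closure_iff_seq_limit.1 hcl
  have hc : ContinuousAt (fun q => (Q.map (MvPolynomial.eval (t • q))).eval (φ (t • q) i)) q := by
    have c1 : ContinuousAt (fun q => φ (t • q) i) q := by
      have c2 : ContinuousAt (fun q => flowPow φ t q) q :=
        ContinuousAt.comp (f := fun q => (t, q)) (hb t ht q (hN' hq).1).2.continuousAt
          (Continuous.prodMk_right t).continuousAt
      have c3 := (continuous_apply i).continuousAt.comp (c2.const_smul t)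
      refine c3.congr (Filter.Eventually.of_forall fun x => ?_)
      exact congrFun (smul_flowPow φ ht0 x) i
    simp only [Polynomial.eval_map, Polynomial.eval₂_eq_sum_range]
    refine tendsto_finsetSum _ fun n _ => Filter.Tendsto.mul ?_ (c1.pow n)
    have c4 : Continuous fun q : Plane => MvPolynomial.eval (t • q) (Q.coeff n) :=
      (contDiff_eval (Q.coeff n) (n := 0)).continuous.comp (continuous_const_smul t)
    exact c4.tendsto q
  refine tendsto_nhds_unique (hc.tendsto.comp hut) ?_
  refine tendsto_const_nhds.congr fun n => ?_
  exact (key _ (hu n).1 (hu n).2.2).symm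

theorem IsLevelOneData.isAlgebraicFlowOfLevelOne {C : Set Plane} {φ : Plane → Plane}
    {ϖ ϱ a b : RatFun} (h : IsLevelOneData ϖ ϱ a b) (hφ : IsProjectiveFlow C φ)
    (hF : HasRationalField C φ ϖ ϱ) : IsAlgebraicFlowOfLevelOne C φ :=
  ⟨hφ, ⟨ϖ, ϱ, hF, h.angular_ne, b, h.homogB.isOrbitFunction h.ne_zero h.along_b⟩,
    h.isAlgebraicFun hφ hF 0, h.isAlgebraicFun hφ hF 1⟩

end ProjFlow

namespace ProjFlow

/-! ### Pairs of commuting flows -/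

theorem along_add_mul (ϖ ϱ a b f : RatFun) :
    along (a * ϖ + b * coord 0) (a * ϱ + b * coord 1) f =
      a * along ϖ ϱ f + b * along (coord 0) (coord 1) f := by
  simp only [along_apply]; ring

theorem IsHomog.along_radial {n : ℕ} {f : RatFun} (hf : IsHomog n f) :
    along (coord 0) (coord 1) f = const n * f := by rw [along_apply, hf.euler]

theorem isHomog_angular {ϖ ϱ : RatFun} (h0 : IsHomog 2 ϖ) (h1 : IsHomog 2 ϱ) :
    IsHomog 3 (angular ϖ ϱ) := by
  rw [angular, sub_eq_add_neg]
  exact ((isHomog_coord 1).mul h0).add ((isHomog_coord 0).mul h1).neg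

/-- A function which is constant along the radial field and along a transversal field is
constant. -/
theorem exists_eq_const_of_along {ϖ ϱ a : RatFun} (hD : angular ϖ ϱ ≠ 0) (ha : IsHomog 0 a)
    (h : along ϖ ϱ a = 0) : ∃ c : ℝ, a = const c := by
  have h1 := ha.along_radial
  rw [Nat.cast_zero, const_zero, zero_mul] at h1
  rw [along_apply] at h h1
  apply exists_eq_const
  · apply (mul_eq_zero.1 (?_ : angular ϖ ϱ * pd 0 a = 0)).resolve_left hD
    rw [angular]
    linear_combination coord 1 * h - ϱ * h1
  · apply (mul_eq_zero.1 (?_ : angular ϖ ϱ * pd 1 a = 0)).resolve_left hD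
    rw [angular]
    linear_combination ϖ * h1 - coord 0 * h

/-- The two flows of a commuting pair play symmetric roles. -/
theorem IsLevelOneData.dual {ϖ ϱ a b : RatFun} (h : IsLevelOneData ϖ ϱ a b) :
    IsLevelOneData (a * ϖ + b * coord 0) (a * ϱ + b * coord 1) a⁻¹ (-(b / a)) := by
  have ha := h.ne_zero_a
  have ea : along (a * ϖ + b * coord 0) (a * ϱ + b * coord 1) a = a * b := by
    rw [along_add_mul, h.along_a, h.homogA.along_radial, Nat.cast_zero, const_zero]
    ring
  have eb : along (a * ϖ + b * coord 0) (a * ϱ + b * coord 1) b = b * b := by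
    rw [along_add_mul, h.along_b, h.homogB.along_radial, Nat.cast_one, const_one]
    ring
  have ei : along (a * ϖ + b * coord 0) (a * ϱ + b * coord 1) a⁻¹ = -(b / a) := by
    rw [Derivation.leibniz_inv, ea]
    simp only [smul_eq_mul]
    field_simp
  refine ⟨?_, ?_, ?_, ?_, ei, ?_⟩
  · have : angular (a * ϖ + b * coord 0) (a * ϱ + b * coord 1) = a * angular ϖ ϱ := by
      simp only [angular]; ring
    rw [this]
    exact mul_ne_zero ha h.angular_ne
  · rw [← one_div, ← const_one]
    exact IsHomog.div (m := 0) (isHomog_const 1) h.homogA ha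
  · exact (IsHomog.div (m := 0) (by rw [zero_add]; exact h.homogB) h.homogA ha).neg
  · exact neg_ne_zero.2 (div_ne_zero h.ne_zero ha)
  · rw [map_neg, div_eq_mul_inv, Derivation.leibniz, ei, eb]
    simp only [smul_eq_mul]
    field_simp
    ring

/-- In the frame formed by the vector field of a flow and the radial field, a commuting rational
field has coefficients `a`, `b` such that `a` grows linearly and `b` is constant along the flow. -/
theorem exists_coef_of_commutes {C : Set Plane} {φ ψ : Plane → Plane} {ϖ ϱ α β : RatFun}
    (hφ : IsProjectiveFlow C φ) (hψ : IsProjectiveFlow C ψ) (hF : HasRationalField C φ ϖ ϱ)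
    (hG : HasRationalField C ψ α β) (hc : Commutes C φ ψ) (hD : angular ϖ ϱ ≠ 0) :
    ∃ a b : RatFun, IsHomog 0 a ∧ IsHomog 1 b ∧ along ϖ ϱ a = b ∧ along ϖ ϱ b = 0 ∧
      α = a * ϖ + b * coord 0 ∧ β = a * ϱ + b * coord 1 := by
  obtain ⟨hϖ, hϱ⟩ := hF.isHomog hφ.domain
  obtain ⟨hα, hβ⟩ := hG.isHomog hψ.domain
  set d := angular ϖ ϱ with hd
  set e := ϖ * β - ϱ * α with he
  have he4 : IsHomog 4 e := by
    rw [he, sub_eq_add_neg]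
    exact (hϖ.mul hβ).add (hϱ.mul hα).neg
  let U := C ∩ {p | DefinedAt d p ∧ val d p ≠ 0}
  have hU : ∀ p ∈ U, det2 (fld φ p) p ≠ 0 ∧
      (DefinedAt (angular α β / d) p ∧ val (angular α β / d) p = coefF (fld φ) (fld ψ) p) ∧
      (DefinedAt (e / d) p ∧ val (e / d) p = coefE (fld φ) (fld ψ) p) := by
    rintro p ⟨hp, hp1, hp2⟩
    obtain ⟨f0, f1, -⟩ := hF p hp
    obtain ⟨g0, g1, -⟩ := hG p hp
    have v : val d p = det2 (fld φ p) p := by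
      rw [hd, val_angular f0 f1, hF.fld_eq hp]
      simp [det2]; ring
    have v1 : val (angular α β) p = det2 (fld ψ p) p := by
      rw [val_angular g0 g1, hG.fld_eq hp]
      simp [det2]; ring
    have v2 : val e p = det2 (fld φ p) (fld ψ p) := by
      rw [he, val_sub (f0.mul g1) (f1.mul g0), val_mul f0 g1, val_mul f1 g0, hF.fld_eq hp,
        hG.fld_eq hp]
      simp [det2]
    refine ⟨v ▸ hp2, ⟨(definedAt_angular g0 g1).div hp1 hp2, ?_⟩,
      ((f0.mul g1).sub (f1.mul g0)).div hp1 hp2, ?_⟩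
    · rw [val_div (definedAt_angular g0 g1) hp1 hp2, v, v1]; rfl
    · rw [val_div ((f0.mul g1).sub (f1.mul g0)) hp1 hp2, v, v2]; rfl
  have hUo : IsOpen U := by
    refine isOpen_iff_mem_nhds.2 fun p hp => ?_
    have c := (contDiffAt_val hp.2.1 (n := 0)).continuousAt.eventually_ne hp.2.2
    filter_upwards [hφ.domain.mem_nhds hp.1, eventually_definedAt hp.2.1, c] with q h1 h2 h3
      using ⟨h1, h2, h3⟩
  have hUn : U.Nonempty := by
    obtain ⟨p, hp, h1⟩ := (generic_val_ne_zero hD).exists_mem hφ.domain.isOpen hφ.domain.nonempty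
    exact ⟨p, hp, h1⟩
  have key : ∀ p ∈ U, val (along ϖ ϱ (angular α β / d)) p = val (e / d) p ∧
      val (along ϖ ϱ (e / d)) p = 0 := by
    intro p hpU
    have hp := hpU.1
    obtain ⟨h1, ⟨h2, h3⟩, h4, h5⟩ := hU p hpU
    obtain ⟨k1, k2, -, -⟩ := fderiv_coef (hφ.contDiffAt_fld hp) (hψ.contDiffAt_fld hp) h1
      (hφ.fderiv_fld_self hp) (hψ.fderiv_fld_self hp) (fderiv_fld_comm hφ hψ hc hp)
    have e1 : coefF (fld φ) (fld ψ) =ᶠ[𝓝 p] val (angular α β / d) := by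
      filter_upwards [hUo.mem_nhds hpU] with q hq using (hU q hq).2.1.2.symm
    have e2 : coefE (fld φ) (fld ψ) =ᶠ[𝓝 p] val (e / d) := by
      filter_upwards [hUo.mem_nhds hpU] with q hq using (hU q hq).2.2.2.symm
    rw [e1.fderiv_eq, (hasFDerivAt_val h2).fderiv, hF.fld_eq hp] at k1
    rw [e2.fderiv_eq, (hasFDerivAt_val h4).fderiv, hF.fld_eq hp] at k2
    rw [val_along (hF p hp).1 (hF p hp).2.1 h2, val_along (hF p hp).1 (hF p hp).2.1 h4, h5, ← k1,
      ← k2]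
    constructor <;> simp <;> ring
  refine ⟨angular α β / d, e / d,
    IsHomog.div (m := 3) (isHomog_angular hα hβ) (isHomog_angular hϖ hϱ) hD,
    IsHomog.div (m := 3) he4 (isHomog_angular hϖ hϱ) hD,
    ratFun_eq_of_val hUo hUn fun p hp _ _ => (key p hp).1,
    ratFun_eq_zero_of_val hUo hUn fun p hp _ => (key p hp).2, ?_, ?_⟩
  -- Cramer's rule
  · rw [div_mul_eq_mul_div, div_mul_eq_mul_div, ← add_div, eq_div_iff hD, he, hd]
    simp only [angular]; ring
  · rw [div_mul_eq_mul_div, div_mul_eq_mul_div, ← add_div, eq_div_iff hD, he, hd]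
    simp only [angular]; ring

theorem HasRationalField.germEq_flowPow {C : Set Plane} {φ ψ : Plane → Plane} {ϖ ϱ : RatFun} {c : ℝ}
    (hφ : IsProjectiveFlow C φ) (hψ : IsProjectiveFlow C ψ) (hF : HasRationalField C φ ϖ ϱ)
    (hG : HasRationalField C ψ (const c * ϖ) (const c * ϱ)) : GermEq C ψ (flowPow φ c) := by
  refine hψ.germEq_of_fld_eq (hφ.flowPow c) fun p hp => ?_
  obtain ⟨f0, f1, -⟩ := hF p hp
  rw [fld_flowPow, hF.fld_eq hp, hG.fld_eq hp, val_mul (definedAt_const _ _) f0,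
    val_mul (definedAt_const _ _) f1, val_const]
  simp

/-- The coefficients of the second field of a commuting pair in the frame formed by the first field
and the radial field. -/
theorem exists_levelOneData_of_commutes {C : Set Plane} {φ ψ : Plane → Plane} {ϖ ϱ α β : RatFun}
    (hφ : IsProjectiveFlow C φ) (hψ : IsProjectiveFlow C ψ) (hF : HasRationalField C φ ϖ ϱ)
    (hG : HasRationalField C ψ α β) (hc : Commutes C φ ψ) (hD : angular ϖ ϱ ≠ 0)
    (hne : ∀ c : ℝ, ¬ GermEq C ψ (flowPow φ c)) :
    ∃ a b : RatFun, IsLevelOneData ϖ ϱ a b ∧ α = a * ϖ + b * coord 0 ∧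
      β = a * ϱ + b * coord 1 := by
  obtain ⟨a, b, ha, hb, hab, hbb, hα, hβ⟩ := exists_coef_of_commutes hφ hψ hF hG hc hD
  refine ⟨a, b, ⟨hD, ha, hb, ?_, hab, hbb⟩, hα, hβ⟩
  rintro rfl
  obtain ⟨c, rfl⟩ := exists_eq_const_of_along hD ha hab
  rw [zero_mul, add_zero] at hα hβ
  subst hα hβ
  exact hne c (HasRationalField.germEq_flowPow hφ hψ hF hG)

theorem isAlgebraicFlowOfLevelOne_of_commutes {C : Set Plane} {φ ψ : Plane → Plane}
    {ϖ ϱ α β : RatFun} (hφ : IsProjectiveFlow C φ) (hψ : IsProjectiveFlow C ψ)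
    (hF : HasRationalField C φ ϖ ϱ) (hG : HasRationalField C ψ α β) (hc : Commutes C φ ψ)
    (hD : angular ϖ ϱ ≠ 0) (hne : ∀ c : ℝ, ¬ GermEq C ψ (flowPow φ c)) :
    IsAlgebraicFlowOfLevelOne C φ ∧ IsAlgebraicFlowOfLevelOne C ψ := by
  obtain ⟨a, b, h, rfl, rfl⟩ := exists_levelOneData_of_commutes hφ hψ hF hG hc hD hne
  exact ⟨h.isAlgebraicFlowOfLevelOne hφ hF, h.dual.isAlgebraicFlowOfLevelOne hψ hG⟩

end ProjFlow

namespace ProjFlow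

/-! ### Straight flows have rational fields and rational orbit functions -/

/-- The Jacobian determinant of two rational functions. -/
noncomputable def jacobian (V Y : RatFun) : RatFun := pd 0 V * pd 1 Y - pd 1 V * pd 0 Y

/-- The first component of the field `z V² ∂_V - w Y² ∂_Y`. -/
noncomputable def straightX (V Y : RatFun) (z w : ℝ) : RatFun :=
  (const z * V ^ 2 * pd 1 Y + const w * Y ^ 2 * pd 1 V) / jacobian V Y

/-- The second component of the field `z V² ∂_V - w Y² ∂_Y`. -/
noncomputable def straightY (V Y : RatFun) (z w : ℝ) : RatFun :=
  -(const z * V ^ 2 * pd 0 Y + const w * Y ^ 2 * pd 0 V) / jacobian V Y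

theorem along_straight_left {V Y : RatFun} (h : jacobian V Y ≠ 0) (z w : ℝ) :
    along (straightX V Y z w) (straightY V Y z w) V = const z * V ^ 2 := by
  rw [along_apply, straightX, straightY, div_mul_eq_mul_div, div_mul_eq_mul_div, ← add_div,
    div_eq_iff h, jacobian]
  ring

theorem along_straight_right {V Y : RatFun} (h : jacobian V Y ≠ 0) (z w : ℝ) :
    along (straightX V Y z w) (straightY V Y z w) Y = -(const w * Y ^ 2) := by
  rw [along_apply, straightX, straightY, div_mul_eq_mul_div, div_mul_eq_mul_div, ← add_div,
    div_eq_iff h, jacobian]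
  ring

theorem angular_straight {V Y : RatFun} (hV : IsHomog 1 V) (hY : IsHomog 1 Y)
    (z w : ℝ) :
    angular (straightX V Y z w) (straightY V Y z w) =
      V * Y * (const z * V + const w * Y) / jacobian V Y := by
  have e1 := hV.euler
  have e2 := hY.euler
  rw [Nat.cast_one, const_one, one_mul] at e1 e2
  rw [angular, straightX, straightY, mul_div_assoc', mul_div_assoc', ← sub_div]
  congr 1
  linear_combination const z * V ^ 2 * e2 + const w * Y ^ 2 * e1

namespace IsChart
variable {C : Set Plane} {V Y : RatFun} {p : Plane} {z w : ℝ} {φ : Plane → Plane}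

theorem definedAt_jacobian (h : IsChart C V Y) (hp : p ∈ C) :
    DefinedAt (jacobian V Y) p ∧ val (jacobian V Y) p ≠ 0 := by
  have v0 := definedAt_pd (h.definedV p hp) 0
  have v1 := definedAt_pd (h.definedV p hp) 1
  have y0 := definedAt_pd (h.definedY p hp) 0
  have y1 := definedAt_pd (h.definedY p hp) 1
  refine ⟨(v0.mul y1).sub (v1.mul y0), ?_⟩
  rw [jacobian, val_sub (v0.mul y1) (v1.mul y0), val_mul v0 y1, val_mul v1 y0]
  exact h.jac p hp

theorem jacobian_ne_zero (h : IsChart C V Y) : jacobian V Y ≠ 0 :=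
  ne_zero_of_val_ne_zero (h.definedAt_jacobian h.domain.nonempty.some_mem).2

theorem add_ne_zero (h : IsChart C V Y) (hzw : (z, w) ≠ (0, 0)) :
    const z * V + const w * Y ≠ 0 := by
  intro h0
  have e : ∀ i, const z * pd i V + const w * pd i Y = 0 := fun i => by
    have := congrArg (pdDer i) h0
    rw [map_add, Derivation.leibniz, Derivation.leibniz, map_zero] at this
    simpa [pd_const] using this
  apply hzw
  have hj := h.jacobian_ne_zero
  have e1 : const z * jacobian V Y = 0 := by
    rw [jacobian]; linear_combination pd 1 Y * e 0 - pd 0 Y * e 1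
  have e2 : const w * jacobian V Y = 0 := by
    rw [jacobian]; linear_combination pd 0 V * e 1 - pd 1 V * e 0
  have e3 := (mul_eq_zero.1 e1).resolve_right hj
  have e4 := (mul_eq_zero.1 e2).resolve_right hj
  rw [← const_zero] at e3 e4
  rw [const_injective e3, const_injective e4]

theorem left_ne_zero (h : IsChart C V Y) : V ≠ 0 := by
  simpa [const_one, const_zero] using h.add_ne_zero (z := 1) (w := 0) (by simp)

theorem right_ne_zero (h : IsChart C V Y) : Y ≠ 0 := by
  simpa [const_one, const_zero] using h.add_ne_zero (z := 0) (w := 1) (by simp)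

theorem hasRationalField (h : IsChart C V Y) (hφ : IsStraight C V Y z w φ) :
    HasRationalField C φ (straightX V Y z w) (straightY V Y z w) := by
  intro p hp
  have dV := h.definedV p hp
  have dY := h.definedY p hp
  obtain ⟨dJ, hJ⟩ := h.definedAt_jacobian hp
  have dx : DefinedAt (straightX V Y z w) p :=
    ((((definedAt_const z p).mul (dV.pow 2)).mul (definedAt_pd dY 1)).add
      (((definedAt_const w p).mul (dY.pow 2)).mul (definedAt_pd dV 1))).div dJ hJ
  have dy : DefinedAt (straightY V Y z w) p :=
    ((((definedAt_const z p).mul (dV.pow 2)).mul (definedAt_pd dY 0)).add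
      (((definedAt_const w p).mul (dY.pow 2)).mul (definedAt_pd dV 0))).neg.div dJ hJ
  refine ⟨dx, dy, ?_⟩
  have e : fld φ p = ![val (straightX V Y z w) p, val (straightY V Y z w) p] := by
    obtain ⟨e1, e2⟩ := h.dval_fld hφ hp
    apply h.eq_of_dval_eq hp
    · rw [e1]
      have := val_along dx dy dV
      rw [along_straight_left h.jacobian_ne_zero, val_mul (definedAt_const z p) (dV.pow 2),
        val_const, val_pow dV] at this
      simp only [linForm_apply, Matrix.cons_val_zero, Matrix.cons_val_one]
      linear_combination this
    · rw [e2]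
      have := val_along dx dy dY
      rw [along_straight_right h.jacobian_ne_zero,
        val_neg ((definedAt_const w p).mul (dY.pow 2)), val_mul (definedAt_const w p) (dY.pow 2),
        val_const, val_pow dY] at this
      simp only [linForm_apply, Matrix.cons_val_zero, Matrix.cons_val_one]
      linear_combination this
  rw [← e]
  exact (h.isProjectiveFlow hφ).hasDerivAt_zero hp

theorem angular_ne_zero (h : IsChart C V Y) (hzw : (z, w) ≠ (0, 0)) :
    angular (straightX V Y z w) (straightY V Y z w) ≠ 0 := by
  rw [angular_straight h.homogV h.homogY]
  exact div_ne_zero (mul_ne_zero (mul_ne_zero h.left_ne_zero h.right_ne_zero) (h.add_ne_zero hzw))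
    h.jacobian_ne_zero

theorem levelOneData_left (h : IsChart C V Y) :
    IsLevelOneData (straightX V Y 1 0) (straightY V Y 1 0) (Y / V) (-Y) := by
  have e1 := along_straight_left h.jacobian_ne_zero 1 0
  have e2 := along_straight_right h.jacobian_ne_zero 1 0
  have hV := h.left_ne_zero
  rw [const_one, one_mul] at e1
  rw [const_zero, zero_mul, neg_zero] at e2
  refine ⟨h.angular_ne_zero (by simp), IsHomog.div (m := 1) h.homogY h.homogV hV, h.homogY.neg,
    neg_ne_zero.2 h.right_ne_zero, ?_, by rw [map_neg, e2, neg_zero]⟩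
  rw [Derivation.leibniz_div, e1, e2]
  simp only [smul_eq_mul]
  field_simp
  ring

theorem levelOneData_right (h : IsChart C V Y) :
    IsLevelOneData (straightX V Y 0 1) (straightY V Y 0 1) (V / Y) V := by
  have e1 := along_straight_left h.jacobian_ne_zero 0 1
  have e2 := along_straight_right h.jacobian_ne_zero 0 1
  have hY := h.right_ne_zero
  rw [const_one, one_mul] at e2
  rw [const_zero, zero_mul] at e1
  refine ⟨h.angular_ne_zero (by simp), IsHomog.div (m := 1) h.homogV h.homogY hY, h.homogV,
    h.left_ne_zero, ?_, e1⟩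
  rw [Derivation.leibniz_div, e1, e2]
  simp only [smul_eq_mul]
  field_simp
  ring

theorem isAlgebraicFlowOfLevelOne_left (h : IsChart C V Y) (hφ : IsStraight C V Y 1 0 φ) :
    IsAlgebraicFlowOfLevelOne C φ :=
  h.levelOneData_left.isAlgebraicFlowOfLevelOne (h.isProjectiveFlow hφ) (h.hasRationalField hφ)

theorem isAlgebraicFlowOfLevelOne_right (h : IsChart C V Y) (hφ : IsStraight C V Y 0 1 φ) :
    IsAlgebraicFlowOfLevelOne C φ :=
  h.levelOneData_right.isAlgebraicFlowOfLevelOne (h.isProjectiveFlow hφ) (h.hasRationalField hφ)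

/-- The orbit function of a straight flow is the inverse of `z / Y + w / V`. -/
theorem isOrbitFunction (h : IsChart C V Y) (hzw : (z, w) ≠ (0, 0)) :
    IsOrbitFunction (straightX V Y z w) (straightY V Y z w)
      (V * Y / (const z * V + const w * Y)) := by
  have hs := h.add_ne_zero hzw
  have hd := mul_ne_zero h.left_ne_zero h.right_ne_zero
  have e1 := along_straight_left h.jacobian_ne_zero z w
  have e2 := along_straight_right h.jacobian_ne_zero z w
  have hc : ∀ c : ℝ, along (straightX V Y z w) (straightY V Y z w) (const c) = 0 := fun c => by
    rw [along_apply, pd_const, pd_const, mul_zero, mul_zero, add_zero]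
  refine IsHomog.isOrbitFunction (IsHomog.div (m := 1) (h.homogV.mul h.homogY) ?_ hs)
    (div_ne_zero hd hs) ?_
  · have a1 := (isHomog_const z).mul h.homogV
    have a2 := (isHomog_const w).mul h.homogY
    rw [zero_add] at a1 a2
    exact a1.add a2
  · rw [Derivation.leibniz_div, map_add, Derivation.leibniz, Derivation.leibniz, Derivation.leibniz,
      e1, e2, hc, hc]
    simp only [smul_eq_mul]
    rw [mul_eq_zero]
    right
    ring

/-- By the Euler relations, the differentials of the coordinates at `p` take the values `V(p)`, `Y(p)`
on the vector `p`. -/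
theorem eq_zero_of_val_eq_zero (h : IsChart C V Y) (hp : p ∈ C) (hV : val V p = 0)
    (hY : val Y p = 0) : p = 0 := by
  have key : ∀ {f : RatFun}, IsHomog 1 f → DefinedAt f p → dval f p p = val f p := by
    intro f hf hd
    have := congrArg (fun g => val g p) hf.euler
    rw [Nat.cast_one, const_one, one_mul, val_add ((definedAt_coord 0 p).mul (definedAt_pd hd 0))
      ((definedAt_coord 1 p).mul (definedAt_pd hd 1)), val_mul (definedAt_coord 0 p)
      (definedAt_pd hd 0), val_mul (definedAt_coord 1 p) (definedAt_pd hd 1), val_coord,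
      val_coord] at this
    rw [← this, linForm_apply]
    ring
  apply h.eq_of_dval_eq hp
  · rw [key h.homogV (h.definedV p hp), hV, map_zero]
  · rw [key h.homogY (h.definedY p hp), hY, map_zero]

/-- The function `V Y / (z V + w Y)` is constant along the trajectories. At the zeros of the
denominator it is defined only if the denominator cancels, or at the origin. -/
theorem isConserved (h : IsChart C V Y) (hφ : IsStraight C V Y z w φ) (hzw : (z, w) ≠ (0, 0)) :
    IsConserved C φ (V * Y / (const z * V + const w * Y)) := by
  set W := V * Y / (const z * V + const w * Y) with hW
  have hs := h.add_ne_zero hzw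
  have hWs : W * (const z * V + const w * Y) = V * Y := div_mul_cancel₀ _ hs
  intro p hp
  filter_upwards [hφ.eqV p hp, hφ.eqY p hp, (hφ.tendsto p hp).eventually (h.domain.mem_nhds hp),
    continuous_snd.continuousAt.eventually (h.domain.mem_nhds hp)] with x eV eY hx' hx dW
  have d : ∀ q ∈ C, DefinedAt (const z * V + const w * Y) q := fun q hq =>
    ((definedAt_const z q).mul (h.definedV q hq)).add ((definedAt_const w q).mul (h.definedY q hq))
  have vs : ∀ q ∈ C, val (const z * V + const w * Y) q = z * val V q + w * val Y q := fun q hq => by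
    rw [val_add ((definedAt_const z q).mul (h.definedV q hq))
      ((definedAt_const w q).mul (h.definedY q hq)), val_mul (definedAt_const z q)
      (h.definedV q hq), val_mul (definedAt_const w q) (h.definedY q hq), val_const, val_const]
  have vm : ∀ q ∈ C, val (V * Y) q = val V q * val Y q := fun q hq =>
    val_mul (h.definedV q hq) (h.definedY q hq)
  set q := x.2
  set q' := flowPow φ x.1 x.2 with hq'
  by_cases h0 : z * val V q + w * val Y q = 0
  · rcases eq_or_ne z 0 with rfl | hz
    · have hw : w ≠ 0 := fun h => hzw (by rw [h])
      -- the denominator is a multiple of `Y` and cancels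
      have e : W = const w⁻¹ * V := by
        rw [hW, const_zero, zero_mul, zero_add, div_eq_iff (mul_ne_zero (const_ne_zero hw)
          h.right_ne_zero)]
        have : const w⁻¹ * const w = 1 := by
          rw [const, const, ← map_mul, ← map_mul, inv_mul_cancel₀ hw]; simp
        linear_combination -(V * Y) * this
      rw [e, val_mul (definedAt_const _ _) (h.definedV _ hx'),
        val_mul (definedAt_const _ _) (h.definedV _ hx)]
      refine ⟨(definedAt_const _ _).mul (h.definedV _ hx'), ?_⟩
      rw [zero_mul, zero_mul, sub_zero, mul_one] at eV
      rw [eV, val_const, val_const]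
    · rcases eq_or_ne w 0 with rfl | hw
      -- the denominator is a multiple of `V` and cancels
      · have e : W = const z⁻¹ * Y := by
          rw [hW, const_zero, zero_mul, add_zero, div_eq_iff (mul_ne_zero (const_ne_zero hz)
            h.left_ne_zero)]
          have : const z⁻¹ * const z = 1 := by
            rw [const, const, ← map_mul, ← map_mul, inv_mul_cancel₀ hz]; simp
          linear_combination -(V * Y) * this
        rw [e, val_mul (definedAt_const _ _) (h.definedY _ hx'),
          val_mul (definedAt_const _ _) (h.definedY _ hx)]
        refine ⟨(definedAt_const _ _).mul (h.definedY _ hx'), ?_⟩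
        rw [zero_mul, zero_mul, add_zero, mul_one] at eY
        rw [eY, val_const, val_const]
      · -- here both coordinates vanish, so that the point is the fixed point `0`
        have hm := congrArg (fun f => val f q) hWs
        rw [val_mul dW (d q hx), vs q hx, h0, mul_zero, vm q hx] at hm
        have hv : val V q = 0 := by
          rcases mul_eq_zero.1 hm.symm with h1 | h1
          · exact h1
          · rw [h1, mul_zero, add_zero] at h0
            exact (mul_eq_zero.1 h0).resolve_left hz
        have hy : val Y q = 0 := by
          rw [hv, mul_zero, zero_add] at h0
          exact (mul_eq_zero.1 h0).resolve_left hw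
        have e1 : q = 0 := h.eq_zero_of_val_eq_zero hx hv hy
        have e2 : q' = 0 := by
          apply h.eq_zero_of_val_eq_zero hx'
          · rw [hv] at eV
            simpa using eV
          · rw [hy] at eY
            simpa using eY
        rw [e2, ← e1]
        exact ⟨dW, rfl⟩
  · have hs' : (z * val V q' + w * val Y q') * ((1 - z * x.1 * val V q) * (1 + w * x.1 * val Y q)) =
        z * val V q + w * val Y q := by
      linear_combination (z * (1 + w * x.1 * val Y q)) * eV + (w * (1 - z * x.1 * val V q)) * eY
    have h0' : z * val V q' + w * val Y q' ≠ 0 := fun h1 => h0 (by rw [← hs', h1, zero_mul])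
    refine ⟨((h.definedV _ hx').mul (h.definedY _ hx')).div (d _ hx') (by rwa [vs _ hx']), ?_⟩
    rw [hW, val_div ((h.definedV _ hx').mul (h.definedY _ hx')) (d _ hx') (by rwa [vs _ hx']),
      val_div ((h.definedV _ hx).mul (h.definedY _ hx)) (d _ hx) (by rwa [vs _ hx]), vs _ hx',
      vs _ hx, vm _ hx', vm _ hx, div_eq_div_iff h0' h0]
    linear_combination -(val V q' * val Y q') * hs' + (z * val V q' + w * val Y q') *
      (val Y q' * (1 + w * x.1 * val Y q) * eV + val V q * eY)

end IsChart

end ProjFlow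

namespace ProjFlow

/-! ### The flows determined by a homogeneous rational function -/

theorem IsHomog.val_pd_smul {f : RatFun} (hf : IsHomog 1 f) {p : Plane} (hp : DefinedAt f p) {t : ℝ}
    (ht : t ≠ 0) (i : Fin 2) : val (pd i f) (t • p) = val (pd i f) p := by
  have h1 : HasFDerivAt (fun q : Plane => t • q) (t • ContinuousLinearMap.id ℝ Plane) p :=
    (hasFDerivAt_id p).const_smul t
  have h2 : HasFDerivAt (fun q : Plane => val f (t • q))
      ((dval f (t • p)).comp (t • ContinuousLinearMap.id ℝ Plane)) p :=
    HasFDerivAt.comp (f := fun q : Plane => t • q) p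
      (hasFDerivAt_val (hf.definedAt_smul hp ht)) h1
  have h3 : HasFDerivAt (fun q : Plane => val f (t • q)) (t • dval f p) p := by
    refine ((hasFDerivAt_val hp).const_smul t).congr_of_eventuallyEq ?_
    filter_upwards [eventually_definedAt hp] with q hq
    rw [hf.val_smul hq ht, pow_one]; rfl
  have h4 := congrArg (fun l => l (Pi.single i 1)) (h2.unique h3)
  fin_cases i
  · simpa [ht] using h4
  · simpa [ht] using h4

theorem pd_zero_ne_zero {V : RatFun} (hV : IsHomog 1 V) (hne : ∀ c : ℝ, V ≠ const c * coord 1) :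
    pd 0 V ≠ 0 := by
  intro h
  have hy : coord 1 ≠ 0 := ne_zero_of_val_ne_zero (p := ![0, 1]) (by simp)
  have e := hV.euler
  rw [Nat.cast_one, const_one, one_mul, h, mul_zero, zero_add] at e
  obtain ⟨g, hg⟩ : ∃ g, pd 1 V = g := ⟨_, rfl⟩
  rw [hg] at e
  subst e
  have e0 : coord 1 * pd 0 g = 0 := by
    rw [pd_mul, pd_coord, if_neg (by decide)] at h
    linear_combination h
  have e1 : coord 1 * pd 1 g = 0 := by
    rw [pd_mul, pd_coord, if_pos rfl] at hg
    linear_combination hg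
  obtain ⟨c, rfl⟩ := exists_eq_const ((mul_eq_zero.1 e0).resolve_left hy)
    ((mul_eq_zero.1 e1).resolve_left hy)
  exact hne c (mul_comm _ _)

theorem isOpen_regularCone (V : RatFun) : IsOpen (regularCone V) := by
  refine isOpen_iff_mem_nhds.2 fun p hp => ?_
  filter_upwards [eventually_definedAt hp.1, eventually_definedAt hp.2.1,
    (contDiffAt_val hp.2.1 (n := 0)).continuousAt.eventually_ne hp.2.2] with q h1 h2 h3
    using ⟨h1, h2, h3⟩

theorem dense_regularCone {V : RatFun} (h : pd 0 V ≠ 0) : Dense (regularCone V) :=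
  (((generic_definedAt V).and (generic_val_ne_zero h)).mono fun _ hp => hp).dense

theorem isFlowDomain_regularCone {V : RatFun} (hV : IsHomog 1 V) (h : pd 0 V ≠ 0) :
    IsFlowDomain (regularCone V) := by
  refine ⟨isOpen_regularCone V, (dense_regularCone h).nonempty, fun p hp t ht => ?_⟩
  have h1 := hV.definedAt_smul hp.1 ht
  exact ⟨h1, definedAt_pd h1 0, by rw [hV.val_pd_smul hp.1 ht]; exact hp.2.2⟩

theorem isChart_of_subset_regularCone {V : RatFun} (hV : IsHomog 1 V) {C : Set Plane}
    (hC : IsFlowDomain C) (hCV : C ⊆ regularCone V) : IsChart C V (coord 1) := by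
  refine ⟨hC, hV, isHomog_coord 1, fun p hp => (hCV hp).1, fun p _ => definedAt_coord 1 p,
    fun p hp => ?_⟩
  rw [pd_coord, pd_coord, if_pos rfl, if_neg (by decide), val_one, val_zero, mul_one, mul_zero,
    sub_zero]
  exact (hCV hp).2.2

theorem flowPow_flowOfA (a : Plane → ℝ) (z : ℝ) (q : Plane) :
    flowPow (flowOfA a) z q = ![firstPow a z q, q 1 / (1 + z * q 1)] := by
  rcases eq_or_ne z 0 with rfl | hz
  · ext i; fin_cases i <;> simp [firstPow]
  · rw [flowPow_of_ne _ hz]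
    ext i
    fin_cases i
    · simp [firstPow, hz, flowOfA]
    · simp only [flowOfA, Pi.smul_apply, smul_eq_mul, Fin.mk_one, Matrix.cons_val_one,
        Matrix.cons_val_fin_one]
      rw [mul_div_assoc, inv_mul_cancel_left₀ hz, add_comm]

theorem flowPow_flowOfU (u : Plane → ℝ) (z : ℝ) (q : Plane) :
    flowPow (flowOfU u) z q = ![firstPow u z q, q 1] := by
  rcases eq_or_ne z 0 with rfl | hz
  · ext i; fin_cases i <;> simp [firstPow]
  · rw [flowPow_of_ne _ hz]
    ext i
    fin_cases i
    · simp [firstPow, hz, flowOfU]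
    · simp [flowOfU, hz]

theorem IsMainBranch.tendsto {C : Set Plane} {f : Plane → ℝ} (h : IsMainBranch C f) {p : Plane}
    (hp : p ∈ C) :
    Filter.Tendsto (fun x : ℝ × Plane => firstPow f x.1 x.2) (𝓝 ((0 : ℝ), p)) (𝓝 (p 0)) := by
  have hu : (𝓝 ((0 : ℝ), p)) = 𝓝[{x : ℝ × Plane | x.1 ≠ 0}] ((0 : ℝ), p) ⊔
      𝓝[{x : ℝ × Plane | x.1 ≠ 0}ᶜ] ((0 : ℝ), p) := by
    rw [← nhdsWithin_union, Set.union_compl_self, nhdsWithin_univ]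
  rw [hu, Filter.tendsto_sup]
  constructor
  · refine (h p hp).congr' ?_
    filter_upwards [self_mem_nhdsWithin] with x hx
    rw [firstPow, if_neg hx]
  · have h1 : Filter.Tendsto (fun x : ℝ × Plane => x.2 0) (𝓝 ((0 : ℝ), p)) (𝓝 (p 0)) := by
      have : Continuous fun x : ℝ × Plane => x.2 0 := by fun_prop
      exact this.tendsto ((0 : ℝ), p)
    refine (h1.mono_left nhdsWithin_le_nhds).congr' ?_
    filter_upwards [self_mem_nhdsWithin] with x hx
    rw [firstPow, if_pos (not_not.1 hx)]

theorem tendsto_div_one_add (w : ℝ) (p : Plane) :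
    Filter.Tendsto (fun x : ℝ × Plane => x.2 1 / (1 + w * x.1 * x.2 1)) (𝓝 ((0 : ℝ), p))
      (𝓝 (p 1)) := by
  have h1 : ContinuousAt (fun x : ℝ × Plane => x.2 1 / (1 + w * x.1 * x.2 1)) ((0 : ℝ), p) := by
    refine ContinuousAt.div (by fun_prop) (by fun_prop) (by simp)
  have := h1.tendsto
  simpa using this

theorem eventually_one_add_ne (w : ℝ) (f : Plane → ℝ) {p : Plane} (hf : ContinuousAt f p) :
    ∀ᶠ x : ℝ × Plane in 𝓝 ((0 : ℝ), p), 1 + w * x.1 * f x.2 ≠ 0 := by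
  have h2 : ContinuousAt (fun x : ℝ × Plane => f x.2) ((0 : ℝ), p) :=
    ContinuousAt.comp (f := fun x : ℝ × Plane => x.2) hf continuous_snd.continuousAt
  have h1 : ContinuousAt (fun x : ℝ × Plane => 1 + w * x.1 * f x.2) ((0 : ℝ), p) := by
    fun_prop
  exact h1.eventually_ne (by simp)

theorem continuousAt_val {f : RatFun} {p : Plane} (hf : DefinedAt f p) : ContinuousAt (val f) p :=
  (contDiffAt_val hf (n := 0)).continuousAt

theorem IsSolutionA.isStraight {V : RatFun} (hV : IsHomog 1 V) {C : Set Plane} {a : Plane → ℝ}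
    (hC : IsFlowDomain C) (hCV : C ⊆ regularCone V) (ha : IsSolutionA V C a) :
    IsStraight C V (coord 1) 0 1 (flowOfA a) := by
  have ht : ∀ p ∈ C, Filter.Tendsto (fun x : ℝ × Plane => flowPow (flowOfA a) x.1 x.2)
      (𝓝 ((0 : ℝ), p)) (𝓝 p) := by
    intro p hp
    simp only [flowPow_flowOfA]
    rw [tendsto_pi_nhds]
    intro i
    fin_cases i
    · exact ha.1.tendsto hp
    · simpa using tendsto_div_one_add 1 p
  refine ⟨ht, fun p hp => ?_, fun p hp => ?_⟩
  · filter_upwards [ha.2 p hp, (ht p hp).eventually (hC.mem_nhds hp),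
      continuous_snd.continuousAt.eventually (hC.mem_nhds hp)] with x h1 h2 h3
    rw [zero_mul, zero_mul, sub_zero, mul_one]
    rcases eq_or_ne x.1 0 with h0 | h0
    · rw [h0, flowPow_zero]
    · have h4 := h1 h0
      change val V (flowOfA a (x.1 • x.2)) = _ at h4
      rw [← smul_flowPow (flowOfA a) h0, hV.val_smul (hCV h2).1 h0, hV.val_smul (hCV h3).1 h0] at h4
      exact mul_left_cancel₀ (pow_ne_zero 1 h0) h4
  · filter_upwards [eventually_one_add_ne 1 (fun q => q 1) (p := p) (continuous_apply 1).continuousAt] with x h1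
    rw [flowPow_flowOfA, val_coord, val_coord]
    simp only [Matrix.cons_val_one, Matrix.cons_val_fin_one, one_mul] at h1 ⊢
    exact div_mul_cancel₀ _ h1

theorem IsSolutionU.isStraight {V : RatFun} (hV : IsHomog 1 V) {C : Set Plane} {u : Plane → ℝ}
    (hC : IsFlowDomain C) (hCV : C ⊆ regularCone V) (hu : IsSolutionU V C u) :
    IsStraight C V (coord 1) 1 0 (flowOfU u) := by
  have ht : ∀ p ∈ C, Filter.Tendsto (fun x : ℝ × Plane => flowPow (flowOfU u) x.1 x.2)
      (𝓝 ((0 : ℝ), p)) (𝓝 p) := by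
    intro p hp
    simp only [flowPow_flowOfU]
    rw [tendsto_pi_nhds]
    intro i
    fin_cases i
    · exact hu.1.tendsto hp
    · simpa using tendsto_div_one_add 0 p
  refine ⟨ht, fun p hp => ?_, fun p hp => ?_⟩
  · filter_upwards [hu.2 p hp, (ht p hp).eventually (hC.mem_nhds hp),
      continuous_snd.continuousAt.eventually (hC.mem_nhds hp),
      eventually_one_add_ne (-1) (val V) (continuousAt_val (hCV hp).1)] with x h1 h2 h3 h5
    rcases eq_or_ne x.1 0 with h0 | h0
    · rw [h0, flowPow_zero]; ring
    · have h4 := h1 h0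
      change val V (flowOfU u (x.1 • x.2)) = _ at h4
      rw [← smul_flowPow (flowOfU u) h0, hV.val_smul (hCV h2).1 h0, hV.val_smul (hCV h3).1 h0, pow_one,
        mul_div_assoc] at h4
      have h6 : 1 - x.1 * val V x.2 ≠ 0 := fun h => h5 (by linear_combination h)
      rw [mul_left_cancel₀ h0 h4, one_mul, div_mul_cancel₀ _ h6]
  · refine Filter.Eventually.of_forall fun x => ?_
    rw [flowPow_flowOfU, val_coord, val_coord]
    simp

theorem isMainBranch_of_tendsto {C : Set Plane} {φ : Plane → Plane}
    (h : ∀ p ∈ C, Filter.Tendsto (fun x : ℝ × Plane => flowPow φ x.1 x.2) (𝓝 ((0 : ℝ), p)) (𝓝 p)) :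
    IsMainBranch C fun q => φ q 0 := by
  intro p hp
  refine ((tendsto_pi_nhds.1 (h p hp) 0).mono_left nhdsWithin_le_nhds).congr' ?_
  filter_upwards [self_mem_nhdsWithin] with x hx
  rw [flowPow_of_ne _ hx]; rfl

theorem IsChart.isSolutionA {V : RatFun} {C : Set Plane} {φ : Plane → Plane}
    (h : IsChart C V (coord 1)) (hφ : IsStraight C V (coord 1) 0 1 φ) :
    IsSolutionA V C fun q => φ q 0 := by
  refine ⟨isMainBranch_of_tendsto hφ.tendsto, fun p hp => ?_⟩
  filter_upwards [hφ.eqV p hp, hφ.eqY p hp, (hφ.tendsto p hp).eventually (h.domain.mem_nhds hp),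
    continuous_snd.continuousAt.eventually (h.domain.mem_nhds hp),
    eventually_one_add_ne 1 (fun q => q 1) (p := p) (continuous_apply 1).continuousAt] with x e1 e2 h1 h2 h3 h0
  rw [zero_mul, zero_mul, sub_zero, mul_one] at e1
  rw [val_coord, val_coord] at e2
  have e3 : ![φ (x.1 • x.2) 0, (x.1 • x.2) 1 / ((x.1 • x.2) 1 + 1)] = x.1 • flowPow φ x.1 x.2 := by
    rw [smul_flowPow _ h0]
    ext i
    fin_cases i
    · rfl
    · rw [← eq_div_iff h3] at e2
      have := congrFun (smul_flowPow φ h0 x.2) 1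
      simp only [Pi.smul_apply, smul_eq_mul] at this
      simp only [Pi.smul_apply, smul_eq_mul, Fin.mk_one, Matrix.cons_val_one,
        Matrix.cons_val_fin_one]
      rw [← this, e2, mul_div_assoc, add_comm, one_mul]
  rw [e3, h.homogV.val_smul (h.definedV _ h1) h0, h.homogV.val_smul (h.definedV _ h2) h0, e1]

theorem IsChart.isSolutionU {V : RatFun} {C : Set Plane} {φ : Plane → Plane}
    (h : IsChart C V (coord 1)) (hφ : IsStraight C V (coord 1) 1 0 φ) :
    IsSolutionU V C fun q => φ q 0 := by
  refine ⟨isMainBranch_of_tendsto hφ.tendsto, fun p hp => ?_⟩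
  filter_upwards [hφ.eqV p hp, hφ.eqY p hp, (hφ.tendsto p hp).eventually (h.domain.mem_nhds hp),
    continuous_snd.continuousAt.eventually (h.domain.mem_nhds hp)] with x e1 e2 h1 h2 h0
  rw [zero_mul, zero_mul, add_zero, mul_one, val_coord, val_coord] at e2
  have e3 : ![φ (x.1 • x.2) 0, (x.1 • x.2) 1] = x.1 • flowPow φ x.1 x.2 := by
    rw [smul_flowPow _ h0]
    ext i
    fin_cases i
    · rfl
    · have := congrFun (smul_flowPow φ h0 x.2) 1
      simp only [Pi.smul_apply, smul_eq_mul] at this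
      simp only [Pi.smul_apply, smul_eq_mul, Fin.mk_one, Matrix.cons_val_one,
        Matrix.cons_val_fin_one]
      rw [← this, e2]
  have h3 := one_sub_ne_zero_of_mul_eq e1
  rw [e3, h.homogV.val_smul (h.definedV _ h1) h0, h.homogV.val_smul (h.definedV _ h2) h0, pow_one,
    eq_div_iff (by rwa [one_mul] at h3)]
  linear_combination x.1 * e1

theorem exists_isSolutionA {V : RatFun} {C : Set Plane} (h : IsChart C V (coord 1)) :
    ∃ a, IsSolutionA V C a := ⟨_, h.isSolutionA (h.isStraight_liftFlow 0 1)⟩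

theorem exists_isSolutionU {V : RatFun} {C : Set Plane} (h : IsChart C V (coord 1)) :
    ∃ u, IsSolutionU V C u := ⟨_, h.isSolutionU (h.isStraight_liftFlow 1 0)⟩

theorem isStraight_flowPow_comp {V : RatFun} (hV : IsHomog 1 V) {C : Set Plane} {a u : Plane → ℝ}
    (hC : IsFlowDomain C) (hCV : C ⊆ regularCone V) (ha : IsSolutionA V C a)
    (hu : IsSolutionU V C u) (z w : ℝ) :
    IsStraight C V (coord 1) z w (flowPow (flowOfU u) z ∘ flowPow (flowOfA a) w) := by
  have := ((hu.isStraight hV hC hCV).flowPow z).comp ((ha.isStraight hV hC hCV).flowPow w)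
  simpa using this

theorem flowPow_flowOfU_comp_flowPow_flowOfA (a u : Plane → ℝ) (z w : ℝ) (q : Plane) :
    (flowPow (flowOfU u) z ∘ flowPow (flowOfA a) w) q =
      ![firstPow u z ![firstPow a w q, q 1 / (1 + w * q 1)], q 1 / (1 + w * q 1)] := by
  rw [Function.comp, flowPow_flowOfA, flowPow_flowOfU]
  simp

end ProjFlow

namespace ProjFlow

/-! ### Rational solutions -/

/-- If a straight flow has rational coordinates, then its directions along a fixed orbit express the
direction of an arbitrary point as a rational function of `V / y`: the point of the orbit with a
given direction is determined by the value of `V / y`, and it is reached at a time `ζ` which is a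
Möbius function of that value. -/
theorem IsChart.exists_direction {C : Set Plane} {V r₀ r₁ : RatFun} {e f : ℝ} {θ : Plane → Plane}
    {p : Plane} (h : IsChart C V (coord 1)) (hθ : IsStraight C V (coord 1) e f θ) (hp : p ∈ C)
    (hr : NearVertex C fun q =>
      (DefinedAt r₀ q ∧ θ q 0 = val r₀ q) ∧ DefinedAt r₁ q ∧ θ q 1 = val r₁ q)
    (hv : val V p ≠ 0) (hp1 : p 1 ≠ 0) (hef : f * p 1 + e * val V p ≠ 0)
    (hf : const (p 1) * V - const (val V p) * coord 1 ≠ 0) :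
    ∃ (A B : Polynomial ℝ) (ζ : RatFun), ζ = (const (p 1) * V - const (val V p) * coord 1) /
        (const (val V p * p 1) * (const f * coord 1 + const e * V)) ∧
      Polynomial.aeval ζ A ≠ 0 ∧
      coord 0 * Polynomial.aeval ζ A = coord 1 * Polynomial.aeval ζ B := by
  set v := val V p with hvdef
  -- the quotient `N / M` is the time at which the trajectory of `p` reaches the ray of a point
  set N := const (p 1) * V - const v * coord 1 with hN
  set M := const (v * p 1) * (const f * coord 1 + const e * V) with hM
  have dN : ∀ q, DefinedAt V q → DefinedAt N q ∧ val N q = p 1 * val V q - v * q 1 := by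
    intro q hq
    have d1 := (definedAt_const (p 1) q).mul hq
    have d2 := (definedAt_const v q).mul (definedAt_coord 1 q)
    refine ⟨d1.sub d2, ?_⟩
    rw [hN, val_sub d1 d2, val_mul (definedAt_const _ q) hq,
      val_mul (definedAt_const _ q) (definedAt_coord 1 q)]
    simp
  have dM : ∀ q, DefinedAt V q → DefinedAt M q ∧ val M q = v * p 1 * (f * q 1 + e * val V q) := by
    intro q hq
    have d1 := (definedAt_const f q).mul (definedAt_coord 1 q)
    have d2 := (definedAt_const e q).mul hq
    refine ⟨(definedAt_const _ q).mul (d1.add d2), ?_⟩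
    rw [hM, val_mul (definedAt_const _ q) (d1.add d2), val_add d1 d2,
      val_mul (definedAt_const _ q) hq, val_mul (definedAt_const _ q) (definedAt_coord 1 q)]
    simp
  have hVp := h.definedV p hp
  have hMp : val M p ≠ 0 := by
    rw [(dM p hVp).2]; exact mul_ne_zero (mul_ne_zero hv hp1) hef
  have hNp : val N p = 0 := by rw [(dN p hVp).2, ← hvdef]; ring
  have dζp : DefinedAt (N / M) p := (dN p hVp).1.div (dM p hVp).1 hMp
  have hζp : val (N / M) p = 0 := by rw [val_div (dN p hVp).1 (dM p hVp).1 hMp, hNp, zero_div]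
  -- the numerators and denominators of the coordinates of `θ` at the points `z p`
  set A₀ := rayPoly p (numer r₀)
  set B₀ := rayPoly p (denom r₀)
  set A₁ := rayPoly p (numer r₁)
  set B₁ := rayPoly p (denom r₁)
  obtain ⟨⟨U, hU, hinj⟩, -⟩ := h.exists_localInverse hp
  have tz : Filter.Tendsto (fun q => (val (N / M) q, p)) (𝓝 p) (𝓝 ((0 : ℝ), p)) := by
    have := (continuousAt_val dζp).tendsto
    rw [hζp] at this
    exact this.prodMk_nhds tendsto_const_nhds
  have tq : Filter.Tendsto (fun q : Plane => (flowPow θ (val (N / M) q) p 1 / q 1) • q) (𝓝 p)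
      (𝓝 p) := by
    have t1 := (tendsto_pi_nhds.1 ((hθ.tendsto p hp).comp tz) 1).div
      ((continuous_apply (1 : Fin 2)).tendsto p) hp1
    have t2 := t1.smul (continuous_id.tendsto p)
    rw [div_self hp1, id, one_smul] at t2
    exact t2
  have key : ∀ᶠ q in 𝓝 p, (DefinedAt V q ∧ DefinedAt (N / M) q) ∧ (val N q ≠ 0 →
      (A₁ * B₀).eval (val (N / M) q) ≠ 0 ∧ q 0 * (A₁ * B₀).eval (val (N / M) q) =
        q 1 * (A₀ * B₁).eval (val (N / M) q)) := by
    filter_upwards [eventually_definedAt hVp, eventually_definedAt dζp,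
      (continuousAt_val (dM p hVp).1).eventually_ne hMp,
      (continuous_apply (1 : Fin 2)).continuousAt.eventually_ne hp1,
      tz.eventually (hθ.eqV p hp), tz.eventually (hθ.eqY p hp), tz.eventually (hr p hp),
      ((hθ.tendsto p hp).comp tz).eventually hU, tq.eventually hU]
      with q dV dζ hMq hq1 eV eY hrq hU1 hU2
    refine ⟨⟨dV, dζ⟩, fun hNq => ?_⟩
    have hz : val (N / M) q * (v * p 1 * (f * q 1 + e * val V q)) = p 1 * val V q - v * q 1 := by
      rw [val_div (dN q dV).1 (dM q dV).1 hMq, ← (dM q dV).2, ← (dN q dV).2,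
        div_mul_cancel₀ _ hMq]
    have hz0 : val (N / M) q ≠ 0 := by
      rw [val_div (dN q dV).1 (dM q dV).1 hMq]; exact div_ne_zero hNq hMq
    simp only [Function.comp] at hU1
    generalize val (N / M) q = z at *
    have hq := hrq hz0
    rw [val_coord, val_coord] at eY
    rw [← hvdef] at eV
    set x := flowPow θ z p with hx
    have n1 := one_sub_ne_zero_of_mul_eq eV
    have hx1 : x 1 ≠ 0 := fun h0 => hp1 (by rw [← eY, h0, zero_mul])
    have n2 : 1 + f * z * p 1 ≠ 0 := fun h0 => hp1 (by rw [← eY, h0, mul_zero])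
    have hc : x 1 / q 1 ≠ 0 := div_ne_zero hx1 hq1
    have hVx : val V x * q 1 = x 1 * val V q := by
      apply mul_right_cancel₀ (mul_ne_zero n1 n2)
      linear_combination q 1 * (1 + f * z * p 1) * eV - val V q * (1 - e * z * v) * eY + hz
    -- the point of the trajectory at the time `z` lies on the ray of `q`, by local injectivity
    have hxq : x = (x 1 / q 1) • q := by
      refine hinj _ hU1 _ hU2 ?_ ?_
      · rw [h.homogV.val_smul dV hc, pow_one, div_mul_eq_mul_div, eq_div_iff hq1, hVx]
      · rw [val_coord, val_coord, Pi.smul_apply, smul_eq_mul, div_mul_cancel₀ _ hq1]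
    have hx0 : x 0 * q 1 = x 1 * q 0 := by
      have := congrFun hxq 0
      rw [Pi.smul_apply, smul_eq_mul] at this
      rw [this]; field_simp
    obtain ⟨⟨d0, e0⟩, d1, e1⟩ := hq
    have b0 := val_mul_denom d0
    have b1 := val_mul_denom d1
    rw [← e0, ← smul_flowPow θ hz0, Pi.smul_apply, smul_eq_mul, ← eval_rayPoly,
      ← eval_rayPoly] at b0
    rw [← e1, ← smul_flowPow θ hz0, Pi.smul_apply, smul_eq_mul, ← eval_rayPoly,
      ← eval_rayPoly] at b1
    unfold DefinedAt at d0 d1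
    rw [← eval_rayPoly] at d0 d1
    change z * x 0 * B₀.eval z = A₀.eval z at b0
    change z * x 1 * B₁.eval z = A₁.eval z at b1
    rw [Polynomial.eval_mul, Polynomial.eval_mul, ← b0, ← b1]
    refine ⟨mul_ne_zero (mul_ne_zero (mul_ne_zero hz0 hx1) d1) d0, ?_⟩
    linear_combination -(z * B₀.eval z * B₁.eval z) * hx0
  obtain ⟨W, hW, hWo, hpW⟩ := mem_nhds_iff.1 key
  have vals : ∀ q, DefinedAt (N / M) q → ∀ P : Polynomial ℝ,
      DefinedAt (Polynomial.aeval (N / M) P) q ∧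
        val (Polynomial.aeval (N / M) P) q = P.eval (val (N / M) q) :=
    fun q hq P => definedAt_aeval hq P
  refine ⟨A₁ * B₀, A₀ * B₁, N / M, rfl, ?_, ?_⟩
  · obtain ⟨q, hq, h1, h2⟩ := (generic_val_ne_zero hf).exists_mem hWo ⟨p, hpW⟩
    obtain ⟨⟨dV, dζ⟩, h3⟩ := hW hq
    exact ne_zero_of_val_ne_zero (p := q) (by rw [(vals q dζ _).2]; exact (h3 h2).1)
  -- the factor `N` accounts for the points of the ray of `p`, where the time is zero
  · have h0 : N * (coord 0 * Polynomial.aeval (N / M) (A₁ * B₀) -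
        coord 1 * Polynomial.aeval (N / M) (A₀ * B₁)) = 0 := by
      refine ratFun_eq_zero_of_val hWo ⟨p, hpW⟩ fun q hq _ => ?_
      obtain ⟨⟨dV, dζ⟩, h3⟩ := hW hq
      have d1 := (definedAt_coord 0 q).mul (vals q dζ (A₁ * B₀)).1
      have d2 := (definedAt_coord 1 q).mul (vals q dζ (A₀ * B₁)).1
      rw [val_mul (dN q dV).1 (d1.sub d2), val_sub d1 d2, val_mul (definedAt_coord 0 q)
        (vals q dζ (A₁ * B₀)).1, val_mul (definedAt_coord 1 q) (vals q dζ (A₀ * B₁)).1,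
        (vals q dζ (A₁ * B₀)).2, (vals q dζ (A₀ * B₁)).2, val_coord, val_coord]
      by_cases hNq : val N q = 0
      · rw [hNq, zero_mul]
      · rw [(h3 hNq).2, sub_self, mul_zero]
    exact sub_eq_zero.1 ((mul_eq_zero.1 h0).resolve_left hf)

end ProjFlow

namespace ProjFlow

/-! ### Functions of the direction -/

theorem coord_ne_zero (i : Fin 2) : coord i ≠ 0 :=
  ne_zero_of_val_ne_zero (p := fun _ => 1) (by simp)

theorem definedAt_ratio {q : Plane} (hq : q 1 ≠ 0) : DefinedAt (coord 0 / coord 1) q ∧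
    val (coord 0 / coord 1) q = q 0 / q 1 := by
  have h : val (coord 1) q ≠ 0 := by rwa [val_coord]
  refine ⟨(definedAt_coord 0 q).div (definedAt_coord 1 q) h, ?_⟩
  rw [val_div (definedAt_coord 0 q) (definedAt_coord 1 q) h, val_coord, val_coord]

theorem isOpen_snd_ne : IsOpen {q : Plane | q 1 ≠ 0} :=
  isOpen_ne.preimage (continuous_apply 1)

theorem aeval_ratio_injective :
    Function.Injective (Polynomial.aeval (R := ℝ) (coord 0 / coord 1 : RatFun)) := by
  rw [injective_iff_map_eq_zero]
  intro P hP
  refine Polynomial.funext fun t => ?_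
  have h := definedAt_ratio (q := ![t, 1]) (by simp)
  have h2 := (definedAt_aeval h.1 P).2
  rw [hP, val_zero, h.2] at h2
  simpa using h2.symm

/-- The embedding of `ℝ(t)` into `ℝ(x, y)` which sends `t` to `x / y`. -/
noncomputable def ratioHom : RatFunc ℝ →ₐ[ℝ] RatFun :=
  RatFunc.liftAlgHom (Polynomial.aeval (coord 0 / coord 1))
    (nonZeroDivisors_le_comap_nonZeroDivisors_of_injective _ aeval_ratio_injective)

theorem ratioHom_injective : Function.Injective ratioHom :=
  RatFunc.liftAlgHom_injective _ aeval_ratio_injective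

theorem ratioHom_div (P Q : Polynomial ℝ) :
    ratioHom (algebraMap _ _ P / algebraMap _ _ Q) =
      Polynomial.aeval (coord 0 / coord 1) P / Polynomial.aeval (coord 0 / coord 1) Q :=
  RatFunc.liftAlgHom_apply_div _ _ P Q

theorem ratioHom_X : ratioHom RatFunc.X = coord 0 / coord 1 := by
  have := ratioHom_div Polynomial.X 1
  simpa using this

theorem eval_aeval_X_one (P : Poly) (t : ℝ) :
    (MvPolynomial.aeval ![(Polynomial.X : Polynomial ℝ), 1] P).eval t =
      MvPolynomial.eval ![t, 1] P := by
  induction P using MvPolynomial.induction_on with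
  | C a => simp
  | add P Q hP hQ => simp [hP, hQ]
  | mul_X P i hP => fin_cases i <;> simp [hP]

theorem ofPoly_eq_of_isHomogeneous {P : Poly} {n : ℕ} (hP : P.IsHomogeneous n) :
    ofPoly P = coord 1 ^ n * Polynomial.aeval (coord 0 / coord 1)
      (MvPolynomial.aeval ![(Polynomial.X : Polynomial ℝ), 1] P) := by
  refine ratFun_eq_of_val isOpen_snd_ne ⟨fun _ => 1, one_ne_zero⟩ fun q hq _ _ => ?_
  have h := definedAt_ratio hq
  have h2 := definedAt_aeval h.1 (MvPolynomial.aeval ![(Polynomial.X : Polynomial ℝ), 1] P)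
  have hq' : q 1 ≠ 0 := hq
  rw [val_mul ((definedAt_coord 1 q).pow n) h2.1, val_pow (definedAt_coord 1 q), val_coord, h2.2,
    h.2, eval_aeval_X_one, ← eval_smul_of_isHomogeneous hP, val_ofPoly]
  congr 2
  ext i
  fin_cases i
  · simp [mul_div_cancel₀ _ hq']
  · simp

theorem exists_ratioHom_eq {V : RatFun} (hV : IsHomog 1 V) : ∃ g, ratioHom g = V / coord 1 := by
  obtain ⟨d, P, Q, hP, hQ, hQ0, rfl⟩ := hV
  refine ⟨algebraMap _ _ (MvPolynomial.aeval ![(Polynomial.X : Polynomial ℝ), 1] P) /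
    algebraMap _ _ (MvPolynomial.aeval ![(Polynomial.X : Polynomial ℝ), 1] Q), ?_⟩
  change _ = ofPoly P / ofPoly Q / _
  have hQ1 := ofPoly_ne_zero hQ0
  have hy := coord_ne_zero 1
  rw [ratioHom_div]
  rw [ofPoly_eq_of_isHomogeneous hQ] at hQ1 ⊢
  rw [ofPoly_eq_of_isHomogeneous hP]
  have := right_ne_zero_of_mul hQ1
  field_simp
  ring

/-- A homogeneous function from which the direction of a point can be recovered rationally has
degree one as a function of the direction. -/
theorem exists_moebius {V : RatFun} (hV : IsHomog 1 V) (hne : ∀ c : ℝ, V ≠ const c * coord 1)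
    {A B : Polynomial ℝ} {c₁ c₂ c₃ e f : ℝ} {ζ : RatFun}
    (hζ : ζ = (const c₁ * V - const c₂ * coord 1) /
      (const c₃ * (const f * coord 1 + const e * V)))
    (hA : Polynomial.aeval ζ A ≠ 0)
    (hAB : coord 0 * Polynomial.aeval ζ A = coord 1 * Polynomial.aeval ζ B) :
    ∃ α β γ δ : ℝ, α * δ - β * γ ≠ 0 ∧ V * (const γ * coord 0 + const δ * coord 1) =
      coord 1 * (const α * coord 0 + const β * coord 1) := by
  obtain ⟨g, hg⟩ := exists_ratioHom_eq hV
  have hy := coord_ne_zero 1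
  have hc : ∀ c : ℝ, ratioHom (algebraMap ℝ _ c) = const c := fun c => by
    rw [AlgHom.commutes, algebraMap_real_eq_const]
  -- the field generated by `V / y` contains the direction, and so it is all of `ℝ(t)`
  let E := IntermediateField.adjoin ℝ {g}
  have hgE : g ∈ E := IntermediateField.mem_adjoin_simple_self ℝ g
  let η : RatFunc ℝ := (algebraMap ℝ _ c₁ * g - algebraMap ℝ _ c₂) /
      (algebraMap ℝ _ c₃ * (algebraMap ℝ _ f + algebraMap ℝ _ e * g))
  have hη : η ∈ E := by
    refine E.div_mem (E.sub_mem (E.mul_mem (E.algebraMap_mem _) hgE) (E.algebraMap_mem _))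
      (E.mul_mem (E.algebraMap_mem _) (E.add_mem (E.algebraMap_mem _)
        (E.mul_mem (E.algebraMap_mem _) hgE)))
  have hηζ : ratioHom η = ζ := by
    simp only [η, map_div₀, map_sub, map_mul, map_add, hc, hg, hζ]
    rw [show const c₁ * V - const c₂ * coord 1 = coord 1 * (const c₁ * (V / coord 1) - const c₂) by
        field_simp,
      show const c₃ * (const f * coord 1 + const e * V) =
        coord 1 * (const c₃ * (const f + const e * (V / coord 1))) by field_simp,
      mul_div_mul_left _ _ hy]
  have hX : RatFunc.X * Polynomial.aeval η A = Polynomial.aeval η B := by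
    apply ratioHom_injective
    rw [map_mul, ratioHom_X, ← Polynomial.aeval_algHom_apply, ← Polynomial.aeval_algHom_apply, hηζ,
      div_mul_eq_mul_div, hAB, mul_div_cancel_left₀ _ hy]
  have hA' : Polynomial.aeval η A ≠ 0 := by
    intro h0
    apply hA
    rw [← hηζ, Polynomial.aeval_algHom_apply, h0, map_zero]
  have hmem : ∀ P : Polynomial ℝ, Polynomial.aeval η P ∈ E := fun P => by
    have := (Polynomial.aeval (⟨η, hη⟩ : E) P).2
    rwa [← IntermediateField.aeval_coe] at this
  have hXE : (RatFunc.X : RatFunc ℝ) ∈ E := by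
    rw [← eq_div_iff hA'] at hX
    rw [hX]
    exact E.div_mem (hmem _) (hmem _)
  have htop : E = ⊤ := by
    rw [eq_top_iff, ← RatFunc.adjoin_X]
    exact IntermediateField.adjoin_simple_le_iff.2 hXE
  -- its degree is the maximum of the degrees of the numerator and the denominator of `V / y`
  have hdeg := RatFunc.finrank_eq_max_natDegree g
  rw [show IntermediateField.adjoin ℝ {g} = ⊤ from htop, IntermediateField.finrank_top] at hdeg
  obtain ⟨α, β, hnum⟩ : ∃ α β, g.num = Polynomial.C α * Polynomial.X + Polynomial.C β :=
    ⟨_, _, Polynomial.eq_X_add_C_of_natDegree_le_one (hdeg ▸ le_max_left _ _)⟩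
  obtain ⟨γ, δ, hden⟩ : ∃ γ δ, g.denom = Polynomial.C γ * Polynomial.X + Polynomial.C δ :=
    ⟨_, _, Polynomial.eq_X_add_C_of_natDegree_le_one (hdeg ▸ le_max_right _ _)⟩
  have hden0 : ¬ (γ = 0 ∧ δ = 0) := by
    rintro ⟨rfl, rfl⟩
    exact g.denom_ne_zero (by rw [hden]; simp)
  have hL : const γ * coord 0 + const δ * coord 1 ≠ 0 := by
    apply ne_zero_of_val_ne_zero (p := ![γ, δ])
    rw [val_add ((definedAt_const _ _).mul (definedAt_coord _ _))
      ((definedAt_const _ _).mul (definedAt_coord _ _)), val_mul (definedAt_const _ _)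
      (definedAt_coord _ _), val_mul (definedAt_const _ _) (definedAt_coord _ _)]
    simp only [val_const, val_coord, Matrix.cons_val_zero, Matrix.cons_val_one]
    intro h0
    exact hden0 (mul_self_add_mul_self_eq_zero.1 h0)
  have hVL : V * (const γ * coord 0 + const δ * coord 1) =
      coord 1 * (const α * coord 0 + const β * coord 1) := by
    have e1 := ratioHom_div g.num g.denom
    rw [RatFunc.num_div_denom, hg, hnum, hden] at e1
    simp only [map_add, map_mul, Polynomial.aeval_C, Polynomial.aeval_X,
      algebraMap_real_eq_const] at e1
    rw [show const α * (coord 0 / coord 1) + const β =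
        (const α * coord 0 + const β * coord 1) / coord 1 by field_simp,
      show const γ * (coord 0 / coord 1) + const δ =
        (const γ * coord 0 + const δ * coord 1) / coord 1 by field_simp,
      div_div_div_cancel_right₀ hy, div_eq_div_iff hy hL] at e1
    rw [e1, mul_comm]
  refine ⟨α, β, γ, δ, fun h0 => ?_, hVL⟩
  -- if the determinant vanishes, the two linear forms are proportional
  have hs : γ ^ 2 + δ ^ 2 ≠ 0 := fun h => hden0 (by
    constructor <;> nlinarith [sq_nonneg γ, sq_nonneg δ])
  obtain ⟨c, hα, hβ⟩ : ∃ c, α = c * γ ∧ β = c * δ := by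
    refine ⟨(α * γ + β * δ) / (γ ^ 2 + δ ^ 2), ?_, ?_⟩
    · field_simp; linear_combination δ * h0
    · field_simp; linear_combination -γ * h0
  apply hne c
  apply mul_right_cancel₀ hL
  have hcm : ∀ s t : ℝ, const (s * t) = const s * const t := fun s t => by simp [const]
  rw [hVL, hα, hβ, hcm, hcm]
  ring

end ProjFlow

namespace ProjFlow

/-! ### Möbius functions of the direction -/

section Moebius
variable {V : RatFun} {C : Set Plane} {α β γ δ : ℝ}

theorem val_linear (a b : ℝ) (q : Plane) :
    DefinedAt (const a * coord 0 + const b * coord 1) q ∧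
      val (const a * coord 0 + const b * coord 1) q = a * q 0 + b * q 1 := by
  have h0 := (definedAt_const a q).mul (definedAt_coord 0 q)
  have h1 := (definedAt_const b q).mul (definedAt_coord 1 q)
  refine ⟨h0.add h1, ?_⟩
  rw [val_add h0 h1, val_mul (definedAt_const _ _) (definedAt_coord _ _),
    val_mul (definedAt_const _ _) (definedAt_coord _ _)]
  simp

/-- On a cone where it is defined, `y (αx + βy) / (γx + δy)` is given by this formula, unless `y`
cancels. -/
theorem val_of_moebius (hC : IsFlowDomain C) (hdef : ∀ q ∈ C, DefinedAt V q)
    (hΔ : α * δ - β * γ ≠ 0) (h : V * (const γ * coord 0 + const δ * coord 1) =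
      coord 1 * (const α * coord 0 + const β * coord 1)) :
    (∀ q ∈ C, γ * q 0 + δ * q 1 ≠ 0 ∧
      val V q * (γ * q 0 + δ * q 1) = q 1 * (α * q 0 + β * q 1)) ∨
    (γ = 0 ∧ ∀ q ∈ C, val V q * δ = α * q 0 + β * q 1) := by
  have hv : ∀ q ∈ C, val V q * (γ * q 0 + δ * q 1) = q 1 * (α * q 0 + β * q 1) := by
    intro q hq
    have := congrArg (fun f => val f q) h
    rwa [val_mul (hdef q hq) (val_linear γ δ q).1, val_mul (definedAt_coord 1 q)
      (val_linear α β q).1, (val_linear γ δ q).2, (val_linear α β q).2, val_coord] at this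
  by_cases hγ : γ = 0
  · subst hγ
    refine Or.inr ⟨rfl, fun q hq => ?_⟩
    have e : V * const δ = const α * coord 0 + const β * coord 1 := by
      apply mul_right_cancel₀ (coord_ne_zero 1)
      rw [const_zero] at h
      linear_combination h
    have := congrArg (fun f => val f q) e
    rwa [val_mul (hdef q hq) (definedAt_const δ q), (val_linear α β q).2, val_const] at this
  · refine Or.inl fun q hq => ⟨fun hM => ?_, hv q hq⟩
    have key : ∀ q ∈ C, γ * q 0 + δ * q 1 = 0 → q = 0 := by
      intro q hq hM
      have h1 := hv q hq
      rw [hM, mul_zero] at h1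
      have hq1 : q 1 = 0 := by
        rcases mul_eq_zero.1 h1.symm with h2 | h2
        · exact h2
        · have : (α * δ - β * γ) * q 1 = 0 := by linear_combination α * hM - γ * h2
          exact (mul_eq_zero.1 this).resolve_left hΔ
      rw [hq1, mul_zero, add_zero] at hM
      ext i
      fin_cases i
      · exact (mul_eq_zero.1 hM).resolve_left hγ
      · exact hq1
    -- the denominator vanishes at the origin only, although the cone is the whole plane
    have h0 : (0 : Plane) ∈ C := key q hq hM ▸ hq
    have := key ![δ, -γ] (hC.mem_of_zero_mem h0 _) (by simp; ring)
    exact hγ (by simpa using congrFun this 1)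

theorem tendsto_pair {F G : ℝ × Plane → ℝ} {p : Plane} (hF : ContinuousAt F ((0 : ℝ), p))
    (hG : ContinuousAt G ((0 : ℝ), p)) (h0 : F (0, p) = p 0) (h1 : G (0, p) = p 1) :
    Filter.Tendsto (fun x => ![F x, G x]) (𝓝 ((0 : ℝ), p)) (𝓝 p) := by
  rw [tendsto_pi_nhds]
  intro i
  fin_cases i
  · have := hF.tendsto
    rwa [h0] at this
  · have := hG.tendsto
    rwa [h1] at this

/-- The solution of `V(u, y) = V / (1 - V)` for `V = y (αx + βy) / (γx + δy)`. -/
noncomputable def moebiusU (α β Δ : ℝ) (q : Plane) : ℝ :=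
  (Δ * q 0 + β * q 1 * (α * q 0 + β * q 1)) / (Δ - α * (α * q 0 + β * q 1))

/-- The solution of `V(a, y / (y + 1)) = V` for `V = y (αx + βy) / (γx + δy)`. -/
noncomputable def moebiusA (α β γ δ Δ : ℝ) (q : Plane) : ℝ :=
  (Δ * q 0 + δ * q 1 * (α * q 0 + β * q 1)) / ((1 + q 1) * (Δ - γ * (α * q 0 + β * q 1)))

theorem firstPow_moebiusU {Δ : ℝ} (hΔ : Δ ≠ 0) (z : ℝ) (q : Plane) :
    firstPow (moebiusU α β Δ) z q =
      (Δ * q 0 + z * β * q 1 * (α * q 0 + β * q 1)) / (Δ - z * α * (α * q 0 + β * q 1)) := by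
  rcases eq_or_ne z 0 with rfl | hz
  · simp [firstPow, hΔ]
  · simp only [firstPow, if_neg hz, moebiusU, Pi.smul_apply, smul_eq_mul]
    rw [← mul_div_assoc]
    congr 1
    · field_simp
    · ring

theorem firstPow_moebiusA {Δ : ℝ} (hΔ : Δ ≠ 0) (z : ℝ) (q : Plane) :
    firstPow (moebiusA α β γ δ Δ) z q = (Δ * q 0 + z * δ * q 1 * (α * q 0 + β * q 1)) /
      ((1 + z * q 1) * (Δ - z * γ * (α * q 0 + β * q 1))) := by
  rcases eq_or_ne z 0 with rfl | hz
  · simp [firstPow, hΔ]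
  · simp only [firstPow, if_neg hz, moebiusA, Pi.smul_apply, smul_eq_mul]
    rw [← mul_div_assoc]
    congr 1
    · field_simp
    · ring

theorem eventually_moebius_ne {Δ : ℝ} (hΔ : Δ ≠ 0) (c a b : ℝ) (p : Plane) :
    ∀ᶠ x : ℝ × Plane in 𝓝 ((0 : ℝ), p), Δ - x.1 * c * (a * x.2 0 + b * x.2 1) ≠ 0 := by
  have h1 : ContinuousAt (fun x : ℝ × Plane => Δ - x.1 * c * (a * x.2 0 + b * x.2 1))
      ((0 : ℝ), p) := by fun_prop
  exact h1.eventually_ne (by simpa using hΔ)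

/-- The formula for `u` solves the functional equation, as is seen by substitution. -/
theorem isStraight_moebiusU (hC : IsFlowDomain C) (hdef : ∀ q ∈ C, DefinedAt V q)
    (hΔ : α * δ - β * γ ≠ 0) (h : V * (const γ * coord 0 + const δ * coord 1) =
      coord 1 * (const α * coord 0 + const β * coord 1)) :
    IsStraight C V (coord 1) 1 0 (flowOfU (moebiusU α β (α * δ - β * γ))) := by
  have ht : ∀ p ∈ C, Filter.Tendsto (fun x : ℝ × Plane =>
      flowPow (flowOfU (moebiusU α β (α * δ - β * γ))) x.1 x.2) (𝓝 ((0 : ℝ), p)) (𝓝 p) := by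
    intro p hp
    simp only [flowPow_flowOfU, firstPow_moebiusU hΔ]
    refine tendsto_pair (ContinuousAt.div (by fun_prop) (by fun_prop) (by simpa using hΔ))
      (by fun_prop) ?_ rfl
    simp [mul_div_cancel_left₀ _ hΔ]
  refine ⟨ht, fun p hp => ?_, fun p hp => Filter.Eventually.of_forall fun x => ?_⟩
  · filter_upwards [(ht p hp).eventually (hC.mem_nhds hp), eventually_moebius_ne hΔ α α β p,
      continuous_snd.continuousAt.eventually (hC.mem_nhds hp)] with x h1 h2 h3
    set q' := flowPow (flowOfU (moebiusU α β (α * δ - β * γ))) x.1 x.2 with hq'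
    have e0 : q' 0 * (α * δ - β * γ - x.1 * α * (α * x.2 0 + β * x.2 1)) =
        (α * δ - β * γ) * x.2 0 + x.1 * β * x.2 1 * (α * x.2 0 + β * x.2 1) := by
      rw [hq', flowPow_flowOfU, firstPow_moebiusU hΔ]
      exact div_mul_cancel₀ _ h2
    have e1 : q' 1 = x.2 1 := by rw [hq', flowPow_flowOfU]; simp
    rcases val_of_moebius hC hdef hΔ h with hv | ⟨rfl, hv⟩
    · obtain ⟨hM, hV⟩ := hv x.2 h3
      obtain ⟨-, hV'⟩ := hv q' h1
      rw [e1] at hV'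
      apply mul_right_cancel₀ (mul_ne_zero hΔ hM)
      generalize val V q' = v' at *
      generalize val V x.2 = v at *
      linear_combination (α * δ - β * γ - x.1 * α * (α * x.2 0 + β * x.2 1)) * hV' +
        (α * x.2 1 - γ * v') * e0 - ((α * δ - β * γ) * (1 + v' * x.1)) * hV
    · have hV := hv x.2 h3
      have hV' := hv q' h1
      rw [e1] at hV'
      have hδ : α * δ * δ ≠ 0 := mul_ne_zero (by simpa using hΔ)
        (right_ne_zero_of_mul (a := α) (by simpa using hΔ))
      apply mul_right_cancel₀ hδ
      generalize val V q' = v' at *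
      generalize val V x.2 = v at *
      linear_combination (α * δ - x.1 * α * (α * x.2 0 + β * x.2 1)) * hV' +
        α * e0 - (α * δ * (1 + v' * x.1)) * hV
  · rw [flowPow_flowOfU, val_coord, val_coord]; simp

/-- The formula for `a` solves the functional equation, as is seen by substitution. -/
theorem isStraight_moebiusA (hC : IsFlowDomain C) (hdef : ∀ q ∈ C, DefinedAt V q)
    (hΔ : α * δ - β * γ ≠ 0) (h : V * (const γ * coord 0 + const δ * coord 1) =
      coord 1 * (const α * coord 0 + const β * coord 1)) :
    IsStraight C V (coord 1) 0 1 (flowOfA (moebiusA α β γ δ (α * δ - β * γ))) := by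
  have ht : ∀ p ∈ C, Filter.Tendsto (fun x : ℝ × Plane =>
      flowPow (flowOfA (moebiusA α β γ δ (α * δ - β * γ))) x.1 x.2) (𝓝 ((0 : ℝ), p)) (𝓝 p) := by
    intro p hp
    simp only [flowPow_flowOfA, firstPow_moebiusA hΔ]
    refine tendsto_pair (ContinuousAt.div (by fun_prop) (by fun_prop) (by simpa using hΔ))
      (ContinuousAt.div (by fun_prop) (by fun_prop) (by simp)) ?_ (by simp)
    simp [mul_div_cancel_left₀ _ hΔ]
  have hn : ∀ p : Plane, ∀ᶠ x : ℝ × Plane in 𝓝 ((0 : ℝ), p), 1 + x.1 * x.2 1 ≠ 0 := fun p => by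
    simpa using eventually_one_add_ne 1 (fun q => q 1) (p := p) (continuous_apply 1).continuousAt
  refine ⟨ht, fun p hp => ?_, fun p hp => ?_⟩
  · filter_upwards [(ht p hp).eventually (hC.mem_nhds hp), eventually_moebius_ne hΔ γ α β p, hn p,
      continuous_snd.continuousAt.eventually (hC.mem_nhds hp)] with x h1 h2 h4 h3
    set q' := flowPow (flowOfA (moebiusA α β γ δ (α * δ - β * γ))) x.1 x.2 with hq'
    have e0 : q' 0 * ((1 + x.1 * x.2 1) *
        (α * δ - β * γ - x.1 * γ * (α * x.2 0 + β * x.2 1))) =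
        (α * δ - β * γ) * x.2 0 + x.1 * δ * x.2 1 * (α * x.2 0 + β * x.2 1) := by
      rw [hq', flowPow_flowOfA, firstPow_moebiusA hΔ]
      exact div_mul_cancel₀ _ (mul_ne_zero h4 h2)
    have e1 : q' 1 * (1 + x.1 * x.2 1) = x.2 1 := by
      rw [hq', flowPow_flowOfA]
      exact div_mul_cancel₀ _ h4
    -- the values of the two linear forms at the image point
    have eL : (α * q' 0 + β * q' 1) * (α * δ - β * γ - x.1 * γ * (α * x.2 0 + β * x.2 1)) =
        (α * δ - β * γ) * (α * x.2 0 + β * x.2 1) := by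
      apply mul_right_cancel₀ h4
      linear_combination α * e0 +
        β * (α * δ - β * γ - x.1 * γ * (α * x.2 0 + β * x.2 1)) * e1
    have eM : (γ * q' 0 + δ * q' 1) * ((1 + x.1 * x.2 1) *
        (α * δ - β * γ - x.1 * γ * (α * x.2 0 + β * x.2 1))) =
        (α * δ - β * γ) * (γ * x.2 0 + δ * x.2 1) := by
      linear_combination γ * e0 +
        δ * (α * δ - β * γ - x.1 * γ * (α * x.2 0 + β * x.2 1)) * e1
    rw [zero_mul, zero_mul, sub_zero, mul_one]
    rcases val_of_moebius hC hdef hΔ h with hv | ⟨rfl, hv⟩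
    · obtain ⟨hM, hV⟩ := hv x.2 h3
      obtain ⟨-, hV'⟩ := hv q' h1
      apply mul_right_cancel₀ (mul_ne_zero hΔ hM)
      generalize val V q' = v' at *
      generalize val V x.2 = v at *
      linear_combination (1 + x.1 * x.2 1) *
        (α * δ - β * γ - x.1 * γ * (α * x.2 0 + β * x.2 1)) * hV' - v' * eM +
        q' 1 * (1 + x.1 * x.2 1) * eL + (α * δ - β * γ) * (α * x.2 0 + β * x.2 1) * e1 -
        (α * δ - β * γ) * hV
    · have hV := hv x.2 h3
      have hV' := hv q' h1
      have hδ : δ ≠ 0 := right_ne_zero_of_mul (a := α) (by simpa using hΔ)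
      apply mul_right_cancel₀ (mul_ne_zero hΔ hδ)
      linear_combination (α * δ) * hV' + eL - (α * δ) * hV
  · filter_upwards [hn p] with x h1
    rw [flowPow_flowOfA, val_coord, val_coord]
    simp only [Matrix.cons_val_one, Matrix.cons_val_fin_one, one_mul]
    exact div_mul_cancel₀ _ h1

theorem nearVertex_of_continuous {R : Plane → Prop} (h : ∀ᶠ q in 𝓝 (0 : Plane), R q) :
    NearVertex C R := fun p _ => by
  have h1 : Continuous fun x : ℝ × Plane => x.1 • x.2 := by fun_prop
  have h2 := h1.tendsto ((0 : ℝ), p)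
  rw [zero_smul] at h2
  exact (h2.eventually h).mono fun _ hx _ => hx

theorem isRationalFun_div {N M : RatFun} {n m : Plane → ℝ} (hN : ∀ q, DefinedAt N q ∧ val N q = n q)
    (hM : ∀ q, DefinedAt M q ∧ val M q = m q) (hc : ContinuousAt m 0) (h0 : m 0 ≠ 0) :
    IsRationalFun C fun q => n q / m q := by
  refine ⟨N / M, nearVertex_of_continuous ?_⟩
  filter_upwards [hc.eventually_ne h0] with q hq
  rw [← (hM q).2] at hq
  refine ⟨(hN q).1.div (hM q).1 hq, ?_⟩
  rw [val_div (hN q).1 (hM q).1 hq, (hN q).2, (hM q).2]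

theorem isRationalFun_moebiusU (hΔ : α * δ - β * γ ≠ 0) :
    IsRationalFun C (moebiusU α β (α * δ - β * γ)) := by
  set Δ := α * δ - β * γ
  have hl := val_linear α β
  have dN : ∀ q : Plane, DefinedAt (const Δ * coord 0 + const β * coord 1 *
      (const α * coord 0 + const β * coord 1)) q ∧ val (const Δ * coord 0 + const β * coord 1 *
      (const α * coord 0 + const β * coord 1)) q =
        Δ * q 0 + β * q 1 * (α * q 0 + β * q 1) := fun q => by
    have d0 := (definedAt_const Δ q).mul (definedAt_coord 0 q)
    have d1 := (definedAt_const β q).mul (definedAt_coord 1 q)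
    refine ⟨d0.add (d1.mul (hl q).1), ?_⟩
    rw [val_add d0 (d1.mul (hl q).1), val_mul d1 (hl q).1, (hl q).2,
      val_mul (definedAt_const _ _) (definedAt_coord _ _),
      val_mul (definedAt_const _ _) (definedAt_coord _ _)]
    simp
  have dM : ∀ q : Plane, DefinedAt (const Δ - const α * (const α * coord 0 + const β * coord 1)) q ∧
      val (const Δ - const α * (const α * coord 0 + const β * coord 1)) q =
        Δ - α * (α * q 0 + β * q 1) := fun q => by
    have d1 := (definedAt_const α q).mul (hl q).1
    refine ⟨(definedAt_const Δ q).sub d1, ?_⟩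
    rw [val_sub (definedAt_const Δ q) d1, val_mul (definedAt_const _ _) (hl q).1, (hl q).2]
    simp
  exact isRationalFun_div dN dM (by fun_prop) (by simpa using hΔ)

theorem isRationalFun_moebiusA (hΔ : α * δ - β * γ ≠ 0) :
    IsRationalFun C (moebiusA α β γ δ (α * δ - β * γ)) := by
  set Δ := α * δ - β * γ
  have hl := val_linear α β
  have dN : ∀ q : Plane, DefinedAt (const Δ * coord 0 + const δ * coord 1 *
      (const α * coord 0 + const β * coord 1)) q ∧ val (const Δ * coord 0 + const δ * coord 1 *
      (const α * coord 0 + const β * coord 1)) q =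
        Δ * q 0 + δ * q 1 * (α * q 0 + β * q 1) := fun q => by
    have d0 := (definedAt_const Δ q).mul (definedAt_coord 0 q)
    have d1 := (definedAt_const δ q).mul (definedAt_coord 1 q)
    refine ⟨d0.add (d1.mul (hl q).1), ?_⟩
    rw [val_add d0 (d1.mul (hl q).1), val_mul d1 (hl q).1, (hl q).2,
      val_mul (definedAt_const _ _) (definedAt_coord _ _),
      val_mul (definedAt_const _ _) (definedAt_coord _ _)]
    simp
  have dM : ∀ q : Plane, DefinedAt ((1 + coord 1) *
      (const Δ - const γ * (const α * coord 0 + const β * coord 1))) q ∧ val ((1 + coord 1) *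
      (const Δ - const γ * (const α * coord 0 + const β * coord 1))) q =
        (1 + q 1) * (Δ - γ * (α * q 0 + β * q 1)) := fun q => by
    have d0 := (definedAt_one (p := q)).add (definedAt_coord 1 q)
    have d1 := (definedAt_const γ q).mul (hl q).1
    have d2 := (definedAt_const Δ q).sub d1
    refine ⟨d0.mul d2, ?_⟩
    rw [val_mul d0 d2, val_add definedAt_one (definedAt_coord 1 q),
      val_sub (definedAt_const Δ q) d1, val_mul (definedAt_const _ _) (hl q).1, (hl q).2]
    simp
  exact isRationalFun_div dN dM (by fun_prop) (by simpa using hΔ)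

end Moebius

theorem IsRationalFun.congr {C : Set Plane} {f g : Plane → ℝ} (h : IsRationalFun C f)
    (hfg : NearVertex C fun q => g q = f q) : IsRationalFun C g := by
  obtain ⟨r, hr⟩ := h
  exact ⟨r, (hr.and hfg).mono fun q hq => ⟨hq.1.1, hq.2.trans hq.1.2⟩⟩

/-- The two solutions are rational simultaneously: either of them being rational makes `V / y` a
Möbius function of `x / y`, and in this case both are given by explicit formulas. -/
theorem isRationalFun_of_straight {V : RatFun} (hV : IsHomog 1 V)
    (hne : ∀ c : ℝ, V ≠ const c * coord 1) {C : Set Plane} {a u : Plane → ℝ}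
    (hC : IsFlowDomain C) (hCV : C ⊆ regularCone V) (ha : IsSolutionA V C a)
    (hu : IsSolutionU V C u) {e f : ℝ} {θ : Plane → Plane} (hef : (e, f) ≠ (0, 0))
    (hθ : IsStraight C V (coord 1) e f θ) (h0 : IsRationalFun C fun q => θ q 0)
    (h1 : IsRationalFun C fun q => θ q 1) : IsRationalFun C a ∧ IsRationalFun C u := by
  have hch := isChart_of_subset_regularCone hV hC hCV
  obtain ⟨r₀, hr₀⟩ := h0
  obtain ⟨r₁, hr₁⟩ := h1
  obtain ⟨p, hp, ⟨⟨-, hv⟩, -, hp1⟩, hs1, hs⟩ := ((generic_val_ne_zero hch.left_ne_zero).and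
    (generic_val_ne_zero (coord_ne_zero 1))).and
    (generic_val_ne_zero (hch.add_ne_zero hef)) |>.exists_mem hC.isOpen hC.nonempty
  have hVp := (hCV hp).1
  rw [val_coord] at hp1
  have hs' : f * p 1 + e * val V p ≠ 0 := by
    rw [val_add ((definedAt_const _ p).mul hVp) ((definedAt_const _ p).mul (definedAt_coord 1 p)),
      val_mul (definedAt_const _ p) hVp, val_mul (definedAt_const _ p) (definedAt_coord 1 p),
      val_const, val_const, val_coord] at hs
    rwa [add_comm]
  have hf : const (p 1) * V - const (val V p) * coord 1 ≠ 0 := by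
    have := hch.add_ne_zero (z := p 1) (w := -val V p) (by simp [hp1])
    have e : const (-val V p) = -const (val V p) := by simp [const]
    rwa [e, neg_mul, ← sub_eq_add_neg] at this
  obtain ⟨A, B, ζ, hζ, hA, hAB⟩ := hch.exists_direction hθ hp (hr₀.and hr₁) hv hp1 hs' hf
  obtain ⟨α, β, γ, δ, hΔ, hVm⟩ := exists_moebius hV hne hζ hA hAB
  have hdef : ∀ q ∈ C, DefinedAt V q := fun q hq => (hCV hq).1
  constructor
  · exact (isRationalFun_moebiusA hΔ).congr ((hch.germEq (ha.isStraight hV hC hCV)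
      (isStraight_moebiusA hC hdef hΔ hVm)).mono fun q hq => congrFun hq 0)
  · exact (isRationalFun_moebiusU hΔ).congr ((hch.germEq (hu.isStraight hV hC hCV)
      (isStraight_moebiusU hC hdef hΔ hVm)).mono fun q hq => congrFun hq 0)

theorem isRationalFun_iff {V : RatFun} (hV : IsHomog 1 V) (hne : ∀ c : ℝ, V ≠ const c * coord 1)
    {C : Set Plane} {a u : Plane → ℝ} (hC : IsFlowDomain C) (hCV : C ⊆ regularCone V)
    (ha : IsSolutionA V C a) (hu : IsSolutionU V C u) :
    IsRationalFun C a ↔ IsRationalFun C u := by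
  constructor
  · intro h
    refine (isRationalFun_of_straight hV hne hC hCV ha hu (e := 0) (f := 1) (by simp)
      (ha.isStraight hV hC hCV) h ?_).2
    have hy : Continuous fun q : Plane => q 1 + 1 := (continuous_apply 1).add continuous_const
    refine isRationalFun_div (N := coord 1) (M := coord 1 + 1) (n := fun q => q 1)
      (m := fun q => q 1 + 1) (fun q => ⟨definedAt_coord 1 q, val_coord 1 q⟩)
      (fun q => ⟨(definedAt_coord 1 q).add definedAt_one, ?_⟩) hy.continuousAt (by simp)
    rw [val_add (definedAt_coord 1 q) definedAt_one, val_coord, val_one]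
  · intro h
    refine (isRationalFun_of_straight hV hne hC hCV ha hu (e := 1) (f := 0) (by simp)
      (hu.isStraight hV hC hCV) h ⟨coord 1, nearVertex_of_continuous ?_⟩).1
    filter_upwards with q
    exact ⟨definedAt_coord 1 q, by simp [flowOfU]⟩

end ProjFlow

namespace ProjFlow

/-! ### Algebraic solutions of autonomous equations -/

open Polynomial in
/-- Differentiation of the coefficients of a polynomial in two variables. -/
noncomputable def coeffDeriv : ℝ[X][X] →ₗ[ℝ] ℝ[X][X] :=
  lsum fun n => (monomial n).restrictScalars ℝ ∘ₗ derivative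

open Polynomial in
theorem coeffDeriv_monomial (n : ℕ) (a : ℝ[X]) :
    coeffDeriv (monomial n a) = monomial n (derivative a) := by
  simp [coeffDeriv, lsum_apply, sum_monomial_index]

open Polynomial in
theorem coeff_coeffDeriv (R : ℝ[X][X]) (j : ℕ) :
    (coeffDeriv R).coeff j = derivative (R.coeff j) := by
  induction R using Polynomial.induction_on' with
  | add P Q hP hQ => simp [hP, hQ]
  | monomial n a =>
    rw [coeffDeriv_monomial, coeff_monomial, coeff_monomial]
    split_ifs <;> simp

open Polynomial in
/-- The derivative of a polynomial expression in `T t` and `t`. -/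
theorem hasDerivAt_evalEval {T : ℝ → ℝ} {T' t : ℝ} (hT : HasDerivAt T T' t) (R : ℝ[X][X]) :
    HasDerivAt (fun s => R.evalEval (T s) s)
      (T' * (coeffDeriv R).evalEval (T t) t +
        (Polynomial.derivative R).evalEval (T t) t) t := by
  induction R using Polynomial.induction_on' with
  | add P Q hP hQ =>
    simp only [map_add, evalEval_add]
    exact (hP.add hQ).congr_deriv (by ring)
  | monomial n a =>
    have e : ∀ (m : ℕ) (b : ℝ[X]) (x y : ℝ), (monomial m b).evalEval x y = b.eval x * y ^ m := by
      intro m b x y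
      simp [evalEval, eval_monomial]
    simp only [coeffDeriv_monomial, derivative_monomial, e]
    have h1 : HasDerivAt (fun s => a.eval (T s)) (a.derivative.eval (T t) * T') t :=
      (a.hasDerivAt (T t)).comp t hT
    refine (h1.mul (hasDerivAt_pow n t)).congr_deriv ?_
    simp
    ring

open Polynomial in
/-- If a solution `T` of `κ(T) T' = w δ(T)` is related algebraically to the time, then the time is
a rational function of `T`: differentiation of a relation of minimal degree in the time gives a
relation of smaller degree, all of whose coefficients therefore vanish. -/
theorem exists_wronskian_of_relation {T : ℝ → ℝ} {w : ℝ} {δ κ : ℝ[X]}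
    (hT : ∀ᶠ t in 𝓝[≠] (0 : ℝ), ∃ T', HasDerivAt T T' t ∧ T' * κ.eval (T t) = w * δ.eval (T t))
    (hne : ∀ c : ℝ[X], c ≠ 0 → ∀ᶠ t in 𝓝[≠] (0 : ℝ), c.eval (T t) ≠ 0)
    {R₀ : ℝ[X][X]} (hR₀ : R₀ ≠ 0) (h₀ : ∀ᶠ t in 𝓝[≠] (0 : ℝ), R₀.evalEval (T t) t = 0) :
    ∃ (n : ℕ) (P Q : ℝ[X]), n ≠ 0 ∧ Q ≠ 0 ∧
      C w * δ * (Q * derivative P - derivative Q * P) + n * κ * Q ^ 2 = 0 := by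
  classical
  have hex : ∃ n, ∃ R : ℝ[X][X], R ≠ 0 ∧ R.natDegree = n ∧
    ∀ᶠ t in 𝓝[≠] (0 : ℝ), R.evalEval (T t) t = 0 := ⟨_, R₀, hR₀, rfl, h₀⟩
  obtain ⟨R, hR, hdeg, hrel⟩ := Nat.find_spec hex
  have hmin : ∀ R' : ℝ[X][X], (∀ᶠ t in 𝓝[≠] (0 : ℝ), R'.evalEval (T t) t = 0) →
      R'.natDegree < Nat.find hex → R' = 0 := fun R' h1 h2 => by
    by_contra h3
    exact Nat.find_min hex h2 ⟨R', h3, rfl, h1⟩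
  set n := Nat.find hex
  have hlead : R.coeff n ≠ 0 := by rw [← hdeg]; exact leadingCoeff_ne_zero.2 hR
  have hn : n ≠ 0 := by
    intro h0
    obtain ⟨t, h1, h2⟩ := (hrel.and (hne _ hlead)).exists
    rw [h0] at hdeg h2
    rw [eq_C_of_natDegree_eq_zero hdeg] at h1
    exact h2 (by simpa [evalEval] using h1)
  set q := R.coeff n
  -- `q` times the derivative of the relation, minus a multiple of the relation which removes the
  -- leading coefficient
  set R' : ℝ[X][X] := C q * (C (C w * δ) * coeffDeriv R +
    C κ * derivative R) - C (C w * δ * derivative q) * R with hR'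
  have hco : ∀ j, R'.coeff j = q * (C w * δ * derivative (R.coeff j) +
      κ * (R.coeff (j + 1) * (j + 1))) - C w * δ * derivative q * R.coeff j := by
    intro j
    rw [hR', coeff_sub, coeff_C_mul, coeff_add, coeff_C_mul, coeff_C_mul, coeff_C_mul,
      coeff_derivative, coeff_coeffDeriv]
  have hzero : R' = 0 := by
    apply hmin
    · have h1 : ∀ᶠ t in 𝓝[≠] (0 : ℝ), ∀ᶠ s in 𝓝 t, R.evalEval (T s) s = 0 := by
        filter_upwards [eventually_eventually_nhdsWithin.2 hrel, self_mem_nhdsWithin] with t h1 h2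
        rwa [nhdsWithin_eq_nhds.2 (isOpen_compl_singleton.mem_nhds h2)] at h1
      filter_upwards [hT, h1, hrel] with t ⟨T', h2, h3⟩ h4 h5
      have h6 := (hasDerivAt_evalEval h2 R).unique
        ((hasDerivAt_const t (0 : ℝ)).congr_of_eventuallyEq h4)
      have e : ∀ (b : ℝ[X]) (x y : ℝ), evalEval x y (C b) = b.eval x := fun b x y => by
        simp [evalEval]
      simp only [hR', evalEval_sub, evalEval_mul, evalEval_add, e, h5, eval_mul, eval_C]
      linear_combination q.eval (T t) * κ.eval (T t) * h6 - q.eval (T t) *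
        (coeffDeriv R).evalEval (T t) t * h3
    · have hle : R'.natDegree ≤ n := natDegree_le_iff_coeff_eq_zero.2 fun N hN => by
        rw [hco, coeff_eq_zero_of_natDegree_lt (hdeg ▸ hN),
          coeff_eq_zero_of_natDegree_lt (hdeg ▸ (by omega : n < N + 1))]
        simp
      refine lt_of_le_of_ne hle fun he => ?_
      have h1 : R'.coeff n = 0 := by
        rw [hco, coeff_eq_zero_of_natDegree_lt (p := R) (n := n + 1) (by omega)]
        ring
      rw [← he, coeff_natDegree, leadingCoeff_eq_zero] at h1
      rw [h1, natDegree_zero] at he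
      exact hn he.symm
  -- the coefficient of degree `n - 1` of `R'` is the desired equation
  refine ⟨n, R.coeff (n - 1), q, hn, hlead, ?_⟩
  have h1 := hco (n - 1)
  rw [hzero, coeff_zero, Nat.sub_add_cancel (Nat.pos_of_ne_zero hn)] at h1
  have h2 : ((n - 1 : ℕ) : ℝ[X]) + 1 = n := by
    exact_mod_cast congrArg (Nat.cast (R := ℝ[X])) (Nat.sub_add_cancel (Nat.pos_of_ne_zero hn))
  rw [h2] at h1
  linear_combination -h1


/-- A quotient of functions which are algebraic over `ℝ[t]` is algebraic over `ℝ[t]`. In the resulting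
relation the roles of the two variables are exchanged. -/
theorem exists_relation_of_div {f g : ℝ → ℝ} {P Q : Polynomial (Polynomial ℝ)} (hP : P ≠ 0)
    (hQ : Q ≠ 0) (hf : ∀ᶠ t in 𝓝[≠] (0 : ℝ), P.evalEval t (f t) = 0)
    (hg : ∀ᶠ t in 𝓝[≠] (0 : ℝ), Q.evalEval t (g t) = 0) (hne : ∀ᶠ t in 𝓝[≠] (0 : ℝ), g t ≠ 0) :
    ∃ R : Polynomial (Polynomial ℝ), R ≠ 0 ∧
      ∀ᶠ t in 𝓝[≠] (0 : ℝ), R.evalEval (f t / g t) t = 0 := by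
  -- on `s` all relations hold, so that the restrictions are algebraic elements of the `ℝ[t]`-algebra
  -- of functions on `s`
  let s : Set ℝ := {t | P.evalEval t (f t) = 0 ∧ Q.evalEval t (g t) = 0 ∧ g t ≠ 0}
  let : Algebra (Polynomial ℝ) (s → ℝ) :=
    (RingHom.pi fun t : s => Polynomial.evalRingHom (t : ℝ)).toAlgebra
  have e : ∀ (R : Polynomial (Polynomial ℝ)) (h : s → ℝ) (t : s),
      Polynomial.aeval h R t = R.evalEval (t : ℝ) (h t) := by
    intro R h t
    rw [← Polynomial.map_evalRingHom_eval, Polynomial.eval_map, Polynomial.aeval_def]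
    exact Polynomial.hom_eval₂ R _ (Pi.evalRingHom (fun _ : s => ℝ) t) h
  have h1 : IsAlgebraic (Polynomial ℝ) (fun t : s => f t) :=
    ⟨P, hP, funext fun t => by rw [e]; exact t.2.1⟩
  have h2 : IsAlgebraic (Polynomial ℝ) (fun t : s => g t) :=
    ⟨Q, hQ, funext fun t => by rw [e]; exact t.2.2.1⟩
  let : Invertible (fun t : s => g t) := ⟨fun t => (g t)⁻¹,
    funext fun t => inv_mul_cancel₀ t.2.2.2, funext fun t => mul_inv_cancel₀ t.2.2.2⟩
  obtain ⟨R, hR, hR0⟩ := h1.mul h2.invOf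
  refine ⟨Polynomial.Bivariate.swap R,
    (map_ne_zero_iff _ Polynomial.Bivariate.swap.injective).2 hR, ?_⟩
  filter_upwards [hf, hg, hne] with t ht1 ht2 ht3
  have h3 := congrFun hR0 ⟨t, ht1, ht2, ht3⟩
  rw [e] at h3
  rw [← Polynomial.coe_aevalAeval_eq_evalEval, Polynomial.Bivariate.aevalAeval_swap,
    Polynomial.coe_aevalAeval_eq_evalEval]
  exact h3

theorem isHomog_aeval_ratio (P : Polynomial ℝ) :
    IsHomog 0 (Polynomial.aeval (coord 0 / coord 1) P) := by
  induction P using Polynomial.induction_on' with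
  | add P Q hP hQ => rw [map_add]; exact hP.add hQ
  | monomial n a =>
    have h : IsHomog 0 (coord 0 / coord 1) :=
      IsHomog.div (m := 1) (isHomog_coord 0) (isHomog_coord 1) (coord_ne_zero 1)
    rw [Polynomial.aeval_monomial, algebraMap_real_eq_const]
    refine (isHomog_const a).mul (n := 0) ?_
    induction n with
    | zero => simpa [const_one] using isHomog_const 1
    | succ n ih => rw [pow_succ]; exact ih.mul h

theorem along_ratio (ϖ ϱ : RatFun) :
    along ϖ ϱ (coord 0 / coord 1) = angular ϖ ϱ / coord 1 ^ 2 := by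
  have hy := coord_ne_zero 1
  have h : along ϖ ϱ (coord 0) = along ϖ ϱ (coord 0 / coord 1 * coord 1) := by
    rw [div_mul_cancel₀ _ hy]
  rw [Derivation.leibniz, along_coord_zero, along_coord_one] at h
  simp only [smul_eq_mul] at h
  rw [angular]
  field_simp at h ⊢
  linear_combination -h

/-- Polynomials in the direction of a point which express a homogeneous function of degree zero. -/
theorem IsHomog.exists_aeval_ratio {f : RatFun} (hf : IsHomog 0 f) :
    ∃ δ κ : Polynomial ℝ, κ ≠ 0 ∧ Polynomial.aeval (coord 0 / coord 1) κ * f =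
      Polynomial.aeval (coord 0 / coord 1) δ := by
  obtain ⟨d, P, Q, hP, hQ, hQ0, rfl⟩ := hf
  have hQ1 := ofPoly_ne_zero hQ0
  have hy := coord_ne_zero 1
  refine ⟨MvPolynomial.aeval ![(Polynomial.X : Polynomial ℝ), 1] P,
    MvPolynomial.aeval ![(Polynomial.X : Polynomial ℝ), 1] Q, ?_, ?_⟩
  · intro h0
    rw [ofPoly_eq_of_isHomogeneous hQ, h0, map_zero, mul_zero] at hQ1
    exact hQ1 rfl
  · change _ * (ofPoly P / ofPoly Q) = _
    rw [ofPoly_eq_of_isHomogeneous hQ] at hQ1 ⊢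
    rw [ofPoly_eq_of_isHomogeneous hP]
    have := right_ne_zero_of_mul hQ1
    field_simp
    rw [add_zero, mul_comm]

/-- A rational function of the direction which satisfies the equation of the time along the
trajectories grows with constant velocity along the field. -/
theorem exists_isLevelOneData_of_wronskian {ϖ ϱ W : RatFun} (hD : angular ϖ ϱ ≠ 0)
    (hW : IsOrbitFunction ϖ ϱ W) {w : ℝ} (hw : w ≠ 0) {δ κ P Q : Polynomial ℝ} (hκ : κ ≠ 0)
    (hδ : Polynomial.aeval (coord 0 / coord 1) κ * (angular ϖ ϱ / (W * coord 1 ^ 2)) =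
      Polynomial.aeval (coord 0 / coord 1) δ) {n : ℕ} (hn : n ≠ 0) (hQ : Q ≠ 0)
    (h : Polynomial.C w * δ * (Q * Polynomial.derivative P - Polynomial.derivative Q * P) +
      n * κ * Q ^ 2 = 0) : ∃ A : RatFun, IsLevelOneData ϖ ϱ A W := by
  have hy := coord_ne_zero 1
  have hW0 := hW.1
  have hn' : (n : ℝ) ≠ 0 := Nat.cast_ne_zero.2 hn
  set s : RatFun := coord 0 / coord 1 with hs
  have hQ' : Polynomial.aeval s Q ≠ 0 := fun h0 =>
    hQ (aeval_ratio_injective (by rw [h0, map_zero]))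
  have hκ' : Polynomial.aeval s κ ≠ 0 := fun h0 =>
    hκ (aeval_ratio_injective (by rw [h0, map_zero]))
  have hcw := const_ne_zero hw
  have hcn := const_ne_zero hn'
  refine ⟨const (-w / n) * (Polynomial.aeval s P / Polynomial.aeval s Q), hD,
    (isHomog_const _).mul (n := 0) (IsHomog.div (m := 0) (isHomog_aeval_ratio P) (isHomog_aeval_ratio Q) hQ'),
    hW.2.1, hW0, ?_, hW.along_eq_zero⟩
  have hd : ∀ R : Polynomial ℝ, along ϖ ϱ (Polynomial.aeval s R) =
      Polynomial.aeval s (Polynomial.derivative R) * (angular ϖ ϱ / coord 1 ^ 2) := fun R => by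
    rw [Derivation.map_aeval, hs, along_ratio, smul_eq_mul]
  have h1 := congrArg (Polynomial.aeval s) h
  simp only [map_add, map_mul, map_sub, map_pow, map_natCast, map_zero, Polynomial.aeval_C,
    algebraMap_real_eq_const, ← hδ] at h1
  have hcn2 : ((n : ℕ) : RatFun) = const n := by rw [← algebraMap_real_eq_const, map_natCast]
  have hcc : const (-w / n) * const n = -const w := by
    rw [const, const, const, ← map_mul, ← map_mul, ← map_neg, ← map_neg]
    congr 2
    field_simp
  have h2 : along ϖ ϱ (Polynomial.aeval s P / Polynomial.aeval s Q) =
      (Polynomial.aeval s (Polynomial.derivative P) * Polynomial.aeval s Q -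
        Polynomial.aeval s P * Polynomial.aeval s (Polynomial.derivative Q)) *
        (angular ϖ ϱ / coord 1 ^ 2) / Polynomial.aeval s Q ^ 2 := by
    rw [Derivation.leibniz_div, hd, hd]
    simp only [smul_eq_mul]
    field_simp
  have hc : along ϖ ϱ (const (-w / n)) = 0 := by
    rw [← algebraMap_real_eq_const, Derivation.map_algebraMap]
  rw [Derivation.leibniz, hc, h2, smul_zero, add_zero, smul_eq_mul]
  rw [hcn2] at h1
  generalize const (-w / n) = c at hcc ⊢
  have h3 : const w * angular ϖ ϱ * (Polynomial.aeval s Q * Polynomial.aeval s (Polynomial.derivative P) -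
      Polynomial.aeval s (Polynomial.derivative Q) * Polynomial.aeval s P) +
      const n * Polynomial.aeval s Q ^ 2 * (W * coord 1 ^ 2) = 0 := by
    refine mul_left_cancel₀ hκ' ?_
    field_simp at h1
    linear_combination h1
  field_simp
  refine mul_left_cancel₀ hcn ?_
  linear_combination (Polynomial.aeval s (Polynomial.derivative P) * Polynomial.aeval s Q -
    Polynomial.aeval s P * Polynomial.aeval s (Polynomial.derivative Q)) * angular ϖ ϱ * hcc - h3

/-- The coordinates of an algebraic flow are algebraic functions of the time along a trajectory. -/
theorem IsAlgebraicFun.exists_polynomial_ray {C : Set Plane} {f : Plane → ℝ}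
    {P : Polynomial Poly} {p : Plane} (hp : p ∈ C)
    (h : NearVertex C fun q => (P.map (MvPolynomial.eval q)).eval (f q) = 0)
    (hlead : MvPolynomial.eval p P.leadingCoeff ≠ 0) :
    ∃ R : Polynomial (Polynomial ℝ), R ≠ 0 ∧ ∀ᶠ t in 𝓝[≠] (0 : ℝ), R.evalEval t (f (t • p)) = 0 := by
  refine ⟨P.map (rayPoly p).toRingHom, fun h0 => ?_, ?_⟩
  · have h1 := congrArg (fun R => (R.coeff P.natDegree).eval 1) h0
    simp only [Polynomial.coeff_map, Polynomial.coeff_natDegree] at h1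
    change (rayPoly p P.leadingCoeff).eval 1 = _ at h1
    rw [eval_rayPoly, one_smul] at h1
    exact hlead (by simpa using h1)
  · have h1 : Filter.Tendsto (fun t : ℝ => (t, p)) (𝓝[≠] 0) (𝓝 ((0 : ℝ), p)) :=
      (Continuous.prodMk_left p).continuousAt.tendsto.mono_left nhdsWithin_le_nhds
    filter_upwards [h1.eventually (h p hp), self_mem_nhdsWithin] with t h2 h3
    rw [← Polynomial.map_evalRingHom_eval, Polynomial.map_map]
    rw [← h2 h3]
    congr 2
    ext i
    · simp
    · simp

/-- The rational time: for an algebraic flow with a rational orbit function `W` there is a rational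
function which grows with the velocity `W` along the orbits. -/
theorem exists_isLevelOneData {C : Set Plane} {φ : Plane → Plane} {ϖ ϱ W : RatFun}
    (hφ : IsProjectiveFlow C φ) (hF : HasRationalField C φ ϖ ϱ) (hD : angular ϖ ϱ ≠ 0)
    (hW : IsOrbitFunction ϖ ϱ W) (h0 : IsAlgebraicFun C fun q => φ q 0)
    (h1 : IsAlgebraicFun C fun q => φ q 1) : ∃ A : RatFun, IsLevelOneData ϖ ϱ A W := by
  obtain ⟨hϖ, hϱ⟩ := hF.isHomog hφ.domain
  obtain ⟨P₀, hP₀, h0⟩ := h0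
  obtain ⟨P₁, hP₁, h1⟩ := h1
  have hy := coord_ne_zero 1
  obtain ⟨δ, κ, hκ, hδ⟩ := IsHomog.exists_aeval_ratio (f := angular ϖ ϱ / (W * coord 1 ^ 2))
    (IsHomog.div (m := 3) (n := 0) (isHomog_angular hϖ hϱ)
      (by rw [pow_two]; exact hW.2.1.mul ((isHomog_coord 1).mul (isHomog_coord 1)))
      (mul_ne_zero hW.1 (pow_ne_zero 2 hy)))
  have hδ' : Polynomial.aeval (coord 0 / coord 1) κ * angular ϖ ϱ =
      Polynomial.aeval (coord 0 / coord 1) δ * (W * coord 1 ^ 2) := by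
    rw [← hδ, mul_assoc, div_mul_cancel₀ _ (mul_ne_zero hW.1 (pow_ne_zero 2 hy))]
  -- a point at which the field is transversal, `W` and `y` do not vanish, and the equations of the
  -- coordinates do not degenerate on the ray
  obtain ⟨p, hp, ⟨⟨⟨hp1, hp2⟩, ⟨hp3, hp4⟩⟩, ⟨hp5, hp6⟩, ⟨hp7, hp8⟩⟩, -, hp9⟩ :=
    ((((generic_val_ne_zero hD).and (generic_val_ne_zero hW.1)).and
      ((generic_val_ne_zero (ofPoly_ne_zero (Polynomial.leadingCoeff_ne_zero.2 hP₀))).and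
      (generic_val_ne_zero (ofPoly_ne_zero (Polynomial.leadingCoeff_ne_zero.2 hP₁))))).and
      (generic_val_ne_zero hy)).exists_mem
      hφ.domain.isOpen hφ.domain.nonempty
  rw [val_ofPoly] at hp6 hp8
  rw [val_coord] at hp9
  obtain ⟨R₀, hR₀, hr0⟩ := IsAlgebraicFun.exists_polynomial_ray hp h0 hp6
  obtain ⟨R₁, hR₁, hr1⟩ := IsAlgebraicFun.exists_polynomial_ray hp h1 hp8
  obtain ⟨X, hXdef⟩ : ∃ X : ℝ → Plane, ∀ t, flowPow φ t p = X t := ⟨_, fun _ => rfl⟩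
  have hX0 : X 0 = p := by rw [← hXdef, flowPow_zero]
  have hl : Filter.Tendsto (fun t : ℝ => (t, p)) (𝓝 0) (𝓝 ((0 : ℝ), p)) :=
    (Continuous.prodMk_left p).continuousAt.tendsto
  have hder : ∀ᶠ t in 𝓝 (0 : ℝ), X t ∈ C ∧ HasDerivAt X ![val ϖ (X t), val ϱ (X t)] t := by
    filter_upwards [hl.eventually (hφ.eventually_hasDerivAt hp),
      hl.eventually (hφ.eventually_mem hp)] with t h2 h3
    simp only [hXdef] at h2 h3
    exact ⟨h3, by rwa [← hF.fld_eq h3]⟩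
  have hcont : Filter.Tendsto X (𝓝 0) (𝓝 p) := by
    rw [← hX0]
    exact hder.self_of_nhds.2.continuousAt.tendsto
  have hgood : ∀ᶠ t in 𝓝 (0 : ℝ), (X t ∈ C ∧ HasDerivAt X ![val ϖ (X t), val ϱ (X t)] t) ∧
      DefinedAt W (X t) ∧ X t 1 ≠ 0 :=
    hder.and ((hcont.eventually (eventually_definedAt hp3)).and
      (hcont.eventually (isOpen_snd_ne.mem_nhds hp9)))
  obtain ⟨ε, hε, hb⟩ := Metric.eventually_nhds_iff_ball.1 hgood
  rw [Real.ball_eq_Ioo, zero_sub, zero_add] at hb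
  -- the orbit function is constant along the trajectory of `p`
  have hWc : ∀ t ∈ Set.Ioo (-ε) ε, val W (X t) = val W p := fun t ht => by
    have := eq_add_mul_of_hasDerivAt (A := fun t => val W (X t)) (c := 0) hε
      (fun s hs => (hasDerivAt_val_comp (hF _ (hb s hs).1.1).1 (hF _ (hb s hs).1.1).2.1
        (hb s hs).2.1 (hb s hs).1.2).congr_deriv (by rw [hW.along_eq_zero, val_zero])) ht
    simpa [hX0] using this
  -- the velocity of the direction
  have hT : ∀ t ∈ Set.Ioo (-ε) ε, HasDerivAt (fun s => X s 0 / X s 1)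
      (val (angular ϖ ϱ) (X t) / X t 1 ^ 2) t := fun t ht => by
    obtain ⟨⟨h2, h3⟩, -, h4⟩ := hb t ht
    have h5 := hasDerivAt_pi.1 h3
    refine ((h5 0).div (h5 1) h4).congr_deriv ?_
    rw [val_angular (hF _ h2).1 (hF _ h2).2.1]
    simp
    ring
  have hnhds : ∀ᶠ t in 𝓝[≠] (0 : ℝ), t ∈ Set.Ioo (-ε) ε :=
    nhdsWithin_le_nhds (Ioo_mem_nhds (neg_lt_zero.2 hε) hε)
  -- the direction is algebraically related to the time
  have hrat : ∃ R : Polynomial (Polynomial ℝ), R ≠ 0 ∧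
      ∀ᶠ t in 𝓝[≠] (0 : ℝ), R.evalEval (X t 0 / X t 1) t = 0 := by
    obtain ⟨R, hR, hr⟩ := exists_relation_of_div hR₀ hR₁ hr0 hr1 (by
      filter_upwards [hnhds, self_mem_nhdsWithin] with t h2 h3
      rw [← smul_flowPow φ h3, hXdef]
      exact mul_ne_zero h3 (hb t h2).2.2)
    refine ⟨R, hR, ?_⟩
    filter_upwards [hr, self_mem_nhdsWithin] with t h2 h3
    rw [← smul_flowPow φ h3, hXdef] at h2
    rwa [Pi.smul_apply, Pi.smul_apply, smul_eq_mul, smul_eq_mul, mul_div_mul_left _ _ h3] at h2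
  obtain ⟨R, hR, hr⟩ := hrat
  obtain ⟨n, P, Q, hn, hQ, hPQ⟩ := exists_wronskian_of_relation (w := val W p) (δ := δ) (κ := κ) (by
      filter_upwards [hnhds] with t h2
      refine ⟨_, hT t h2, ?_⟩
      obtain ⟨⟨h3, -⟩, h4, h5⟩ := hb t h2
      have h6 := definedAt_ratio h5
      have h7 := congrArg (fun f => val f (X t)) hδ'
      have hy2 := definedAt_coord 1 (X t)
      have hang := definedAt_angular (hF _ h3).1 (hF _ h3).2.1
      rw [val_mul (definedAt_aeval h6.1 κ).1 hang, (definedAt_aeval h6.1 κ).2, h6.2,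
        val_mul (definedAt_aeval h6.1 δ).1 (h4.mul (hy2.pow 2)), (definedAt_aeval h6.1 δ).2, h6.2,
        val_mul h4 (hy2.pow 2), val_pow hy2, val_coord, hWc t h2] at h7
      field_simp
      linear_combination h7) (by
      intro c hc
      have h2 : ∀ᶠ t in 𝓝[≠] (0 : ℝ), ∀ r ∈ c.roots.toFinset, X t 0 / X t 1 ≠ r := by
        rw [Finset.eventually_all]
        intro r _
        refine HasDerivAt.eventually_ne (hT 0 ⟨neg_lt_zero.2 hε, hε⟩) ?_
        rw [hX0]
        exact div_ne_zero hp2 (pow_ne_zero 2 hp9)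
      filter_upwards [h2] with t h2 h3
      exact h2 _ (by simpa [hc] using h3) rfl) hR hr
  exact exists_isLevelOneData_of_wronskian hD hW hp4 hκ hδ hn hQ hPQ

end ProjFlow

namespace ProjFlow

/-! ### Locally constant functions on double sectors -/

theorem eventually_eval_ne_zero {P : Polynomial ℝ} (hP : P ≠ 0) (x : ℝ) :
    ∀ᶠ s in 𝓝[≠] x, P.eval s ≠ 0 := by
  have h : ∀ᶠ s in 𝓝[≠] x, ∀ r ∈ P.roots.toFinset, s ≠ r := by
    rw [Finset.eventually_all]
    intro r _
    rcases eq_or_ne x r with rfl | hr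
    · exact self_mem_nhdsWithin
    · exact nhdsWithin_le_nhds (isOpen_ne.mem_nhds hr)
  filter_upwards [h] with s h1 h2
  exact h1 s (by simpa [hP] using h2) rfl

/-- A smooth function which coincides with multiples of one nonzero polynomial to the left and to
the right of the origin coincides with the same multiple on both sides. -/
theorem eq_of_eventually_eq_mul_polynomial {g : ℝ → ℝ} (hg : ContDiffAt ℝ ∞ g 0)
    {P : Polynomial ℝ} (hP : P ≠ 0) {k l : ℝ} (hk : ∀ᶠ s in 𝓝[>] (0 : ℝ), g s = k * P.eval s)
    (hl : ∀ᶠ s in 𝓝[<] (0 : ℝ), g s = l * P.eval s) : k = l := by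
  induction hn : P.natDegree generalizing g P with
  | zero =>
    obtain ⟨c, hc⟩ := Polynomial.natDegree_eq_zero.1 hn
    have hc0 : c ≠ 0 := by rintro rfl; exact hP (by rw [← hc, map_zero])
    subst hc
    simp only [Polynomial.eval_C] at hk hl
    have h1 := tendsto_nhds_unique (hg.continuousAt.tendsto.mono_left nhdsWithin_le_nhds)
      (tendsto_const_nhds.congr' (hk.mono fun _ h => h.symm))
    have h2 := tendsto_nhds_unique (hg.continuousAt.tendsto.mono_left nhdsWithin_le_nhds)
      (tendsto_const_nhds.congr' (hl.mono fun _ h => h.symm))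
    exact mul_right_cancel₀ hc0 (h1.symm.trans h2)
  | succ n ih =>
    have key : ∀ (m : ℝ) (s : Set ℝ), IsOpen s → (∀ᶠ x in 𝓝[s] (0 : ℝ), g x = m * P.eval x) →
        ∀ᶠ x in 𝓝[s] (0 : ℝ), deriv g x = m * (Polynomial.derivative P).eval x := by
      intro m s hs h
      filter_upwards [eventually_eventually_nhdsWithin.2 h, self_mem_nhdsWithin] with x h1 h2
      rw [nhdsWithin_eq_nhds.2 (hs.mem_nhds h2)] at h1
      exact (((P.hasDerivAt x).const_mul m).congr_of_eventuallyEq h1).deriv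
    have hd : (Polynomial.derivative P).natDegree = n := by
      rw [Polynomial.natDegree_derivative, hn, Nat.add_sub_cancel]
    refine ih (g := deriv g) ?_ (fun h0 => ?_) (key k _ isOpen_Ioi hk) (key l _ isOpen_Iio hl) hd
    · have h1 : ContDiffAt ℝ ∞ (fderiv ℝ g) 0 := hg.fderiv_right (by simp)
      exact h1.clm_apply contDiffAt_const
    · rw [Polynomial.derivative_eq_zero.1 h0] at hn
      exact (Nat.succ_ne_zero n) hn.symm

/-- The restriction of a polynomial in two variables to the line through `p` in the direction of
`v`. -/
noncomputable def linePoly (p v : Plane) : Poly →ₐ[ℝ] Polynomial ℝ :=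
  MvPolynomial.aeval fun i => Polynomial.C (p i) + v i • Polynomial.X

theorem eval_linePoly (p v : Plane) (P : Poly) (t : ℝ) :
    (linePoly p v P).eval t = MvPolynomial.eval (p + t • v) P := by
  induction P using MvPolynomial.induction_on with
  | C a => simp [linePoly]
  | add P Q hP hQ => simp [hP, hQ]
  | mul_X P i hP =>
    rw [map_mul, Polynomial.eval_mul, hP, map_mul]
    simp [linePoly]
    left; ring

/-- The vector `p` turned by a right angle. -/
def perp (p : Plane) : Plane := ![-p 1, p 0]

/-- The square of the Euclidean norm. -/
def normSq (p : Plane) : ℝ := p 0 ^ 2 + p 1 ^ 2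

theorem normSq_pos {p : Plane} (hp : p ≠ 0) : 0 < normSq p := by
  rw [normSq]
  by_contra hc
  have h0 : p 0 = 0 := pow_eq_zero_iff two_ne_zero |>.1
    (by linarith [sq_nonneg (p 0), sq_nonneg (p 1)])
  have h1 : p 1 = 0 := pow_eq_zero_iff two_ne_zero |>.1
    (by linarith [sq_nonneg (p 0), sq_nonneg (p 1)])
  apply hp
  ext i
  fin_cases i
  · exact h0
  · exact h1

/-- A point on the same side as `p` in terms of its direction. -/
theorem eq_smul_add_smul_perp {p q : Plane} (hp : p ≠ 0) (h : p 0 * q 0 + p 1 * q 1 ≠ 0) :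
    q = ((p 0 * q 0 + p 1 * q 1) / normSq p) •
      (p + (det2 p q / (p 0 * q 0 + p 1 * q 1)) • perp p) := by
  have h0 := (normSq_pos hp).ne'
  obtain ⟨r, hr⟩ : ∃ r, p 0 * q 0 + p 1 * q 1 = r := ⟨_, rfl⟩
  rw [hr] at h ⊢
  ext i
  fin_cases i
  · change q 0 = r / normSq p * (p 0 + det2 p q / r * -p 1)
    field_simp
    rw [← hr, normSq, det2]; ring
  · change q 1 = r / normSq p * (p 1 + det2 p q / r * p 0)
    field_simp
    rw [← hr, normSq, det2]; ring

theorem linePoly_perp_ne_zero {S : Poly} {d : ℕ} (hS : S.IsHomogeneous d) (hS0 : S ≠ 0) {p : Plane}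
    (hp : p ≠ 0) : linePoly p (perp p) S ≠ 0 := by
  intro h0
  apply hS0
  have ho : IsOpen {q : Plane | p 0 * q 0 + p 1 * q 1 ≠ 0} := by
    refine isOpen_ne.preimage (f := fun q : Plane => p 0 * q 0 + p 1 * q 1) ?_
    exact (continuous_const.mul (continuous_apply 0)).add (continuous_const.mul (continuous_apply 1))
  refine mvPolynomial_eq_zero_of_open ho ⟨p, ?_⟩ fun q hq => ?_
  · have := normSq_pos hp
    rw [normSq] at this
    change p 0 * p 0 + p 1 * p 1 ≠ 0
    nlinarith
  · rw [eq_smul_add_smul_perp hp hq, eval_smul_of_isHomogeneous hS, ← eval_linePoly, h0,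
      Polynomial.eval_zero, mul_zero]

/-- A function of the direction which is locally constant off the zero set of a homogeneous
polynomial `S` takes the same value on the two sides of each line of zeros, provided that it is
near each point the quotient of a smooth function by a polynomial. -/
theorem exists_eventually_eq_of_quotient {D : Set Plane} (hD : IsFlowDomain D) {S : Poly} {d : ℕ}
    (hS : S.IsHomogeneous d) (hS0 : S ≠ 0) {K : Plane → ℝ}
    (hK : ∀ q ∈ D, MvPolynomial.eval q S ≠ 0 → HasFDerivAt K (0 : Plane →L[ℝ] ℝ) q)
    (hKs : ∀ q ∈ D, MvPolynomial.eval q S ≠ 0 → ∀ t : ℝ, t ≠ 0 → K (t • q) = K q)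
    {p : Plane} (hp : p ∈ D) (hp0 : p ≠ 0) {g : Plane → ℝ} (hg : ContDiffAt ℝ ∞ g p) {P : Poly}
    (hP : ∀ᶠ q in 𝓝 p, MvPolynomial.eval q S ≠ 0 →
      MvPolynomial.eval q P ≠ 0 ∧ g q = K q * MvPolynomial.eval q P) :
    ∃ k, ∀ᶠ q in 𝓝 p, MvPolynomial.eval q S ≠ 0 → K q = k := by
  -- a curve transversal to the line through `p`, parametrized by the direction
  let c : ℝ → Plane := fun s => p + s • perp p
  have hc0 : c 0 = p := by simp [c]
  have hcd : ∀ s, HasDerivAt c (perp p) s := fun s => by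
    refine (((hasDerivAt_id s).smul_const (perp p)).const_add p).congr_deriv ?_
    rw [one_smul]
  have hc : Filter.Tendsto c (𝓝 0) (𝓝 p) := by
    have := (hcd 0).continuousAt.tendsto
    rwa [hc0] at this
  have hne := eventually_eval_ne_zero (linePoly_perp_ne_zero hS hS0 hp0) 0
  rw [eventually_nhdsWithin_iff] at hne
  obtain ⟨ε, hε, hb⟩ := Metric.eventually_nhds_iff_ball.1
    ((hc.eventually (hD.mem_nhds hp)).and (hne.and (hc.eventually hP)))
  rw [Real.ball_eq_Ioo, zero_sub, zero_add] at hb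
  have hSc : ∀ s ∈ Set.Ioo (-ε) ε, s ≠ 0 → MvPolynomial.eval (c s) S ≠ 0 := fun s hs h0 => by
    have := (hb s hs).2.1 h0
    rwa [eval_linePoly] at this
  have hKd : ∀ s ∈ Set.Ioo (-ε) ε, MvPolynomial.eval (c s) S ≠ 0 →
      HasDerivAt (fun s => K (c s)) 0 s := fun s hs h0 =>
    (HasFDerivAt.comp_hasDerivAt (f := c) s (hK _ (hb s hs).1 h0) (hcd s)).congr_deriv (by simp)
  have hconst : ∀ s : Set ℝ, IsOpen s → IsPreconnected s → s ⊆ Set.Ioo (-ε) ε → (0 : ℝ) ∉ s →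
      ∀ x ∈ s, ∀ y ∈ s, K (c x) = K (c y) := by
    intro s hs hs1 hs2 hs3 x hx y hy
    have hd : ∀ x ∈ s, HasDerivAt (fun s => K (c s)) 0 x := fun x hx =>
      hKd x (hs2 hx) (hSc x (hs2 hx) (by rintro rfl; exact hs3 hx))
    exact hs.is_const_of_deriv_eq_zero (f := fun s => K (c s)) hs1
      (fun x hx => (hd x hx).differentiableAt.differentiableWithinAt)
      (fun x hx => (hd x hx).deriv) hx hy
  have hp1 := hconst (Set.Ioo 0 ε) isOpen_Ioo isPreconnected_Ioo
    (Set.Ioo_subset_Ioo_left (by linarith)) (by simp)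
  have hm1 := hconst (Set.Ioo (-ε) 0) isOpen_Ioo isPreconnected_Ioo
    (Set.Ioo_subset_Ioo_right hε.le) (by simp)
  -- the constants on the two sides agree
  have hk : K (c (ε / 2)) = K (c (-(ε / 2))) := by
    refine eq_of_eventually_eq_mul_polynomial (g := fun s => g (c s)) (P := linePoly p (perp p) P)
      ?_ (fun h0 => ?_) ?_ ?_
    · refine ContDiffAt.comp (0 : ℝ) (by rwa [hc0]) ?_
      exact contDiffAt_const.add (contDiffAt_id.smul contDiffAt_const)
    · have hm : ε / 2 ∈ Set.Ioo (-ε) ε := ⟨by linarith, by linarith⟩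
      refine ((hb _ hm).2.2 (hSc _ hm (by positivity))).1 ?_
      change MvPolynomial.eval (p + (ε / 2) • perp p) P = 0
      rw [← eval_linePoly, h0, Polynomial.eval_zero]
    · filter_upwards [Ioo_mem_nhdsGT hε] with s hs
      have hm : s ∈ Set.Ioo (-ε) ε := ⟨by linarith [hs.1], hs.2⟩
      rw [eval_linePoly, hp1 (ε / 2) ⟨by linarith, by linarith⟩ s hs]
      exact ((hb _ hm).2.2 (hSc _ hm hs.1.ne')).2
    · filter_upwards [Ioo_mem_nhdsLT (neg_lt_zero.2 hε)] with s hs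
      have hm : s ∈ Set.Ioo (-ε) ε := ⟨hs.1, by linarith [hs.2]⟩
      rw [eval_linePoly, hm1 (-(ε / 2)) ⟨by linarith, by linarith⟩ s hs]
      exact ((hb _ hm).2.2 (hSc _ hm hs.2.ne)).2
  have hall : ∀ s ∈ Set.Ioo (-ε) ε, MvPolynomial.eval (c s) S ≠ 0 → K (c s) = K (c (ε / 2)) := by
    intro s hs h0
    rcases lt_trichotomy s 0 with h | rfl | h
    · rw [hk]
      exact hm1 s ⟨hs.1, h⟩ _ ⟨by linarith, by linarith⟩
    · refine tendsto_nhds_unique (l := 𝓝[>] (0 : ℝ))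
        ((hKd 0 hs h0).continuousAt.tendsto.mono_left nhdsWithin_le_nhds)
        (tendsto_const_nhds.congr' ?_)
      filter_upwards [Ioo_mem_nhdsGT hε] with s hs
      exact hp1 (ε / 2) ⟨by linarith, by linarith⟩ s hs
    · exact hp1 s ⟨h, hs.2⟩ _ ⟨by linarith, by linarith⟩
  refine ⟨K (c (ε / 2)), ?_⟩
  have hns := normSq_pos hp0
  have e1 : p 0 * p 0 + p 1 * p 1 = normSq p := by rw [normSq]; ring
  have l1 : ContinuousAt (fun q : Plane => p 0 * q 0 + p 1 * q 1) p :=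
    ((continuous_const.mul (continuous_apply 0)).add
      (continuous_const.mul (continuous_apply 1))).continuousAt
  have l2 : ContinuousAt (fun q : Plane => det2 p q / (p 0 * q 0 + p 1 * q 1)) p := by
    refine ContinuousAt.div ?_ l1 (by rw [e1]; exact hns.ne')
    exact ((continuous_const.mul (continuous_apply 1)).sub
      (continuous_const.mul (continuous_apply 0))).continuousAt
  have e2 : det2 p p / (p 0 * p 0 + p 1 * p 1) = 0 := by
    rw [det2, mul_comm (p 1), sub_self, zero_div]
  filter_upwards [l1.eventually_ne (by rw [e1]; exact hns.ne'), l2.eventually (Ioo_mem_nhds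
    (a := -ε) (b := ε) (by beta_reduce; rw [e2]; linarith) (by beta_reduce; rw [e2]; exact hε))] with q h1 h2 h3
  have e3 := eq_smul_add_smul_perp hp0 h1
  have h4 : MvPolynomial.eval (c (det2 p q / (p 0 * q 0 + p 1 * q 1))) S ≠ 0 := by
    rw [e3, eval_smul_of_isHomogeneous hS] at h3
    exact right_ne_zero_of_mul h3
  rw [e3, ← hall _ h2 h4]
  exact hKs _ (hb _ h2).1 h4 _ (div_ne_zero h1 hns.ne')

/-- A function as in `exists_eventually_eq_of_quotient` is constant on a double sector. -/
theorem exists_eq_of_isDoubleSector {D : Set Plane} (hD : IsFlowDomain D) (hs : IsDoubleSector D)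
    {S : Poly} {d : ℕ} (hS : S.IsHomogeneous d) (hS0 : S ≠ 0) (hz : MvPolynomial.eval 0 S = 0)
    {K : Plane → ℝ}
    (hK : ∀ q ∈ D, MvPolynomial.eval q S ≠ 0 → HasFDerivAt K (0 : Plane →L[ℝ] ℝ) q)
    (hKs : ∀ q ∈ D, MvPolynomial.eval q S ≠ 0 → ∀ t : ℝ, t ≠ 0 → K (t • q) = K q)
    {g : Plane → ℝ} (hg : ∀ p ∈ D, ContDiffAt ℝ ∞ g p) {P : Poly}
    (hP : ∀ q ∈ D, MvPolynomial.eval q S ≠ 0 →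
      MvPolynomial.eval q P ≠ 0 ∧ g q = K q * MvPolynomial.eval q P) :
    ∃ k, ∀ q ∈ D, MvPolynomial.eval q S ≠ 0 → K q = k := by
  -- the connected half of the double sector, or the punctured plane if the cone contains the origin
  obtain ⟨T, hT, hTn, hTD, hTS⟩ : ∃ T : Set Plane, IsPreconnected T ∧ T.Nonempty ∧
      (∀ p ∈ T, p ∈ D ∧ p ≠ 0) ∧ ∀ q ∈ D, q ≠ 0 → q ∈ T ∨ -q ∈ T := by
    obtain ⟨T, hT, hTD⟩ := hs
    by_cases h0 : (0 : Plane) ∈ D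
    · refine ⟨{0}ᶜ, (isConnected_compl_singleton_of_one_lt_rank ?_ 0).isPreconnected,
        ⟨fun _ => 1, fun h => one_ne_zero (congrFun h 0)⟩,
        fun p hp => ⟨hD.mem_of_zero_mem h0 p, hp⟩, fun q _ hq => Or.inl hq⟩
      rw [rank_fin_fun]
      exact Nat.one_lt_ofNat
    · exact ⟨T, hT.isPreconnected, hT.nonempty, fun p hp => ⟨(hTD p).2 (Or.inl hp), by
        rintro rfl; exact h0 ((hTD 0).2 (Or.inl hp))⟩, fun q hq _ => (hTD q).1 hq⟩
  have hloc : ∀ p ∈ T, ∃ k, ∀ᶠ q in 𝓝 p, MvPolynomial.eval q S ≠ 0 → K q = k := fun p hp =>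
    exists_eventually_eq_of_quotient hD hS hS0 hK hKs (hTD p hp).1 (hTD p hp).2 (hg p (hTD p hp).1)
      (by filter_upwards [hD.mem_nhds (hTD p hp).1] with q hq using hP q hq)
  have huniq : ∀ {p : Plane} {k l : ℝ}, (∀ᶠ q in 𝓝 p, MvPolynomial.eval q S ≠ 0 → K q = k) →
      (∀ᶠ q in 𝓝 p, MvPolynomial.eval q S ≠ 0 → K q = l) → k = l := by
    intro p k l h1 h2
    obtain ⟨U, hU, hUo, hpU⟩ := mem_nhds_iff.1 (h1.and h2)
    obtain ⟨q, hq, hqS⟩ := Generic.exists_mem (R := fun q => MvPolynomial.eval q S ≠ 0)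
      ⟨S, hS0, fun _ h => h⟩ hUo ⟨p, hpU⟩
    exact ((hU hq).1 hqS).symm.trans ((hU hq).2 hqS)
  obtain ⟨x, hx⟩ := hTn
  obtain ⟨k, hk⟩ := hloc x hx
  have hT2 : ∀ y ∈ T, ∀ᶠ q in 𝓝 y, MvPolynomial.eval q S ≠ 0 → K q = k := by
    intro y hy
    obtain ⟨l, h1, h2⟩ := hT.induction₂ (fun x y => ∃ l,
      (∀ᶠ q in 𝓝 x, MvPolynomial.eval q S ≠ 0 → K q = l) ∧
      ∀ᶠ q in 𝓝 y, MvPolynomial.eval q S ≠ 0 → K q = l) (fun x hx => by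
        obtain ⟨k, hk⟩ := hloc x hx
        refine nhdsWithin_le_nhds ?_
        filter_upwards [hk.eventually_nhds] with y hy using ⟨k, hk, hy⟩) (fun a b c _ _ _ => by
        rintro ⟨l, h1, h2⟩ ⟨m, h3, h4⟩
        rw [huniq h2 h3] at h1
        exact ⟨m, h1, h4⟩) (fun a b _ _ => by
        rintro ⟨l, h1, h2⟩
        exact ⟨l, h2, h1⟩) hx hy
    rwa [huniq hk h1]
  refine ⟨k, fun q hq hqS => ?_⟩
  have hq0 : q ≠ 0 := by rintro rfl; exact hqS hz
  rcases hTS q hq hq0 with h | h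
  · exact (hT2 q h).self_of_nhds hqS
  · have e : -q = (-1 : ℝ) • q := by simp
    have h1 := (hT2 _ h).self_of_nhds
    rw [e, eval_smul_of_isHomogeneous hS] at h1
    rw [← h1 (mul_ne_zero (pow_ne_zero _ (by norm_num)) hqS)]
    exact (hKs q hq hqS (-1) (by norm_num)).symm

end ProjFlow

namespace ProjFlow

/-! ### The chart belonging to a flow of level one -/

/-- Finitely many homogeneous functions are defined and different from zero off the zero set of a
homogeneous polynomial. -/
theorem exists_isHomogeneous_of_list (L : List RatFun)
    (h : ∀ f ∈ L, f ≠ 0 ∧ ∃ n, IsHomog n f) : ∃ (S : Poly) (d : ℕ), S.IsHomogeneous d ∧ S ≠ 0 ∧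
      ∀ p, MvPolynomial.eval p S ≠ 0 → ∀ f ∈ L, DefinedAt f p ∧ val f p ≠ 0 := by
  induction L with
  | nil => exact ⟨1, 0, MvPolynomial.isHomogeneous_one _ _, one_ne_zero, by simp⟩
  | cons f L ih =>
    obtain ⟨S, d, hS, hS0, hSL⟩ := ih fun g hg => h g (List.mem_cons_of_mem _ hg)
    obtain ⟨hf, n, e, P, Q, hP, hQ, hQ0, rfl⟩ := h f List.mem_cons_self
    have hP0 : P ≠ 0 := by rintro rfl; simp at hf
    refine ⟨P * Q * S, _, (hP.mul hQ).mul hS, mul_ne_zero (mul_ne_zero hP0 hQ0) hS0,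
      fun p hp g hg => ?_⟩
    rw [map_mul, map_mul] at hp
    rcases List.mem_cons.1 hg with rfl | hg
    · have hm : ofPoly P / ofPoly Q * ofPoly Q = ofPoly P := div_mul_cancel₀ _ (ofPoly_ne_zero hQ0)
      have hQ1 := right_ne_zero_of_mul (left_ne_zero_of_mul hp)
      refine ⟨definedAt_of_mul_eq hm hQ1, ?_⟩
      rw [val_eq_of_mul_eq hm hQ1]
      exact div_ne_zero (left_ne_zero_of_mul (left_ne_zero_of_mul hp)) hQ1
    · exact hSL p (right_ne_zero_of_mul hp) g hg

section
variable {D : Set Plane} {S : Poly} {d : ℕ}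

theorem IsFlowDomain.subset_closure_inter (hD : IsFlowDomain D) (hS0 : S ≠ 0) :
    D ⊆ closure (D ∩ {p | MvPolynomial.eval p S ≠ 0}) :=
  Generic.inter (R := fun p => MvPolynomial.eval p S ≠ 0) ⟨S, hS0, fun _ h => h⟩ hD.isOpen

theorem IsFlowDomain.inter_ne (hD : IsFlowDomain D) (hS : S.IsHomogeneous d) (hS0 : S ≠ 0) :
    IsFlowDomain (D ∩ {p | MvPolynomial.eval p S ≠ 0}) := by
  refine ⟨hD.isOpen.inter (isOpen_ne_fun (MvPolynomial.continuous_eval _) continuous_const), ?_,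
    fun p hp t ht => ⟨hD.smul_mem p hp.1 t ht, ?_⟩⟩
  · obtain ⟨p, hp⟩ := hD.nonempty
    exact closure_nonempty_iff.1 ⟨p, hD.subset_closure_inter hS0 hp⟩
  · rw [Set.mem_ofPred_eq, eval_smul_of_isHomogeneous hS]
    exact mul_ne_zero (pow_ne_zero _ ht) hp.2

end

theorem HasRationalField.mono {C D : Set Plane} {φ : Plane → Plane} {ϖ ϱ : RatFun}
    (h : HasRationalField C φ ϖ ϱ) (hDC : D ⊆ C) : HasRationalField D φ ϖ ϱ :=
  fun p hp => h p (hDC hp)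

theorem IsHomog.dval_self {n : ℕ} {f : RatFun} (hf : IsHomog n f) {p : Plane} (hd : DefinedAt f p) :
    dval f p p = n * val f p := by
  have := congrArg (fun g => val g p) hf.euler
  rw [val_add ((definedAt_coord 0 p).mul (definedAt_pd hd 0))
    ((definedAt_coord 1 p).mul (definedAt_pd hd 1)), val_mul (definedAt_coord 0 p)
    (definedAt_pd hd 0), val_mul (definedAt_coord 1 p) (definedAt_pd hd 1), val_coord,
    val_coord, val_mul (definedAt_const _ p) hd, val_const] at this
  rw [linForm_apply, ← this]
  ring

theorem HasRationalField.dval_fld {C : Set Plane} {φ : Plane → Plane} {ϖ ϱ f : RatFun}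
    (h : HasRationalField C φ ϖ ϱ) {p : Plane} (hp : p ∈ C) (hf : DefinedAt f p) :
    dval f p (fld φ p) = val (along ϖ ϱ f) p := by
  rw [val_along (h p hp).1 (h p hp).2.1 hf, h.fld_eq hp, linForm_apply]
  simp
  ring

theorem HasRationalField.det2_fld {C : Set Plane} {φ : Plane → Plane} {ϖ ϱ : RatFun}
    (h : HasRationalField C φ ϖ ϱ) {p : Plane} (hp : p ∈ C) :
    det2 (fld φ p) p = val (angular ϖ ϱ) p := by
  rw [val_angular (h p hp).1 (h p hp).2.1, h.fld_eq hp]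
  simp [det2]; ring

namespace IsLevelOneData
variable {C : Set Plane} {φ : Plane → Plane} {ϖ ϱ a b : RatFun}

theorem along_left (h : IsLevelOneData ϖ ϱ a b) : along ϖ ϱ (-(b / a)) = (-(b / a)) ^ 2 := by
  have ha := h.ne_zero_a
  rw [map_neg, Derivation.leibniz_div, h.along_a, h.along_b]
  simp only [smul_eq_mul]
  field_simp
  ring

/-- The points at which the functions `a`, `b` can serve for the construction of coordinates. -/
def IsRegularOn (ϖ ϱ a b : RatFun) (C : Set Plane) : Prop :=
  ∀ p ∈ C, (DefinedAt a p ∧ val a p ≠ 0) ∧ (DefinedAt b p ∧ val b p ≠ 0) ∧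
    DefinedAt (angular ϖ ϱ) p ∧ val (angular ϖ ϱ) p ≠ 0

/-- The functions `-b / a` and `-b` are coordinates: in the frame formed by the field and the
radial field the differentials are `(V², V)` and `(0, Y)`. -/
theorem isChart (h : IsLevelOneData ϖ ϱ a b) (hC : IsFlowDomain C) (hr : IsRegularOn ϖ ϱ a b C) :
    IsChart C (-(b / a)) (-b) := by
  have hV : IsHomog 1 (-(b / a)) := (IsHomog.div (m := 0) h.homogB h.homogA h.ne_zero_a).neg
  have hY : IsHomog 1 (-b) := h.homogB.neg
  have dV : ∀ p ∈ C, DefinedAt (-(b / a)) p := fun p hp =>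
    ((hr p hp).2.1.1.div (hr p hp).1.1 (hr p hp).1.2).neg
  have dY : ∀ p ∈ C, DefinedAt (-b) p := fun p hp => (hr p hp).2.1.1.neg
  refine ⟨hC, hV, hY, dV, dY, fun p hp => ?_⟩
  have key : jacobian (-(b / a)) (-b) * angular ϖ ϱ = (-(b / a)) ^ 2 * -b := by
    have e1 := h.along_left
    have e2 : along ϖ ϱ (-b) = 0 := by rw [map_neg, h.along_b, neg_zero]
    have e3 := hV.euler
    have e4 := hY.euler
    rw [Nat.cast_one, const_one, one_mul] at e3 e4
    generalize -(b / a) = V at *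
    generalize -b = Y at *
    rw [along_apply] at e1 e2
    rw [jacobian, angular]
    linear_combination Y * e1 + (ϖ * pd 0 V + ϱ * pd 1 V) * e4 - (ϖ * pd 0 Y + ϱ * pd 1 Y) * e3 - V * e2
  obtain ⟨⟨a1, a2⟩, ⟨b1, b2⟩, c1, c2⟩ := hr p hp
  have v0 := definedAt_pd (dV p hp) 0
  have v1 := definedAt_pd (dV p hp) 1
  have y0 := definedAt_pd (dY p hp) 0
  have y1 := definedAt_pd (dY p hp) 1
  have hj : DefinedAt (jacobian (-(b / a)) (-b)) p := (v0.mul y1).sub (v1.mul y0)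
  have hv := congrArg (fun f => val f p) key
  rw [val_mul hj c1, val_mul ((dV p hp).pow 2) (dY p hp), val_pow (dV p hp), val_neg b1,
    val_neg (b1.div a1 a2), val_div b1 a1 a2, jacobian, val_sub (v0.mul y1) (v1.mul y0),
    val_mul v0 y1, val_mul v1 y0] at hv
  intro h0
  rw [h0, zero_mul] at hv
  exact mul_ne_zero (pow_ne_zero 2 (neg_ne_zero.2 (div_ne_zero b2 a2))) (neg_ne_zero.2 b2) hv.symm

theorem isStraight_left (h : IsLevelOneData ϖ ϱ a b) (hφ : IsProjectiveFlow C φ)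
    (hF : HasRationalField C φ ϖ ϱ) (hr : IsRegularOn ϖ ϱ a b C) :
    IsStraight C (-(b / a)) (-b) 1 0 φ := by
  have hch := h.isChart hφ.domain hr
  refine hch.isStraight_of_dval_fld hφ (fun p hp => ?_) fun p hp => ?_
  · rw [hF.dval_fld hp (hch.definedV p hp), h.along_left, val_pow (hch.definedV p hp), one_mul]
  · rw [hF.dval_fld hp (hch.definedY p hp), map_neg, h.along_b, neg_zero, val_zero, zero_mul,
      neg_zero]

/-- A flow whose field has the coefficients `k + l a` and `l b` in the frame formed by the field of
`φ` and the radial field. -/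
theorem isStraight_of_fld_eq (h : IsLevelOneData ϖ ϱ a b) (hC : IsFlowDomain C)
    (hF : HasRationalField C φ ϖ ϱ) (hr : IsRegularOn ϖ ϱ a b C) {η : Plane → Plane}
    (hη : IsProjectiveFlow C η) {k l : ℝ}
    (he : ∀ p ∈ C, fld η p = (k + l * val a p) • fld φ p + (l * val b p) • p) :
    IsStraight C (-(b / a)) (-b) k l η := by
  have hch := h.isChart hC hr
  refine hch.isStraight_of_dval_fld hη (fun p hp => ?_) fun p hp => ?_
  · obtain ⟨⟨a1, a2⟩, ⟨b1, b2⟩, -⟩ := hr p hp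
    rw [he p hp, map_add, map_smul, map_smul, hF.dval_fld hp (hch.definedV p hp), h.along_left,
      hch.homogV.dval_self (hch.definedV p hp), val_pow (hch.definedV p hp),
      val_neg (b1.div a1 a2), val_div b1 a1 a2, smul_eq_mul, smul_eq_mul]
    field_simp
    push_cast
    ring
  · obtain ⟨⟨a1, a2⟩, ⟨b1, b2⟩, -⟩ := hr p hp
    rw [he p hp, map_add, map_smul, map_smul, hF.dval_fld hp (hch.definedY p hp), map_neg,
      h.along_b, hch.homogY.dval_self (hch.definedY p hp), neg_zero, val_zero, val_neg b1,
      smul_eq_mul, smul_eq_mul]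
    push_cast
    ring

end IsLevelOneData

/-! ### The centralizer of a flow of level one -/

theorem hasFDerivAt_zero_of_frame {K : Plane → ℝ} {q v w : Plane} (hK : DifferentiableAt ℝ K q)
    (h : det2 v w ≠ 0) (hv : fderiv ℝ K q v = 0) (hw : fderiv ℝ K q w = 0) :
    HasFDerivAt K (0 : Plane →L[ℝ] ℝ) q := by
  have : fderiv ℝ K q = 0 := by
    apply ContinuousLinearMap.ext
    intro x
    rw [eq_smul_add_smul_of_det2 h x, map_add, map_smul, map_smul, hv, hw]
    simp
  rw [← this]
  exact hK.hasFDerivAt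

theorem coefF_fld_smul (φ η : Plane → Plane) {t : ℝ} (ht : t ≠ 0) (q : Plane) :
    coefF (fld φ) (fld η) (t • q) = coefF (fld φ) (fld η) q := by
  rw [coefF, coefF, fld_smul φ ht, fld_smul η ht]
  have e : ∀ v : Plane, det2 (t ^ 2 • v) (t • q) = t ^ 3 * det2 v q := fun v => by
    simp [det2]; ring
  rw [e, e, mul_div_mul_left _ _ (pow_ne_zero 3 ht)]

theorem coefE_fld_smul (φ η : Plane → Plane) {t : ℝ} (ht : t ≠ 0) (q : Plane) :
    coefE (fld φ) (fld η) (t • q) = t * coefE (fld φ) (fld η) q := by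
  rw [coefE, coefE, fld_smul φ ht, fld_smul η ht]
  have e : ∀ v : Plane, det2 (t ^ 2 • v) (t • q) = t ^ 3 * det2 v q := fun v => by
    simp [det2]; ring
  have e' : ∀ v w : Plane, det2 (t ^ 2 • v) (t ^ 2 • w) = t ^ 3 * (t * det2 v w) := fun v w => by
    simp [det2]; ring
  rw [e, e', mul_div_mul_left _ _ (pow_ne_zero 3 ht), mul_div_assoc]

namespace IsLevelOneData
variable {C : Set Plane} {φ η : Plane → Plane} {ϖ ϱ a b : RatFun}

/-- The coefficients of a commuting field are, up to two constants of integration, those of the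
known fields: both of the functions below have derivative zero. -/
theorem hasFDerivAt_coef (h : IsLevelOneData ϖ ϱ a b) (hφ : IsProjectiveFlow C φ)
    (hη : IsProjectiveFlow C η) (hc : Commutes C φ η) (hF : HasRationalField C φ ϖ ϱ) {p : Plane}
    (hp : p ∈ C) (ha : DefinedAt a p) (hb : DefinedAt b p) (hb0 : val b p ≠ 0)
    (hD : val (angular ϖ ϱ) p ≠ 0) :
    HasFDerivAt (fun q => coefE (fld φ) (fld η) q / val b q) (0 : Plane →L[ℝ] ℝ) p ∧
    HasFDerivAt (fun q => coefF (fld φ) (fld η) q - coefE (fld φ) (fld η) q / val b q * val a q)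
      (0 : Plane →L[ℝ] ℝ) p := by
  have hdet : det2 (fld φ p) p ≠ 0 := by rwa [hF.det2_fld hp]
  have cF := hφ.contDiffAt_fld hp
  have cH := hη.contDiffAt_fld hp
  obtain ⟨k1, k2, k3, k4⟩ := fderiv_coef cF cH hdet (hφ.fderiv_fld_self hp)
    (hη.fderiv_fld_self hp) (fderiv_fld_comm hφ hη hc hp)
  have dF := ((contDiffAt_coefF cF cH hdet).differentiableAt (by simp))
  have dE := ((contDiffAt_coefE cF cH hdet).differentiableAt (by simp))
  have da := hasFDerivAt_val ha
  have db := hasFDerivAt_val hb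
  have ea : dval a p (fld φ p) = val b p := by rw [hF.dval_fld hp ha, h.along_a]
  have ea' : dval a p p = 0 := by rw [h.homogA.dval_self ha]; simp
  have eb : dval b p (fld φ p) = 0 := by rw [hF.dval_fld hp hb, h.along_b, val_zero]
  have eb' : dval b p p = val b p := by rw [h.homogB.dval_self hb]; simp
  have dK := (((contDiffAt_coefE cF cH hdet).div (contDiffAt_val hb) hb0).differentiableAt
    (by simp)).hasFDerivAt
  have e1 : coefE (fld φ) (fld η) =ᶠ[𝓝 p]
      fun q => coefE (fld φ) (fld η) q / val b q * val b q := by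
    filter_upwards [db.continuousAt.eventually_ne hb0] with q hq using (div_mul_cancel₀ _ hq).symm
  have e2 := ((dK.mul db).congr_of_eventuallyEq e1).fderiv
  have hK : HasFDerivAt (fun q => coefE (fld φ) (fld η) q / val b q) (0 : Plane →L[ℝ] ℝ) p := by
    refine hasFDerivAt_zero_of_frame dK.differentiableAt hdet ?_ ?_
    · have := congrArg (fun L => L (fld φ p)) e2
      simp only [add_apply, smul_apply, smul_eq_mul] at this
      rw [k2, eb, mul_zero, zero_add] at this
      exact (mul_eq_zero.1 this.symm).resolve_left hb0
    · have := congrArg (fun L => L p) e2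
      simp only [add_apply, smul_apply, smul_eq_mul] at this
      rw [k4, eb'] at this
      simp only [Pi.div_apply] at this
      rw [div_mul_cancel₀ _ hb0, left_eq_add] at this
      exact (mul_eq_zero.1 this).resolve_left hb0
  refine ⟨hK, ?_⟩
  have hL := dF.hasFDerivAt.sub (hK.mul da)
  refine hasFDerivAt_zero_of_frame hL.differentiableAt hdet ?_ ?_
  · refine (congrArg (fun L : Plane →L[ℝ] ℝ => L (fld φ p)) hL.fderiv).trans ?_
    simp only [sub_apply, add_apply, smul_apply, smul_eq_mul]
    rw [k1, ea, div_mul_cancel₀ _ hb0]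
    simp
  · refine (congrArg (fun L : Plane →L[ℝ] ℝ => L p) hL.fderiv).trans ?_
    simp only [sub_apply, add_apply, smul_apply, smul_eq_mul]
    rw [k3, ea']
    simp

end IsLevelOneData

end ProjFlow

namespace ProjFlow

namespace IsLevelOneData
variable {D : Set Plane} {φ η : Plane → Plane} {ϖ ϱ a b : RatFun}

/-- A commuting flow with a rational field has the coefficients `k + l a` and `l b` in the frame
formed by the known field and the radial field. -/
theorem exists_coef_of_hasRationalField (h : IsLevelOneData ϖ ϱ a b) (hφ : IsProjectiveFlow D φ)
    (hη : IsProjectiveFlow D η) (hc : Commutes D φ η) (hF : HasRationalField D φ ϖ ϱ)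
    {γ δ : RatFun} (hG : HasRationalField D η γ δ) : ∃ k l : ℝ, ∀ p ∈ D, DefinedAt a p →
      DefinedAt b p → fld η p = (k + l * val a p) • fld φ p + (l * val b p) • p := by
  obtain ⟨a', b', ha', hb', hab, hbb, rfl, rfl⟩ :=
    exists_coef_of_commutes hφ hη hF hG hc h.angular_ne
  have hconst : ∀ c : ℝ, along ϖ ϱ (const c) = 0 := fun c => by
    rw [along_apply, pd_const, pd_const, mul_zero, mul_zero, add_zero]
  obtain ⟨l, hl⟩ := exists_eq_const_of_along (a := b' / b) h.angular_ne
    (IsHomog.div (m := 1) hb' h.homogB h.ne_zero) (by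
      rw [Derivation.leibniz_div, hbb, h.along_b]; simp)
  rw [div_eq_iff h.ne_zero] at hl
  obtain ⟨k, hk⟩ := exists_eq_const_of_along (a := a' + -(const l * a)) h.angular_ne
    (ha'.add (((isHomog_const l).mul (n := 0) h.homogA).neg)) (by
      rw [map_add, map_neg, Derivation.leibniz, hconst, hab, h.along_a, hl]; simp)
  rw [add_neg_eq_iff_eq_add] at hk
  refine ⟨k, l, fun p hp ha hb => ?_⟩
  obtain ⟨f0, f1, -⟩ := hF p hp
  have c := definedAt_const l p
  have dA : DefinedAt (const k + const l * a) p := (definedAt_const k p).add (c.mul ha)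
  have vA : val (const k + const l * a) p = k + l * val a p := by
    rw [val_add (definedAt_const k p) (c.mul ha), val_mul c ha, val_const, val_const]
  have vB : val (const l * b) p = l * val b p := by rw [val_mul c hb, val_const]
  have key : ∀ (i : Fin 2) {f : RatFun}, DefinedAt f p → val (a' * f + b' * coord i) p =
      (k + l * val a p) * val f p + l * val b p * p i := fun i f hf => by
    rw [hk, hl, val_add (dA.mul hf) ((c.mul hb).mul (definedAt_coord i p)), val_mul dA hf,
      val_mul (c.mul hb) (definedAt_coord i p), vA, vB, val_coord]
  rw [hG.fld_eq hp, hF.fld_eq hp, key 0 f0, key 1 f1]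
  ext i
  fin_cases i <;> simp

/-- The same for a smooth commuting flow on a double sector: the two constants of integration
cannot change at the singular lines of the coordinates. -/
theorem exists_coef_of_isDoubleSector (h : IsLevelOneData ϖ ϱ a b) (hφ : IsProjectiveFlow D φ)
    (hη : IsProjectiveFlow D η) (hc : Commutes D φ η) (hF : HasRationalField D φ ϖ ϱ)
    (hD : IsDoubleSector D) {S : Poly} {d : ℕ} (hS : S.IsHomogeneous d) (hS0 : S ≠ 0)
    (hz : MvPolynomial.eval 0 S = 0)
    (hr : ∀ p, MvPolynomial.eval p S ≠ 0 → DefinedAt a p ∧ (DefinedAt b p ∧ val b p ≠ 0) ∧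
      DefinedAt (angular ϖ ϱ) p ∧ val (angular ϖ ϱ) p ≠ 0) :
    ∃ k l : ℝ, ∀ p ∈ D, MvPolynomial.eval p S ≠ 0 →
      fld η p = (k + l * val a p) • fld φ p + (l * val b p) • p := by
  have hder := fun p (hp : p ∈ D) (hpS : MvPolynomial.eval p S ≠ 0) =>
    h.hasFDerivAt_coef hφ hη hc hF hp (hr p hpS).1 (hr p hpS).2.1.1 (hr p hpS).2.1.2
      (hr p hpS).2.2.2
  -- the functions are those of `hasFDerivAt_coef`; the numerators and denominators of `a`, `b` and of
  -- `y ϖ - x ϱ` clear the singularities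
  have cpoly : ∀ (P : Poly) (p : Plane), ContDiffAt ℝ ∞ (fun q : Plane => MvPolynomial.eval q P) p :=
    fun P p => (contDiff_eval P).contDiffAt
  obtain ⟨l, hl⟩ := exists_eq_of_isDoubleSector hφ.domain hD hS hS0 hz
    (K := fun q => coefE (fld φ) (fld η) q / val b q) (fun p hp hpS => (hder p hp hpS).1)
    (fun p _ hpS t ht => by
      rw [coefE_fld_smul φ η ht, h.homogB.val_smul (hr p hpS).2.1.1 ht, pow_one,
        mul_div_mul_left _ _ ht])
    (g := fun q => det2 (fld φ q) (fld η q) *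
      MvPolynomial.eval q (denom b * denom (angular ϖ ϱ)))
    (fun p hp => (contDiffAt_det2 (hφ.contDiffAt_fld hp) (hη.contDiffAt_fld hp)).mul (cpoly _ p))
    (P := numer b * numer (angular ϖ ϱ)) (fun p hp hpS => by
      obtain ⟨-, ⟨b1, b2⟩, c1, c2⟩ := hr p hpS
      have hb := numer_eval_ne_zero b1 b2
      have hc := numer_eval_ne_zero c1 c2
      rw [map_mul]
      refine ⟨mul_ne_zero hb hc, ?_⟩
      rw [map_mul, coefE, hF.det2_fld hp, ← val_mul_denom b1, ← val_mul_denom c1]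
      field_simp)
  obtain ⟨k, hk⟩ := exists_eq_of_isDoubleSector hφ.domain hD hS hS0 hz
    (K := fun q => coefF (fld φ) (fld η) q - coefE (fld φ) (fld η) q / val b q * val a q)
    (fun p hp hpS => (hder p hp hpS).2)
    (fun p _ hpS t ht => by
      rw [coefF_fld_smul φ η ht, coefE_fld_smul φ η ht, h.homogB.val_smul (hr p hpS).2.1.1 ht,
        h.homogA.val_smul (hr p hpS).1 ht, pow_one, pow_zero, one_mul, mul_div_mul_left _ _ ht])
    (g := fun q => det2 (fld η q) q * MvPolynomial.eval q (denom a * denom (angular ϖ ϱ)) -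
      l * MvPolynomial.eval q (numer a * numer (angular ϖ ϱ)))
    (fun p hp => ((contDiffAt_det2 (hη.contDiffAt_fld hp) contDiffAt_id).mul (cpoly _ p)).sub
      (contDiffAt_const.mul (cpoly _ p)))
    (P := denom a * numer (angular ϖ ϱ)) (fun p hp hpS => by
      obtain ⟨a1, -, c1, c2⟩ := hr p hpS
      have hc := numer_eval_ne_zero c1 c2
      have := hl p hp hpS
      rw [map_mul]
      refine ⟨mul_ne_zero a1 hc, ?_⟩
      rw [this, map_mul, map_mul, coefF, hF.det2_fld hp, ← val_mul_denom a1, ← val_mul_denom c1]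
      field_simp)
  refine ⟨k, l, fun p hp hpS => ?_⟩
  obtain ⟨a1, ⟨b1, b2⟩, c1, c2⟩ := hr p hpS
  have e1 := hl p hp hpS
  have e2 := hk p hp hpS
  rw [e1, sub_eq_iff_eq_add] at e2
  rw [div_eq_iff b2] at e1
  rw [← e1, ← e2]
  exact eq_coefF_add_coefE (by rwa [hF.det2_fld hp])

end IsLevelOneData

/-- The description of all flows which commute with a given flow of level one. -/
theorem exists_centralizer {C : Set Plane} {φ : Plane → Plane}
    (hφ : IsAlgebraicFlowOfLevelOne C φ) : ∃ (C' : Set Plane) (ψ : Plane → Plane),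
      C' ⊆ C ∧ C ⊆ closure C' ∧ IsAlgebraicFlowOfLevelOne C' ψ ∧
      (∀ c : ℝ, ¬ GermEq C' ψ (flowPow φ c)) ∧
      (∀ z w : ℝ, IsProjectiveFlow C' (flowPow φ z ∘ flowPow ψ w) ∧
        Commutes C' φ (flowPow φ z ∘ flowPow ψ w)) ∧
      ∀ (D : Set Plane) (η : Plane → Plane), D ⊆ C → IsProjectiveFlow D η →
        (IsDoubleSector D ∨ ∃ γ δ : RatFun, HasRationalField D η γ δ) → Commutes D φ η →
        ∃ z w : ℝ, GermEq (D ∩ C') η (flowPow φ z ∘ flowPow ψ w) := by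
  obtain ⟨hφ, ⟨ϖ, ϱ, hF, hD, b, hb⟩, h0, h1⟩ := hφ
  obtain ⟨a, h⟩ := exists_isLevelOneData hφ hF hD hb h0 h1
  obtain ⟨hϖ, hϱ⟩ := hF.isHomog hφ.domain
  obtain ⟨S, d, hS, hS0, hSr⟩ := exists_isHomogeneous_of_list [a, b, angular ϖ ϱ, coord 1] (by
    simp only [List.mem_cons, List.not_mem_nil, or_false]
    rintro f (rfl | rfl | rfl | rfl)
    · exact ⟨h.ne_zero_a, 0, h.homogA⟩
    · exact ⟨h.ne_zero, 1, h.homogB⟩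
    · exact ⟨hD, 3, isHomog_angular hϖ hϱ⟩
    · exact ⟨coord_ne_zero 1, 1, isHomog_coord 1⟩)
  simp only [List.mem_cons, List.not_mem_nil, or_false, forall_eq_or_imp, forall_eq] at hSr
  have hz : MvPolynomial.eval 0 S = 0 := by
    by_contra h0
    exact (hSr 0 h0).2.2.2.2 (by simp)
  -- off the singular lines the functions `-b / a` and `-b` form a chart
  let N : Set Plane := {p | MvPolynomial.eval p S ≠ 0}
  have hreg : ∀ D : Set Plane, IsLevelOneData.IsRegularOn ϖ ϱ a b (D ∩ N) := fun D p hp =>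
    ⟨(hSr p hp.2).1, (hSr p hp.2).2.1, (hSr p hp.2).2.2.1⟩
  have hsub : ∀ D : Set Plane, D ∩ N ⊆ D := fun D => Set.inter_subset_left
  have hC' : IsFlowDomain (C ∩ N) := hφ.domain.inter_ne hS hS0
  have hch := h.isChart hC' (hreg C)
  have sφ := h.isStraight_left (hφ.mono hC' (hsub C)) (hF.mono (hsub C)) (hreg C)
  have sψ := hch.isStraight_liftFlow 0 1
  have scomp : ∀ z w : ℝ, IsStraight (C ∩ N) (-(b / a)) (-b) z w
      (flowPow φ z ∘ flowPow (liftFlow (C ∩ N) (-(b / a)) (-b) 0 1) w) := fun z w => by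
    have := (sφ.flowPow z).comp (sψ.flowPow w)
    simpa using this
  refine ⟨C ∩ N, liftFlow (C ∩ N) (-(b / a)) (-b) 0 1, hsub C,
    hφ.domain.subset_closure_inter hS0, hch.isAlgebraicFlowOfLevelOne_right sψ, fun c hc => ?_,
    fun z w => ⟨hch.isProjectiveFlow (scomp z w), hch.commutes sφ (scomp z w)⟩,
    fun D η hDC hη hcase hcomm => ?_⟩
  -- the flow `ψ` moves the second coordinate, while the powers of `φ` do not
  · obtain ⟨p, hp⟩ := hC'.nonempty
    have e1 := (hch.dval_fld sψ hp).2
    have e2 := (hch.dval_fld (sφ.flowPow c) hp).2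
    rw [← fld_eq_of_germEq hc hp, e1, mul_zero, zero_mul, neg_zero, one_mul, neg_eq_zero,
      val_neg (hreg C p hp).2.1.1] at e2
    exact pow_ne_zero 2 (neg_ne_zero.2 (hreg C p hp).2.1.2) e2
  · have hφD := hφ.mono hη.domain hDC
    have hFD := hF.mono hDC
    have hDN : IsFlowDomain (D ∩ N) := hη.domain.inter_ne hS hS0
    obtain ⟨k, l, hkl⟩ : ∃ k l : ℝ, ∀ p ∈ D ∩ N,
        fld η p = (k + l * val a p) • fld φ p + (l * val b p) • p := by
      rcases hcase with hcase | ⟨γ, δ, hG⟩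
      · obtain ⟨k, l, hkl⟩ := h.exists_coef_of_isDoubleSector hφD hη hcomm hFD hcase hS hS0 hz
          fun p hp => ⟨(hSr p hp).1.1, (hSr p hp).2.1, (hSr p hp).2.2.1⟩
        exact ⟨k, l, fun p hp => hkl p hp.1 hp.2⟩
      · obtain ⟨k, l, hkl⟩ := h.exists_coef_of_hasRationalField hφD hη hcomm hFD hG
        exact ⟨k, l, fun p hp => hkl p hp.1 (hSr p hp.2).1.1 (hSr p hp.2).2.1.1⟩
    have sη := h.isStraight_of_fld_eq hDN (hFD.mono (hsub D)) (hreg D) (hη.mono hDN (hsub D)) hkl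
    have hset : D ∩ (C ∩ N) = D ∩ N := by
      rw [← Set.inter_assoc, Set.inter_eq_left.2 hDC]
    refine ⟨k, l, ?_⟩
    rw [hset]
    exact (h.isChart hDN (hreg D)).germEq sη
      ((scomp k l).mono (Set.inter_subset_inter_left N hDC))

end ProjFlow

namespace ProjFlow

/-! ### Conjugation by a birational map which preserves the lines through the origin -/

section
variable {c : RatFun}

theorem mvAeval_radial_of_isHomogeneous (c : RatFun) {P : Poly} {n : ℕ} (hP : P.IsHomogeneous n) :
    MvPolynomial.aeval (fun i => c * coord i) P = c ^ n * ofPoly P := by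
  refine ratFun_eq_of_val (isOpen_definedAt c) (generic_definedAt c).dense.nonempty
    fun p hp _ _ => ?_
  have h := (definedAt_mvAeval (f := fun i => c * coord i)
    (fun i => hp.mul (definedAt_coord i p)) P).2
  rw [h, val_mul (hp.pow n) (definedAt_ofPoly P p), val_pow hp, val_ofPoly,
    ← eval_smul_of_isHomogeneous hP]
  congr 2
  funext i
  rw [val_mul hp (definedAt_coord i p), val_coord]
  rfl

/-- A polynomial which vanishes under the substitution `𝐱 ↦ c 𝐱` vanishes at a generic point `q`, since
`q` is the image of `c(q)⁻¹ q`. -/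
theorem injective_mvAeval_radial (hc : IsHomog 0 c) (hc0 : c ≠ 0) :
    Function.Injective (MvPolynomial.aeval (R := ℝ) fun i => c * coord i) := by
  rw [injective_iff_map_eq_zero]
  intro P hP
  obtain ⟨S, hS, hS2⟩ := generic_val_ne_zero hc0
  have key : ∀ q, MvPolynomial.eval q S ≠ 0 → MvPolynomial.eval q P = 0 := by
    intro q hq
    obtain ⟨h1, h2⟩ := hS2 q hq
    have h3 := hc.definedAt_smul h1 (inv_ne_zero h2)
    have h4 := hc.val_smul h1 (inv_ne_zero h2)
    rw [pow_zero, one_mul] at h4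
    have h5 := (definedAt_mvAeval (f := fun i => c * coord i)
      (fun i => h3.mul (definedAt_coord i ((val c q)⁻¹ • q))) P).2
    rw [hP, val_zero] at h5
    rw [h5]
    congr 2
    funext i
    rw [val_mul h3 (definedAt_coord i _), h4, val_coord, Pi.smul_apply, smul_eq_mul,
      mul_inv_cancel_left₀ h2]
  have hz : P * S = 0 := MvPolynomial.funext fun q => by
    rw [map_mul, map_zero]
    by_cases hq : MvPolynomial.eval q S = 0
    · rw [hq, mul_zero]
    · rw [key q hq, zero_mul]
  exact (mul_eq_zero.1 hz).resolve_right hS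

/-- The substitution `x ↦ c x`, `y ↦ c y`. -/
noncomputable def radialHom (hc : IsHomog 0 c) (hc0 : c ≠ 0) : RatFun →ₐ[ℝ] RatFun :=
  IsFractionRing.liftAlgHom (injective_mvAeval_radial hc hc0)

theorem radialHom_ofPoly (hc : IsHomog 0 c) (hc0 : c ≠ 0) (P : Poly) :
    radialHom hc hc0 (ofPoly P) = MvPolynomial.aeval (fun i => c * coord i) P :=
  IsFractionRing.lift_algebraMap (injective_mvAeval_radial hc hc0) P

theorem radialHom_coord (hc : IsHomog 0 c) (hc0 : c ≠ 0) (i : Fin 2) :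
    radialHom hc hc0 (coord i) = c * coord i := by
  rw [show coord i = ofPoly (MvPolynomial.X i) from rfl, radialHom_ofPoly, MvPolynomial.aeval_X]
  rfl

theorem radialHom_of_isHomog (hc : IsHomog 0 c) (hc0 : c ≠ 0) {n : ℕ} {f : RatFun}
    (hf : IsHomog n f) : radialHom hc hc0 f = c ^ n * f := by
  obtain ⟨d, P, Q, hP, hQ, hQ0, rfl⟩ := hf
  change radialHom hc hc0 (ofPoly P / ofPoly Q) = c ^ n * (ofPoly P / ofPoly Q)
  have := ofPoly_ne_zero hQ0
  rw [map_div₀, radialHom_ofPoly, radialHom_ofPoly, mvAeval_radial_of_isHomogeneous c hP,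
    mvAeval_radial_of_isHomogeneous c hQ, pow_add]
  field_simp

theorem algHom_ext_coord {f g : RatFun →ₐ[ℝ] RatFun} (h : ∀ i, f (coord i) = g (coord i)) :
    f = g := by
  refine IsLocalization.algHom_ext (nonZeroDivisors Poly) ?_
  refine MvPolynomial.algHom_ext fun i => ?_
  exact h i

theorem IsHomog.inv_zero (hc : IsHomog 0 c) (hc0 : c ≠ 0) : IsHomog 0 c⁻¹ := by
  rw [← one_div, ← const_one]
  exact IsHomog.div (m := 0) (isHomog_const 1) hc hc0

theorem radialHom_comp (hc : IsHomog 0 c) (hc0 : c ≠ 0) (hd : IsHomog 0 c⁻¹) (hd0 : c⁻¹ ≠ 0) :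
    (radialHom hc hc0).comp (radialHom hd hd0) = AlgHom.id ℝ RatFun := by
  refine algHom_ext_coord fun i => ?_
  rw [AlgHom.comp_apply, radialHom_coord, map_mul, radialHom_coord, radialHom_of_isHomog hc hc0 hd,
    pow_zero, one_mul, inv_mul_cancel_left₀ hc0, AlgHom.id_apply]

theorem radialHom_comp' (hc : IsHomog 0 c) (hc0 : c ≠ 0) (hd : IsHomog 0 c⁻¹) (hd0 : c⁻¹ ≠ 0) :
    (radialHom hd hd0).comp (radialHom hc hc0) = AlgHom.id ℝ RatFun := by
  refine algHom_ext_coord fun i => ?_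
  rw [AlgHom.comp_apply, radialHom_coord, map_mul, radialHom_coord, radialHom_of_isHomog hd hd0 hc,
    pow_zero, one_mul, mul_inv_cancel_left₀ hc0, AlgHom.id_apply]

/-- For a nonzero homogeneous function `c` of degree zero there is a birational map `𝐱 ↦ c(𝐱) 𝐱`. -/
theorem exists_radial (hc : IsHomog 0 c) (hc0 : c ≠ 0) : ∃ σ : RatFun ≃ₐ[ℝ] RatFun,
    (∀ i, σ (coord i) = c * coord i) ∧ ∀ i, σ.symm (coord i) = c⁻¹ * coord i :=
  ⟨AlgEquiv.ofAlgHom (radialHom hc hc0) (radialHom (hc.inv_zero hc0) (inv_ne_zero hc0))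
    (radialHom_comp _ _ _ _) (radialHom_comp' _ _ _ _),
    fun i => radialHom_coord hc hc0 i, fun i => radialHom_coord (hc.inv_zero hc0) (inv_ne_zero hc0) i⟩

theorem birMap_radial {σ : RatFun ≃ₐ[ℝ] RatFun} (h : ∀ i, σ (coord i) = c * coord i) {p : Plane}
    (hc : DefinedAt c p) : BirDefinedAt σ p ∧ birMap σ p = val c p • p := by
  refine ⟨fun i => by rw [h]; exact hc.mul (definedAt_coord i p), funext fun i => ?_⟩
  rw [birMap, h, val_mul hc (definedAt_coord i p), val_coord]
  rfl

/-- Conjugation by the map `𝐱 ↦ c(𝐱) 𝐱` transforms the coordinates `V`, `Y` into `c V`, `c Y`. -/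
theorem IsStraight.conj_radial {D : Set Plane} {V Y : RatFun} {z w : ℝ} {φ : Plane → Plane}
    (hφ : IsStraight D V Y z w φ) (hD : IsFlowDomain D) (hc : IsHomog 0 c)
    (hcD : ∀ p ∈ D, DefinedAt c p ∧ val c p ≠ 0) (hV : IsHomog 1 V) (hY : IsHomog 1 Y)
    (hVD : ∀ p ∈ D, DefinedAt V p) (hYD : ∀ p ∈ D, DefinedAt Y p) {σ : RatFun ≃ₐ[ℝ] RatFun}
    (hσ : ∀ i, σ (coord i) = c * coord i) (hσ' : ∀ i, σ.symm (coord i) = c⁻¹ * coord i) :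
    IsStraight D (c * V) (c * Y) z w (conj σ φ) := by
  have hl : ∀ p ∈ D, birMap σ p = val c p • p := fun p hp => (birMap_radial hσ (hcD p hp).1).2
  have hl' : ∀ p ∈ D, birMap σ.symm p = (val c p)⁻¹ • p := fun p hp => by
    rw [(birMap_radial hσ' ((hcD p hp).1.inv (hcD p hp).2)).2, val_inv (hcD p hp).1 (hcD p hp).2]
  have hlD : ∀ p ∈ D, val c p • p ∈ D := fun p hp => hD.smul_mem p hp _ (hcD p hp).2
  have hcs : ∀ p ∈ D, ∀ t : ℝ, t ≠ 0 → val c (t • p) = val c p := fun p hp t ht => by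
    rw [hc.val_smul (hcD p hp).1 ht, pow_zero, one_mul]
  have hcont : ∀ p ∈ D, ContinuousAt (fun q => val c q • q) p := fun p hp =>
    (contDiffAt_val (hcD p hp).1 (n := 0)).continuousAt.smul continuousAt_id
  have hcont' : ∀ p ∈ D, ContinuousAt (fun q => (val c q)⁻¹ • q) p := fun p hp =>
    ((contDiffAt_val (hcD p hp).1 (n := 0)).continuousAt.inv₀ (hcD p hp).2).smul continuousAt_id
  -- the trajectories of the conjugate flow
  have hpow : ∀ x : ℝ × Plane, x.2 ∈ D →
      ProjFlow.flowPow φ x.1 (val c x.2 • x.2) ∈ D →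
      ProjFlow.flowPow (ProjFlow.conj σ φ) x.1 x.2 =
        (val c (ProjFlow.flowPow φ x.1 (val c x.2 • x.2)))⁻¹ •
          ProjFlow.flowPow φ x.1 (val c x.2 • x.2) := by
    rintro ⟨t, p⟩ hp hr
    dsimp only at hp hr ⊢
    rcases eq_or_ne t 0 with rfl | ht
    · rw [flowPow_zero, flowPow_zero, hcs p hp _ (hcD p hp).2, inv_smul_smul₀ (hcD p hp).2]
    · have e1 : φ (val c p • t • p) = t • ProjFlow.flowPow φ t (val c p • p) := by
        rw [smul_flowPow φ ht, smul_comm]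
      rw [flowPow_of_ne _ ht, ProjFlow.conj, Function.comp_apply, Function.comp_apply,
        hl _ (hD.smul_mem p hp t ht), hcs p hp t ht, e1, hl' _ (hD.smul_mem _ hr t ht),
        hcs _ hr t ht, smul_comm _ t, inv_smul_smul₀ ht]
  have htend : ∀ p ∈ D, Filter.Tendsto (fun x : ℝ × Plane => ProjFlow.flowPow φ x.1 (val c x.2 • x.2))
      (𝓝 ((0 : ℝ), p)) (𝓝 (val c p • p)) := fun p hp =>
    (hφ.tendsto _ (hlD p hp)).comp (Filter.Tendsto.prodMk_nhds (continuous_fst.tendsto ((0 : ℝ), p))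
      ((hcont p hp).tendsto.comp (continuous_snd.tendsto ((0 : ℝ), p))))
  have hmem : ∀ p ∈ D, ∀ᶠ x : ℝ × Plane in 𝓝 ((0 : ℝ), p),
      x.2 ∈ D ∧ ProjFlow.flowPow φ x.1 (val c x.2 • x.2) ∈ D := fun p hp =>
    ((continuous_snd.tendsto ((0 : ℝ), p)).eventually (hD.mem_nhds hp)).and
      ((htend p hp).eventually (hD.mem_nhds (hlD p hp)))
  have harg : ∀ p ∈ D, Filter.Tendsto (fun x : ℝ × Plane => (x.1, val c x.2 • x.2))
      (𝓝 ((0 : ℝ), p)) (𝓝 ((0 : ℝ), val c p • p)) := fun p hp =>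
    Filter.Tendsto.prodMk_nhds (continuous_fst.tendsto ((0 : ℝ), p))
      ((hcont p hp).tendsto.comp (continuous_snd.tendsto ((0 : ℝ), p)))
  -- the transformation of the coordinates
  have hval : ∀ {f : RatFun}, IsHomog 1 f → (∀ p ∈ D, DefinedAt f p) → ∀ p ∈ D,
      val (c * f) p = val f (val c p • p) ∧ val (c * f) ((val c p)⁻¹ • p) = val f p := by
    intro f hf hfD p hp
    have h0 := (hcD p hp).2
    have hi := hD.smul_mem p hp _ (inv_ne_zero h0)
    rw [val_mul (hcD p hp).1 (hfD p hp), hf.val_smul (hfD p hp) h0, val_mul (hcD _ hi).1 (hfD _ hi),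
      hcs p hp _ (inv_ne_zero h0), hf.val_smul (hfD p hp) (inv_ne_zero h0), pow_one, pow_one,
      mul_inv_cancel_left₀ h0]
    exact ⟨rfl, rfl⟩
  refine ⟨fun p hp => ?_, fun p hp => ?_, fun p hp => ?_⟩
  · have h1 := (hcont' _ (hlD p hp)).tendsto.comp (htend p hp)
    rw [hcs p hp _ (hcD p hp).2, inv_smul_smul₀ (hcD p hp).2] at h1
    refine h1.congr' ?_
    filter_upwards [hmem p hp] with x hx using (hpow x hx.1 hx.2).symm
  · filter_upwards [hmem p hp, (harg p hp).eventually (hφ.eqV _ (hlD p hp))] with x hx h1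
    rw [hpow x hx.1 hx.2, (hval hV hVD _ hx.1).1, (hval hV hVD _ hx.2).2]
    exact h1
  · filter_upwards [hmem p hp, (harg p hp).eventually (hφ.eqY _ (hlD p hp))] with x hx h1
    rw [hpow x hx.1 hx.2, (hval hY hYD _ hx.1).1, (hval hY hYD _ hx.2).2]
    exact h1

end

/-- For the chart `V = -b / a`, `Y = -b` of a commuting pair, the map `𝐱 ↦ c(𝐱) 𝐱` with
`c = -b / y` transforms `y` into `Y` and `y / a` into `V`. -/
theorem exists_conj_of_commutes {C : Set Plane} {φ ψ : Plane → Plane}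
    (hφ : IsAlgebraicFlowOfLevelOne C φ) (hψ : IsAlgebraicFlowOfLevelOne C ψ)
    (hc : Commutes C φ ψ) (hne : ∀ c : ℝ, ¬ GermEq C ψ (flowPow φ c)) :
    ∃ (V : RatFun) (a u : Plane → ℝ) (σ : RatFun ≃ₐ[ℝ] RatFun) (D : Set Plane),
      IsHomog 1 V ∧ (∀ c : ℝ, V ≠ const c * coord 1) ∧
      IsSolutionA V (regularCone V) a ∧ IsSolutionU V (regularCone V) u ∧ IsOneBir σ ∧
      IsFlowDomain D ∧ D ⊆ C ∧ C ⊆ closure D ∧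
      (∀ p ∈ D, BirDefinedAt σ p ∧ BirDefinedAt σ.symm (birMap σ p) ∧
        birMap σ p ∈ regularCone V) ∧
      GermEq D φ (conj σ (flowOfU u)) ∧ GermEq D ψ (conj σ (flowOfA a)) := by
  obtain ⟨hφ, ⟨ϖ, ϱ, hF, hD, -⟩, -⟩ := hφ
  obtain ⟨hψ, ⟨α, β, hG, -⟩, -⟩ := hψ
  obtain ⟨a, b, h, rfl, rfl⟩ := exists_levelOneData_of_commutes hφ hψ hF hG hc hD hne
  obtain ⟨hϖ, hϱ⟩ := hF.isHomog hφ.domain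
  have ha0 := h.ne_zero_a
  have hb0 := h.ne_zero
  have hy := coord_ne_zero 1
  obtain ⟨S, d, hS, hS0, hSr⟩ := exists_isHomogeneous_of_list [a, b, angular ϖ ϱ, coord 1] (by
    simp only [List.mem_cons, List.not_mem_nil, or_false]
    rintro f (rfl | rfl | rfl | rfl)
    · exact ⟨ha0, 0, h.homogA⟩
    · exact ⟨hb0, 1, h.homogB⟩
    · exact ⟨hD, 3, isHomog_angular hϖ hϱ⟩
    · exact ⟨hy, 1, isHomog_coord 1⟩)
  simp only [List.mem_cons, List.not_mem_nil, or_false, forall_eq_or_imp, forall_eq] at hSr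
  let N : Set Plane := {p | MvPolynomial.eval p S ≠ 0}
  have hdom : IsFlowDomain (C ∩ N) := hφ.domain.inter_ne hS hS0
  have hsub : C ∩ N ⊆ C := Set.inter_subset_left
  have hreg : IsLevelOneData.IsRegularOn ϖ ϱ a b (C ∩ N) := fun p hp =>
    ⟨(hSr p hp.2).1, (hSr p hp.2).2.1, (hSr p hp.2).2.2.1⟩
  have hch := h.isChart hdom hreg
  have sφ := h.isStraight_left (hφ.mono hdom hsub) (hF.mono hsub) hreg
  have sψ := h.isStraight_of_fld_eq hdom (hF.mono hsub) hreg (hψ.mono hdom hsub) (k := 0) (l := 1)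
    fun p hp => by
      obtain ⟨⟨a1, -⟩, ⟨b1, -⟩, -⟩ := hreg p hp
      obtain ⟨f0, f1, -⟩ := hF p hp.1
      rw [hG.fld_eq hp.1, hF.fld_eq hp.1, val_add (a1.mul f0) (b1.mul (definedAt_coord 0 p)),
        val_add (a1.mul f1) (b1.mul (definedAt_coord 1 p)), val_mul a1 f0, val_mul a1 f1,
        val_mul b1 (definedAt_coord 0 p), val_mul b1 (definedAt_coord 1 p), val_coord, val_coord]
      ext i
      fin_cases i <;> simp
  -- the homogeneous function `V = y / a` satisfies the assumptions of the explicit construction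
  have hV : IsHomog 1 (coord 1 / a) := IsHomog.div (m := 0) (isHomog_coord 1) h.homogA ha0
  have hVne : ∀ k : ℝ, coord 1 / a ≠ const k * coord 1 := fun k hk => by
    have h1 : const k * a = 1 := by
      rw [div_eq_iff ha0] at hk
      apply mul_left_cancel₀ hy
      linear_combination -hk
    have h2 := congrArg (along ϖ ϱ) h1
    have h3 : along ϖ ϱ (const k) = 0 := by
      rw [along_apply, pd_const, pd_const, mul_zero, mul_zero, add_zero]
    rw [Derivation.leibniz, h3, h.along_a, Derivation.map_one_eq_zero, smul_zero, add_zero,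
      smul_eq_mul] at h2
    rcases mul_eq_zero.1 h2 with h4 | h4
    · rw [h4, zero_mul] at h1
      exact zero_ne_one h1
    · exact hb0 h4
  have hVcone : C ∩ N ⊆ regularCone (coord 1 / a) := by
    intro p hp
    obtain ⟨⟨a1, a2⟩, ⟨b1, b2⟩, c1, c2⟩ := hreg p hp
    have dy := definedAt_coord 1 p
    have dV := dy.div a1 a2
    have hy0 := (hSr p hp.2).2.2.2.2
    refine ⟨dV, definedAt_pd dV 0, fun h0 => ?_⟩
    -- `a_x (y ϖ - x ϱ) = y b`, by the Euler relation for `a`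
    have key : pd 0 (coord 1 / a) * (a ^ 2 * angular ϖ ϱ) = -(coord 1 ^ 2 * b) := by
      have e1 := h.homogA.euler
      have e2 := h.along_a
      have e3 : pd 0 (coord 1 / a) = -(coord 1 * pd 0 a) / a ^ 2 := by
        rw [← pdDer_apply, Derivation.leibniz_div, pdDer_apply, pdDer_apply, pd_coord,
          if_neg (by decide)]
        simp only [smul_eq_mul]
        field_simp
        ring
      rw [Nat.cast_zero, const_zero, zero_mul] at e1
      rw [along_apply] at e2
      rw [e3, angular]
      field_simp
      linear_combination ϱ * e1 - coord 1 * e2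
    have hv := congrArg (fun f => val f p) key
    rw [val_mul (definedAt_pd dV 0) ((a1.pow 2).mul c1), h0, zero_mul,
      val_neg ((dy.pow 2).mul b1), val_mul (dy.pow 2) b1, val_pow dy] at hv
    exact mul_ne_zero (pow_ne_zero 2 hy0) b2 (neg_eq_zero.1 hv.symm)
  have hdomV := isFlowDomain_regularCone hV (pd_zero_ne_zero hV hVne)
  have hchV := isChart_of_subset_regularCone hV hdomV subset_rfl
  obtain ⟨a', ha'⟩ := exists_isSolutionA hchV
  obtain ⟨u', hu'⟩ := exists_isSolutionU hchV
  -- the map `𝐱 ↦ c(𝐱) 𝐱` with `c = -b / y` is defined off the singular lines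
  have hc0 : IsHomog 0 (-(b / coord 1)) :=
    (IsHomog.div (m := 1) (n := 0) h.homogB (isHomog_coord 1) hy).neg
  have hcne : -(b / coord 1) ≠ 0 := neg_ne_zero.2 (div_ne_zero hb0 hy)
  have hcD : ∀ p ∈ C ∩ N, DefinedAt (-(b / coord 1)) p ∧ val (-(b / coord 1)) p ≠ 0 := by
    intro p hp
    obtain ⟨-, ⟨b1, b2⟩, -, y1, y2⟩ := hSr p hp.2
    refine ⟨(b1.div y1 y2).neg, ?_⟩
    rw [val_neg (b1.div y1 y2), val_div b1 y1 y2]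
    exact neg_ne_zero.2 (div_ne_zero b2 y2)
  obtain ⟨σ, hσ, hσ'⟩ := exists_radial hc0 hcne
  have eV : -(b / coord 1) * (coord 1 / a) = -(b / a) := by field_simp
  have eY : -(b / coord 1) * coord 1 = -b := by field_simp
  have hconj : ∀ {z w : ℝ} {η : Plane → Plane},
      IsStraight (regularCone (coord 1 / a)) (coord 1 / a) (coord 1) z w η →
      IsStraight (C ∩ N) (-(b / a)) (-b) z w (conj σ η) := fun hη => by
    have := (hη.mono hVcone).conj_radial hdom hc0 hcD hV (isHomog_coord 1)
      (fun p hp => (hVcone hp).1) (fun p _ => definedAt_coord 1 p) hσ hσ'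
    rwa [eV, eY] at this
  refine ⟨coord 1 / a, a', u', σ, C ∩ N, hV, hVne, ha', hu', fun i => ?_, hdom, hsub,
    hφ.domain.subset_closure_inter hS0, fun p hp => ?_,
    hch.germEq sφ (hconj (hu'.isStraight hV hdomV subset_rfl)),
    hch.germEq sψ (hconj (ha'.isStraight hV hdomV subset_rfl))⟩
  · rw [hσ]
    exact hc0.mul (isHomog_coord i)
  · obtain ⟨c1, c2⟩ := hcD p hp
    obtain ⟨h1, h2⟩ := birMap_radial hσ c1
    have hm := hdom.smul_mem p hp _ c2
    rw [h2]
    exact ⟨h1, (birMap_radial hσ' ((hcD _ hm).1.inv (hcD _ hm).2)).1, hVcone hm⟩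

end ProjFlow

theorem mainTheorem1 :
    -- two commuting flows, neither a power of the other, are algebraic of level one
    (∀ (C : Set ProjFlow.Plane) (φ ψ : ProjFlow.Plane → ProjFlow.Plane)
        (ϖ ϱ α β : ProjFlow.RatFun),
      ProjFlow.IsProjectiveFlow C φ → ProjFlow.IsProjectiveFlow C ψ →
      ¬ ProjFlow.GermEq C φ id → ¬ ProjFlow.GermEq C ψ id →
      ProjFlow.HasRationalField C φ ϖ ϱ → ProjFlow.HasRationalField C ψ α β →
      ProjFlow.Commutes C φ ψ →
      ProjFlow.coord 1 * ϖ - ProjFlow.coord 0 * ϱ ≠ 0 →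
      (∀ c : ℝ, ¬ ProjFlow.GermEq C ψ (ProjFlow.flowPow φ c)) →
      ProjFlow.IsAlgebraicFlowOfLevelOne C φ ∧ ProjFlow.IsAlgebraicFlowOfLevelOne C ψ) ∧
    -- all flows that commute with an algebraic flow of level one
    (∀ (C : Set ProjFlow.Plane) (φ : ProjFlow.Plane → ProjFlow.Plane),
      ProjFlow.IsAlgebraicFlowOfLevelOne C φ →
      ∃ (C' : Set ProjFlow.Plane) (ψ : ProjFlow.Plane → ProjFlow.Plane),
        C' ⊆ C ∧ C ⊆ closure C' ∧
        ProjFlow.IsAlgebraicFlowOfLevelOne C' ψ ∧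
        (∀ c : ℝ, ¬ ProjFlow.GermEq C' ψ (ProjFlow.flowPow φ c)) ∧
        (∀ z w : ℝ,
          ProjFlow.IsProjectiveFlow C' (ProjFlow.flowPow φ z ∘ ProjFlow.flowPow ψ w) ∧
          ProjFlow.Commutes C' φ (ProjFlow.flowPow φ z ∘ ProjFlow.flowPow ψ w)) ∧
        (∀ (D : Set ProjFlow.Plane) (η : ProjFlow.Plane → ProjFlow.Plane), D ⊆ C →
          ProjFlow.IsProjectiveFlow D η →
          (ProjFlow.IsDoubleSector D ∨
            ∃ γ δ : ProjFlow.RatFun, ProjFlow.HasRationalField D η γ δ) →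
          ProjFlow.Commutes D φ η →
          ∃ z w : ℝ, ProjFlow.GermEq (D ∩ C') η
            (ProjFlow.flowPow φ z ∘ ProjFlow.flowPow ψ w))) ∧
    -- the explicit construction, and the orbits
    (∀ V : ProjFlow.RatFun, ProjFlow.IsHomog 1 V →
      (∀ c : ℝ, V ≠ ProjFlow.const c * ProjFlow.coord 1) →
      ProjFlow.IsFlowDomain (ProjFlow.regularCone V) ∧ Dense (ProjFlow.regularCone V) ∧
      (∃ a : ProjFlow.Plane → ℝ, ProjFlow.IsSolutionA V (ProjFlow.regularCone V) a) ∧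
      (∃ u : ProjFlow.Plane → ℝ, ProjFlow.IsSolutionU V (ProjFlow.regularCone V) u) ∧
      ∀ (C : Set ProjFlow.Plane) (a u : ProjFlow.Plane → ℝ),
        ProjFlow.IsFlowDomain C → C ⊆ ProjFlow.regularCone V →
        ProjFlow.IsSolutionA V C a → ProjFlow.IsSolutionU V C u →
        ProjFlow.IsAlgebraicFlowOfLevelOne C (ProjFlow.flowOfA a) ∧
        ProjFlow.IsAlgebraicFlowOfLevelOne C (ProjFlow.flowOfU u) ∧
        ProjFlow.Commutes C (ProjFlow.flowOfU u) (ProjFlow.flowOfA a) ∧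
        (ProjFlow.IsRationalFun C a ↔ ProjFlow.IsRationalFun C u) ∧
        ∀ z w : ℝ,
          ProjFlow.IsProjectiveFlow C
            (ProjFlow.flowPow (ProjFlow.flowOfU u) z ∘ ProjFlow.flowPow (ProjFlow.flowOfA a) w) ∧
          ProjFlow.GermEq C
            (ProjFlow.flowPow (ProjFlow.flowOfU u) z ∘ ProjFlow.flowPow (ProjFlow.flowOfA a) w)
            (fun q => ![ProjFlow.firstPow u z ![ProjFlow.firstPow a w q, q 1 / (1 + w * q 1)],
              q 1 / (1 + w * q 1)]) ∧
          ((z, w) ≠ (0, 0) →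
            ProjFlow.const z * V + ProjFlow.const w * ProjFlow.coord 1 ≠ 0 ∧
            (∃ γ δ : ProjFlow.RatFun,
              ProjFlow.HasRationalField C (ProjFlow.flowPow (ProjFlow.flowOfU u) z ∘
                ProjFlow.flowPow (ProjFlow.flowOfA a) w) γ δ ∧
              ProjFlow.IsOrbitFunction γ δ (V * ProjFlow.coord 1 /
                (ProjFlow.const z * V + ProjFlow.const w * ProjFlow.coord 1))) ∧
            ProjFlow.IsConserved C
              (ProjFlow.flowPow (ProjFlow.flowOfU u) z ∘ ProjFlow.flowPow (ProjFlow.flowOfA a) w)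
              (V * ProjFlow.coord 1 /
                (ProjFlow.const z * V + ProjFlow.const w * ProjFlow.coord 1)))) ∧
    -- every pair arises from the construction by a conjugation
    (∀ (C : Set ProjFlow.Plane) (φ ψ : ProjFlow.Plane → ProjFlow.Plane),
      ProjFlow.IsAlgebraicFlowOfLevelOne C φ → ProjFlow.IsAlgebraicFlowOfLevelOne C ψ →
      ProjFlow.Commutes C φ ψ →
      (∀ c : ℝ, ¬ ProjFlow.GermEq C ψ (ProjFlow.flowPow φ c)) →
      ∃ (V : ProjFlow.RatFun) (a u : ProjFlow.Plane → ℝ)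
        (σ : ProjFlow.RatFun ≃ₐ[ℝ] ProjFlow.RatFun) (D : Set ProjFlow.Plane),
        ProjFlow.IsHomog 1 V ∧ (∀ c : ℝ, V ≠ ProjFlow.const c * ProjFlow.coord 1) ∧
        ProjFlow.IsSolutionA V (ProjFlow.regularCone V) a ∧
        ProjFlow.IsSolutionU V (ProjFlow.regularCone V) u ∧
        ProjFlow.IsOneBir σ ∧
        ProjFlow.IsFlowDomain D ∧ D ⊆ C ∧ C ⊆ closure D ∧
        (∀ p ∈ D, ProjFlow.BirDefinedAt σ p ∧
          ProjFlow.BirDefinedAt σ.symm (ProjFlow.birMap σ p) ∧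
          ProjFlow.birMap σ p ∈ ProjFlow.regularCone V) ∧
        ProjFlow.GermEq D φ (ProjFlow.conj σ (ProjFlow.flowOfU u)) ∧
        ProjFlow.GermEq D ψ (ProjFlow.conj σ (ProjFlow.flowOfA a))) := by
  refine ⟨fun C φ ψ ϖ ϱ α β hφ hψ _ _ hF hG hc hD hne =>
    ProjFlow.isAlgebraicFlowOfLevelOne_of_commutes hφ hψ hF hG hc hD hne, ?_, ?_, ?_⟩
  · exact fun C φ hφ => ProjFlow.exists_centralizer hφ
  · intro V hV hne
    have hV0 := ProjFlow.pd_zero_ne_zero hV hne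
    have hdom := ProjFlow.isFlowDomain_regularCone hV hV0
    have hch := ProjFlow.isChart_of_subset_regularCone hV hdom subset_rfl
    refine ⟨hdom, ProjFlow.dense_regularCone hV0, ProjFlow.exists_isSolutionA hch,
      ProjFlow.exists_isSolutionU hch, fun C a u hC hCV ha hu => ?_⟩
    have h := ProjFlow.isChart_of_subset_regularCone hV hC hCV
    have hA := ha.isStraight hV hC hCV
    have hU := hu.isStraight hV hC hCV
    refine ⟨h.isAlgebraicFlowOfLevelOne_right hA, h.isAlgebraicFlowOfLevelOne_left hU,
      h.commutes hU hA, ProjFlow.isRationalFun_iff hV hne hC hCV ha hu, fun z w => ?_⟩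
    have hzw := ProjFlow.isStraight_flowPow_comp hV hC hCV ha hu z w
    exact ⟨h.isProjectiveFlow hzw, fun p _ => Filter.Eventually.of_forall fun x _ =>
      ProjFlow.flowPow_flowOfU_comp_flowPow_flowOfA a u z w _, fun h0 => ⟨h.add_ne_zero h0,
        ⟨_, _, h.hasRationalField hzw, h.isOrbitFunction h0⟩, h.isConserved hzw h0⟩⟩
  · exact fun C φ ψ hφ hψ hc hne => ProjFlow.exists_conj_of_commutes hφ hψ hc hne
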